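/- Let $n\ge 4$, $p\ge 3$ be integers. Let $X_1,\dots,X_n$ be independent centered random vectors in $\mathbb{R}^p$ with finite second moments, and let $Y_1,\dots,Y_n$ be independent Gaussian vectors with $Y_i\sim N(0,\mathrm{E}[X_iX_i'])$. Put $S_n^X=n^{-1/2}\sum_{i=1}^n X_i$, $S_n^Y=n^{-1/2}\sum_{i=1}^n Y_i$ and, for a class $\mathcal{A}$ of Borel subsets of $\mathbb{R}^p$, $\rho_n(\mathcal{A})=\sup_{A\in\mathcal{A}}|\Pr(S_n^X\in A)-\Pr(S_n^Y\in A)|$. For $K\subset\mathbb{R}^p$ let $\mathcal{S}_K(v)=\sup\{w'v: w\in K\}\in[-\infty,\infty]$. A set $A^m\subset\mathbb{R}^p$ is called $m$-generated, with set of normals $\mathcal{V}(A^m)$, if $\mathcal{V}(A^m)$ is a set of $m$ unit vectors and $A^m=\bigcap_{v\in\mathcal{V}(A^m)}\{w: w'v\le \mathcal{S}_{A^m}(v)\}$; for $\epsilon\ge 0$ put $A^{m,\epsilon}=\bigcap_{v\in\mathcal{V}(A^m)}\{w: w'v\le \mathcal{S}_{A^m}(v)+\epsilon\}$. For $a\ge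 0$ and $d>0$ let $\mathcal{A}^{\mathrm{si}}(a,d)$ be the class of all Borel sets $A\subset\mathbb{R}^p$ for which there is an $m$-generated set $A^m=A^m(A)$ with $m\le (pn)^d$ and $A^m\subset A\subset A^{m,\epsilon}$ for $\epsilon=a/n$ (simple convex sets; convexity of $A$ itself is not required). Let $b,q>0$ and $B_n\ge 1$ be constants. For $A\in\mathcal{A}^{\mathrm{si}}(a,d)$ with approximating set $A^m=A^m(A)$ consider the conditions (M.1$'$) $n^{-1}\sum_{i=1}^n\mathrm{E}[(v'X_i)^2]\ge b$ for all $v\in\mathcal{V}(A^m)$; (M.2$'$) $n^{-1}\sum_{i=1}^n\mathrm{E}[|v'X_i|^{2+k}]\le B_n^k$ for all $v\in\mathcal{V}(A^m)$ and $k=1,2$; (E.1$'$) $\mathrm{E}[\exp(|v'X_i|/B_n)]\le 2$ for all $i=1,\dots,n$ and $v\in\mathcal{V}(A^m)$; (E.2$'$) $\mathrm{E}[(\max_{v\in\mathcal{V}(A^m)}|v'X_i|/B_n)^q]\le 2$ for all $i=1,\dots,n$. Let $$D_n^{(1)}=\Big(\frac{B_n^2\log^7(pn)}{n}\Big)^{1/6},\qquad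 D_{n,q}^{(2)}=\Big(\frac{B_n^2\log^3(pn)}{n^{1-2/q}}\Big)^{1/3}.$$ Let $\mathcal{A}$ be a subclass of $\mathcal{A}^{\mathrm{si}}(a,d)$ such that (M.1$'$), (M.2$'$) and (E.1$'$) hold for every $A\in\mathcal{A}$. Then $\rho_n(\mathcal{A})\le C D_n^{(1)}$, where the constant $C$ depends only on $a$, $b$ and $d$. If, instead of (E.1$'$), condition (E.2$'$) holds for every $A\in\mathcal{A}$, then $\rho_n(\mathcal{A})\le C\{D_n^{(1)}+D_{n,q}^{(2)}\}$, where $C$ depends only on $a$, $b$, $d$ and $q$. -/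

import Mathlib

open MeasureTheory ProbabilityTheory
open scoped ENNReal

noncomputable section

namespace HighDimCLT

/-- `ℝ^p` with the Euclidean inner product and norm. -/
abbrev Vec (p : ℕ) : Type := EuclideanSpace ℝ (Fin p)

/-- The normalized sum `n^{-1/2} ∑_i X_i`. -/
def normalizedSum {Ω : Type*} {n p : ℕ} (X : Fin n → Ω → Vec p) (ω : Ω) : Vec p :=
  (Real.sqrt (n : ℝ))⁻¹ • ∑ i, X i ω

/-- `X_1, …, X_n` are independent centered random vectors in `ℝ^p` with finite second moments, and
`Y_1, …, Y_n` are independent centered Gaussian random vectors in `ℝ^p` such that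
`E[Y_i Y_i'] = E[X_i X_i']`, i.e. `Y_i ∼ N(0, E[X_i X_i'])` (possibly degenerate).
The vectors `Y_i` may live on another probability space. -/
structure GaussianAnalogue {Ω Ω' : Type*} [MeasurableSpace Ω] [MeasurableSpace Ω'] {n p : ℕ}
    (P : Measure Ω) (X : Fin n → Ω → Vec p) (P' : Measure Ω') (Y : Fin n → Ω' → Vec p) :
    Prop where
  indep_X : iIndepFun X P
  memLp_X : ∀ i, MemLp (X i) 2 P
  centered_X : ∀ i j, ∫ ω, X i ω j ∂P = 0
  indep_Y : iIndepFun Y P'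
  gaussian_Y : ∀ i, HasGaussianLaw (Y i) P'
  centered_Y : ∀ i j, ∫ ω, Y i ω j ∂P' = 0
  cov_eq : ∀ i j k, ∫ ω, Y i ω j * Y i ω k ∂P' = ∫ ω, X i ω j * X i ω k ∂P

/-- `ρ_n(𝒜) = sup_{A ∈ 𝒜} |P(S_n^X ∈ A) - P(S_n^Y ∈ A)|`. The supremum is over a family of numbers
in `[0, 1]`; it is `0` when `𝒜` is empty. -/
def rho {Ω Ω' : Type*} [MeasurableSpace Ω] [MeasurableSpace Ω'] {n p : ℕ}
    (P : Measure Ω) (X : Fin n → Ω → Vec p) (P' : Measure Ω') (Y : Fin n → Ω' → Vec p)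
    (𝒜 : Set (Set (Vec p))) : ℝ :=
  ⨆ A : 𝒜, |P.real {ω | normalizedSum X ω ∈ (A : Set (Vec p))}
    - P'.real {ω | normalizedSum Y ω ∈ (A : Set (Vec p))}|

/-- The support function `S_A(v) = sup {w'v : w ∈ A}`, with values in the extended reals
(`⊤` if `A` is unbounded in direction `v`, `⊥` if `A` is empty). -/
def supportFun {p : ℕ} (A : Set (Vec p)) (v : Vec p) : EReal :=
  ⨆ w ∈ A, ((inner ℝ w v : ℝ) : EReal)

/-- For `ε ≥ 0`, the set `A^{m,ε} = ⋂_{v ∈ V} {w : w'v ≤ S_A(v) + ε}`. -/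
def enlargement {p : ℕ} (V : Finset (Vec p)) (A : Set (Vec p)) (ε : ℝ) : Set (Vec p) :=
  {w | ∀ v ∈ V, ((inner ℝ w v : ℝ) : EReal) ≤ supportFun A v + (ε : EReal)}

/-- `A` is generated by the half-spaces with outward unit normals in the finite set `V`:
`A = ⋂_{v ∈ V} {w : w'v ≤ S_A(v)}`. Such an `A` is an `m`-generated convex set with `m` the number
of elements of `V`. -/
def GeneratedBy {p : ℕ} (V : Finset (Vec p)) (A : Set (Vec p)) : Prop :=
  (∀ v ∈ V, ‖v‖ = 1) ∧ A = {w | ∀ v ∈ V, ((inner ℝ w v : ℝ) : EReal) ≤ supportFun A v}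

/-- Condition (C) for `A`, with the approximating `m`-generated convex set `Am` and its set of
normals `V`: `m ≤ (p n)^d` and `Am ⊆ A ⊆ Am^{m,ε}` with `ε = a / n`. -/
structure IsSimpleApprox {p : ℕ} (n : ℕ) (a d : ℝ) (A : Set (Vec p))
    (V : Finset (Vec p)) (Am : Set (Vec p)) : Prop where
  generated : GeneratedBy V Am
  card_le : (V.card : ℝ) ≤ ((p : ℝ) * (n : ℝ)) ^ d
  subset : Am ⊆ A
  subset_enlargement : A ⊆ enlargement V Am (a / (n : ℝ))

/-- The class `𝒜^si(a, d)` of all Borel sets that satisfy condition (C). -/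
def simpleConvex (n p : ℕ) (a d : ℝ) : Set (Set (Vec p)) :=
  {A | MeasurableSet A ∧ ∃ (V : Finset (Vec p)) (Am : Set (Vec p)), IsSimpleApprox n a d A V Am}

section Moments

variable {Ω : Type*} [MeasurableSpace Ω] {n p : ℕ}

/-- The expectation, in `[0, ∞]`, of a nonnegative random variable. -/
def expect (P : Measure Ω) (f : Ω → ℝ) : ℝ≥0∞ := ∫⁻ ω, ENNReal.ofReal (f ω) ∂P

/-- (M.1'): `n^{-1} ∑_i E[(v'X_i)^2] ≥ b` for all `v ∈ V`. -/
def CondM1 (P : Measure Ω) (X : Fin n → Ω → Vec p) (b : ℝ) (V : Finset (Vec p)) : Prop :=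
  ∀ v ∈ V, ENNReal.ofReal b ≤ (n : ℝ≥0∞)⁻¹ * ∑ i, expect P (fun ω => (inner ℝ v (X i ω)) ^ 2)

/-- (M.2'): `n^{-1} ∑_i E[|v'X_i|^{2+k}] ≤ B^k` for all `v ∈ V` and `k = 1, 2`. -/
def CondM2 (P : Measure Ω) (X : Fin n → Ω → Vec p) (B : ℝ) (V : Finset (Vec p)) : Prop :=
  ∀ v ∈ V, ∀ k ∈ ({1, 2} : Finset ℕ),
    (n : ℝ≥0∞)⁻¹ * ∑ i, expect P (fun ω => |inner ℝ v (X i ω)| ^ (2 + k)) ≤ ENNReal.ofReal (B ^ k)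

/-- (E.1'): `E[exp(|v'X_i| / B)] ≤ 2` for all `i` and all `v ∈ V`. -/
def CondE1 (P : Measure Ω) (X : Fin n → Ω → Vec p) (B : ℝ) (V : Finset (Vec p)) : Prop :=
  ∀ i, ∀ v ∈ V, expect P (fun ω => Real.exp (|inner ℝ v (X i ω)| / B)) ≤ 2

/-- (E.2'): `E[(max_{v ∈ V} |v'X_i| / B)^q] ≤ 2` for all `i`. -/
def CondE2 (P : Measure Ω) (X : Fin n → Ω → Vec p) (B q : ℝ) (V : Finset (Vec p)) : Prop :=
  ∀ i, expect P (fun ω => (⨆ v : V, |inner ℝ (v : Vec p) (X i ω)| / B) ^ q) ≤ 2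

end Moments

/-- `D_n^{(1)} = (B² log⁷(pn) / n)^{1/6}`. -/
def D1 (n p : ℕ) (B : ℝ) : ℝ :=
  (B ^ 2 * Real.log ((p : ℝ) * (n : ℝ)) ^ 7 / (n : ℝ)) ^ (1 / 6 : ℝ)

/-- `D_{n,q}^{(2)} = (B² log³(pn) / n^{1 - 2/q})^{1/3}`. -/
def D2 (n p : ℕ) (B q : ℝ) : ℝ :=
  (B ^ 2 * Real.log ((p : ℝ) * (n : ℝ)) ^ 3 / (n : ℝ) ^ (1 - 2 / q)) ^ (1 / 3 : ℝ)

end HighDimCLT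

end

set_option linter.unusedSectionVars false

noncomputable section

namespace HighDimCLT

/-! ### A smooth cutoff function -/

/-! The proof is a Lindeberg replacement argument for rectangles in the coordinates `v'x`, closed by
a self-bounding inequality, followed by a sandwich for simple convex sets.

Smoothing. The vectors `v'X_i` are multiplied by `β / √n`, and the indicator of a shifted negative
orthant is replaced by `G (logSumExp w)`, where `G` falls from `1` to `0` on `[c, 2c]` and `c ≥ log
(card J)`. This costs a shift of the rectangle by `2c` in the rescaled coordinates, that is, by `2c
/ β` in the original ones. The third derivative in a direction `x` is at most a constant times `(K /
c) ∑ π_j |x_j|^3` with softmax weights `π`, and it vanishes unless `c ≤ logSumExp ≤ 2c`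
(`abs_smoothInd_sub_taylor_le`). Thus the third-order error involves third moments of single
coordinates, weighted by the chance that the sum lies in a shell around the boundary of the
rectangle, and not the third moment of a maximum. Increments of norm above `1` are charged to
`tailSq`.

Replacement. Each summand is of type `X` with probability `θ` and of type `Y` otherwise,
independently over `i`. The derivative in `θ` of an expectation is the mean over all choices of the
sum of the single-swap differences (`hasDerivAt_bernExp`). For a fixed choice, all swaps are
compared with the same full sum, so the weights on coordinate `j` do not depend on `i`. Third
moments can therefore be summed over `i` before the maximum over `j` is taken
(`sum_abs_integral_smoothInd_update_sub_le`); this is why averaged moment conditions for single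
directions are enough.

Self-bounding. Let `S` be the supremum over `θ` and over all rectangles of the distance between the
mixed law and the Gaussian one. The shell probability under a mixture is at most `2S` plus the
Gaussian probability of the shell, which Nazarov's inequality (`gaussian_anticoncentration`) bounds
by a multiple of its width. Once the third-moment coefficient is small, this reads `S ≤ S / 2 +
...`, and solving for `S` yields `abs_mixCdf_sub_le`.

Nazarov's inequality is proved by splitting the event that some constraint fails according to the
first most violated constraint `j`. Given the part of the vector independent of `V_j`, the set of
values of `V_j` realising this case is upward closed, and a Gaussian half-line starting no further
than about `R` has mass at least of order `1 / R` times its initial density.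

Rates. With `L = log (pn)`, the choices are `c = (d + 1) L` and `β = κ L^{3/2} / D`, where `D` is
the target rate. The smoothing error is then of order `√L · c / β`, hence of order `D`; the
third-moment condition becomes `B L^{7/2} ≤ D^3 √n`, which defines `D1`; and the tail term is
negligible under (E.1') and produces `D2` under (E.2'). `IsSimpleApprox.abs_prob_sub_le` passes from
rectangles to simple convex sets at the price of one more use of anti-concentration, with width `a /
n`. -/

/-- A three times differentiable cutoff, equal to `1` on `(-∞, c]` and to `0` on `[2c, ∞)`, whose
first three derivatives are bounded by `K / c`. -/
structure SmoothCutoff (K c : ℝ) where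
  G : ℝ → ℝ
  G1 : ℝ → ℝ
  G2 : ℝ → ℝ
  G3 : ℝ → ℝ
  hasDerivAt_G : ∀ u, HasDerivAt G (G1 u) u
  hasDerivAt_G1 : ∀ u, HasDerivAt G1 (G2 u) u
  hasDerivAt_G2 : ∀ u, HasDerivAt G2 (G3 u) u
  nonneg : ∀ u, 0 ≤ G u
  le_one : ∀ u, G u ≤ 1
  eq_one : ∀ u, u ≤ c → G u = 1
  eq_zero : ∀ u, 2 * c ≤ u → G u = 0
  abs_G1 : ∀ u, |G1 u| ≤ K / c
  abs_G2 : ∀ u, |G2 u| ≤ K / c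
  abs_G3 : ∀ u, |G3 u| ≤ K / c
  support : ∀ u, u < c ∨ 2 * c < u → G1 u = 0 ∧ G2 u = 0 ∧ G3 u = 0

theorem hasDerivAt_deriv_of_contDiff_top {f : ℝ → ℝ} (hf : ∀ n : ℕ, ContDiff ℝ n f) (u : ℝ) :
    HasDerivAt f (deriv f u) u :=
  (((hf 1).differentiable (by norm_num)) u).hasDerivAt

theorem contDiff_deriv_of_forall {f : ℝ → ℝ} (hf : ∀ n : ℕ, ContDiff ℝ n f) (n : ℕ) :
    ContDiff ℝ n (deriv f) := by
  have h := hf (n + 1)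
  push_cast at h
  exact (contDiff_succ_iff_deriv.1 h).2.2

theorem deriv_eq_zero_outside {f : ℝ → ℝ} {a b : ℝ} {s t : ℝ}
    (ha : ∀ u, u < a → f u = s) (hb : ∀ u, b < u → f u = t) :
    (∀ u, u < a → deriv f u = 0) ∧ (∀ u, b < u → deriv f u = 0) := by
  constructor
  · intro u hu
    have : f =ᶠ[nhds u] fun _ => s := by
      filter_upwards [Iio_mem_nhds hu] with x hx using ha x hx
    rw [this.deriv_eq]; simp
  · intro u hu
    have : f =ᶠ[nhds u] fun _ => t := by
      filter_upwards [Ioi_mem_nhds hu] with x hx using hb x hx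
    rw [this.deriv_eq]; simp

theorem exists_abs_le_of_eq_zero_outside {f : ℝ → ℝ} {a b : ℝ} (hf : Continuous f)
    (ha : ∀ u, u < a → f u = 0) (hb : ∀ u, b < u → f u = 0) : ∃ K, ∀ u, |f u| ≤ K := by
  obtain ⟨K, hK⟩ := (isCompact_Icc (a := a) (b := b)).exists_bound_of_continuousOn hf.continuousOn
  refine ⟨max K 0, fun u => ?_⟩
  by_cases h1 : u < a
  · simp [ha u h1]
  by_cases h2 : b < u
  · simp [hb u h2]
  exact (hK u ⟨not_lt.1 h1, not_lt.1 h2⟩).trans (le_max_left _ _)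

theorem exists_smoothCutoff : ∃ K : ℝ, 1 ≤ K ∧ ∀ c : ℝ, 1 ≤ c → Nonempty (SmoothCutoff K c) := by
  set S := Real.smoothTransition
  have hS : ∀ n : ℕ, ContDiff ℝ n S := fun n => by
    have := Real.smoothTransition.contDiff (n := (n : ℕ∞))
    exact_mod_cast this
  have hS1 := contDiff_deriv_of_forall hS
  have hS2 := contDiff_deriv_of_forall hS1
  have hS3 := contDiff_deriv_of_forall hS2
  have z1 := deriv_eq_zero_outside (f := S) (a := 0) (b := 1) (s := 0) (t := 1)
    (fun u hu => Real.smoothTransition.zero_of_nonpos hu.le)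
    (fun u hu => Real.smoothTransition.one_of_one_le hu.le)
  have z2 := deriv_eq_zero_outside z1.1 z1.2
  have z3 := deriv_eq_zero_outside z2.1 z2.2
  obtain ⟨K1, hK1⟩ := exists_abs_le_of_eq_zero_outside (hS1 0).continuous z1.1 z1.2
  obtain ⟨K2, hK2⟩ := exists_abs_le_of_eq_zero_outside (hS2 0).continuous z2.1 z2.2
  obtain ⟨K3, hK3⟩ := exists_abs_le_of_eq_zero_outside (hS3 0).continuous z3.1 z3.2
  have n1 := (abs_nonneg _).trans (hK1 0)
  have n2 := (abs_nonneg _).trans (hK2 0)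
  have n3 := (abs_nonneg _).trans (hK3 0)
  -- Rescaling by `c` makes the `k`-th derivative of order `c^{-k}`, but for `c ≥ 1` all three are
  -- bounded by a multiple of `1 / c`, which is all that is used later. The summand `1` only ensures
  -- `1 ≤ K`.
  refine ⟨K1 + K2 + K3 + 1, by linarith, fun c hc => ?_⟩
  have c0 : 0 < c := by linarith
  have hin : ∀ u : ℝ, HasDerivAt (fun u => 2 - u / c) (-(1 / c)) u := fun u => by
    simpa using ((hasDerivAt_id u).div_const c).const_sub 2
  have comp : ∀ {f : ℝ → ℝ}, (∀ n : ℕ, ContDiff ℝ n f) → ∀ (k : ℝ) (u : ℝ),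
      HasDerivAt (fun u => k * f (2 - u / c)) (k * (-(1 / c)) * deriv f (2 - u / c)) u := by
    intro f hf k u
    have := ((hasDerivAt_deriv_of_contDiff_top hf (2 - u / c)).comp u (hin u)).const_mul k
    refine this.congr_deriv ?_
    ring
  have i1 : 1 / c ≤ 1 := by rw [div_le_one c0]; exact hc
  have i0 : 0 < 1 / c := by positivity
  have bd : ∀ (f : ℝ → ℝ) (M k : ℝ), (∀ u, |f u| ≤ M) → |k| ≤ 1 / c → M ≤ K1 + K2 + K3 + 1 →
      ∀ u, |k * f (2 - u / c)| ≤ (K1 + K2 + K3 + 1) / c := by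
    intro f M k hM hk hMK u
    rw [abs_mul, mul_comm, div_eq_mul_one_div (K1 + K2 + K3 + 1) c]
    exact mul_le_mul ((hM _).trans hMK) hk (abs_nonneg _) (by linarith)
  -- The cutoff is `u ↦ S (2 - u / c)`; the leading `1 *` lets the single statement `comp` produce
  -- all three derivatives.
  refine ⟨⟨fun u => 1 * S (2 - u / c), fun u => 1 * (-(1 / c)) * deriv S (2 - u / c),
    fun u => 1 * (-(1 / c)) * (-(1 / c)) * deriv (deriv S) (2 - u / c),
    fun u => 1 * (-(1 / c)) * (-(1 / c)) * (-(1 / c)) * deriv (deriv (deriv S)) (2 - u / c),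
    comp hS _, comp hS1 _, comp hS2 _, ?_, ?_, ?_, ?_, bd _ _ _ hK1 ?_ ?_,
    bd _ _ _ hK2 ?_ ?_, bd _ _ _ hK3 ?_ ?_, ?_⟩⟩
  · intro u; simpa using Real.smoothTransition.nonneg _
  · intro u; simpa using Real.smoothTransition.le_one _
  · intro u hu
    have : u / c ≤ 1 := by rwa [div_le_one c0]
    rw [one_mul]
    exact Real.smoothTransition.one_of_one_le (by linarith)
  · intro u hu
    have : 2 ≤ u / c := by rwa [le_div_iff₀ c0]
    rw [one_mul]
    exact Real.smoothTransition.zero_of_nonpos (by linarith)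
  · simp [abs_of_pos c0]
  · linarith
  · rw [one_mul, neg_mul_neg, abs_of_nonneg (by positivity)]; nlinarith
  · linarith
  · have h2 : 1 / c * (1 / c) ≤ 1 := by nlinarith
    rw [one_mul, neg_mul_neg, mul_neg, abs_neg, abs_of_nonneg (by positivity)]
    nlinarith
  · linarith
  · rintro u (hu | hu)
    · have : 1 < 2 - u / c := by
        have : u / c < 1 := by rwa [div_lt_one c0]
        linarith
      simp [z1.2 _ this, z2.2 _ this, z3.2 _ this]
    · have : 2 - u / c < 0 := by
        have : 2 < u / c := by rwa [lt_div_iff₀ c0]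
        linarith
      simp [z1.1 _ this, z2.1 _ this, z3.1 _ this]

/-! ### Second order Taylor expansion along a segment -/

theorem abs_le_of_hasDerivAt_of_abs_deriv_le {u u' : ℝ → ℝ} {M : ℝ} (h0 : u 0 = 0)
    (hu : ∀ r, HasDerivAt u (u' r) r) (hM : ∀ r ∈ Set.Icc (0 : ℝ) 1, |u' r| ≤ M) :
    ∀ r ∈ Set.Icc (0 : ℝ) 1, |u r| ≤ M := by
  intro r hr
  have h := (convex_Icc (0 : ℝ) 1).norm_image_sub_le_of_norm_hasDerivWithin_le
    (fun x _ => (hu x).hasDerivWithinAt) hM (Set.left_mem_Icc.2 zero_le_one) hr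
  have hM0 : 0 ≤ M := (abs_nonneg _).trans (hM 0 (Set.left_mem_Icc.2 zero_le_one))
  rw [h0, sub_zero, sub_zero, Real.norm_eq_abs, Real.norm_eq_abs, abs_of_nonneg hr.1] at h
  exact h.trans (mul_le_of_le_one_right hM0 hr.2)

/-- Three applications of the mean value bound on `[0, 1]`, each integrating the previous remainder.
The factor `1 / 6` is given away. -/
theorem abs_sub_taylor_two_le {f f1 f2 f3 : ℝ → ℝ} {M : ℝ} (h1 : ∀ r, HasDerivAt f (f1 r) r)
    (h2 : ∀ r, HasDerivAt f1 (f2 r) r) (h3 : ∀ r, HasDerivAt f2 (f3 r) r)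
    (hM : ∀ r ∈ Set.Icc (0 : ℝ) 1, |f3 r| ≤ M) :
    |f 1 - (f 0 + f1 0 + f2 0 / 2)| ≤ M := by
  have b2 := abs_le_of_hasDerivAt_of_abs_deriv_le (u := fun r => f2 r - f2 0) (by simp)
    (fun r => (h3 r).sub_const _) hM
  have b1 := abs_le_of_hasDerivAt_of_abs_deriv_le (u := fun r => f1 r - f1 0 - f2 0 * r)
    (by simp) (fun r => (((h2 r).sub_const (f1 0)).fun_sub
      ((hasDerivAt_id r).const_mul (f2 0))).congr_deriv (by simp)) b2
  have b0 := abs_le_of_hasDerivAt_of_abs_deriv_le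
    (u := fun r => f r - f 0 - f1 0 * r - f2 0 / 2 * r ^ 2)
    (by simp) (fun r => ((((h1 r).sub_const (f 0)).fun_sub
      ((hasDerivAt_id r).const_mul (f1 0))).fun_sub
        ((hasDerivAt_pow 2 r).const_mul (f2 0 / 2))).congr_deriv (by simp; ring)) b1
  have := b0 1 (by simp)
  convert this using 2
  simp; ring

/-! ### The soft maximum -/

section SoftMax

variable {J : Type*} [Fintype J]

/-- `∑_j exp(w_j)`. -/
def expSum (w : J → ℝ) : ℝ := ∑ j, Real.exp (w j)

/-- The softmax weights `exp(w_j) / ∑_k exp(w_k)`. -/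
def softmax (w : J → ℝ) (j : J) : ℝ := Real.exp (w j) / expSum w

/-- The soft maximum `log ∑_j exp(w_j)`. -/
def logSumExp (w : J → ℝ) : ℝ := Real.log (expSum w)

/-- The softmax weights, cut off outside `{lo ≤ logSumExp ≤ hi}`. -/
def shellWeight (lo hi : ℝ) (w : J → ℝ) (j : J) : ℝ :=
  if lo ≤ logSumExp w ∧ logSumExp w ≤ hi then softmax w j else 0

/-- The moments `∑_j π_j x_j ^ k` under the softmax weights `π` at `w`. -/
def softMoment (k : ℕ) (w x : J → ℝ) : ℝ := ∑ j, softmax w j * x j ^ k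

/-! ### Stability of the softmax weights and of the shell -/

theorem expSum_nonneg (w : J → ℝ) : 0 ≤ expSum w := Finset.sum_nonneg fun _ _ => (Real.exp_pos _).le

theorem expSum_pos [Nonempty J] (w : J → ℝ) : 0 < expSum w :=
  Finset.sum_pos (fun _ _ => Real.exp_pos _) Finset.univ_nonempty

theorem softmax_nonneg (w : J → ℝ) (j : J) : 0 ≤ softmax w j :=
  div_nonneg (Real.exp_pos _).le (expSum_nonneg w)

theorem sum_softmax [Nonempty J] (w : J → ℝ) : ∑ j, softmax w j = 1 := by
  unfold softmax
  rw [← Finset.sum_div]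
  exact div_self (expSum_pos w).ne'

theorem softmax_le_one [Nonempty J] (w : J → ℝ) (j : J) : softmax w j ≤ 1 := by
  rw [← sum_softmax w]
  exact Finset.single_le_sum (fun k _ => softmax_nonneg w k) (Finset.mem_univ j)

theorem le_logSumExp [Nonempty J] (w : J → ℝ) (j : J) : w j ≤ logSumExp w := by
  unfold logSumExp
  rw [Real.le_log_iff_exp_le (expSum_pos w)]
  exact Finset.single_le_sum (f := fun j => Real.exp (w j)) (fun k _ => (Real.exp_pos _).le)
    (Finset.mem_univ j)

theorem logSumExp_le_add [Nonempty J] {w w' : J → ℝ} {δ : ℝ} (h : ∀ j, w j ≤ w' j + δ) :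
    logSumExp w ≤ logSumExp w' + δ := by
  unfold logSumExp
  rw [← Real.log_exp δ, ← Real.log_mul (expSum_pos _).ne' (Real.exp_pos _).ne']
  apply Real.log_le_log (expSum_pos _)
  unfold expSum
  rw [Finset.sum_mul]
  refine Finset.sum_le_sum fun j _ => ?_
  rw [← Real.exp_add]
  exact Real.exp_le_exp.2 (h j)

theorem logSumExp_le [Nonempty J] {w : J → ℝ} {M : ℝ} (h : ∀ j, w j ≤ M) :
    logSumExp w ≤ Real.log (Fintype.card J) + M := by
  have := logSumExp_le_add (w := w) (w' := fun _ => 0) (δ := M) (by simpa using h)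
  simpa [logSumExp, expSum] using this

theorem abs_logSumExp_add_sub_le [Nonempty J] (w x : J → ℝ) :
    |logSumExp (w + x) - logSumExp w| ≤ ‖x‖ := by
  have hx : ∀ j, |x j| ≤ ‖x‖ := fun j => norm_le_pi_norm x j
  have h1 := logSumExp_le_add (w := w + x) (w' := w) (δ := ‖x‖)
    fun j => by simpa using (abs_le.1 (hx j)).2
  have h2 := logSumExp_le_add (w := w) (w' := w + x) (δ := ‖x‖)
    fun j => by
      have := (abs_le.1 (hx j)).1
      simp only [Pi.add_apply]; linarith
  rw [abs_le]; constructor <;> linarith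

theorem softmax_eq_exp [Nonempty J] (w : J → ℝ) (j : J) :
    softmax w j = Real.exp (w j - logSumExp w) := by
  rw [Real.exp_sub, logSumExp, Real.exp_log (expSum_pos w), softmax]

/-- The logarithm of a weight is `w_j - logSumExp w`, and both terms move by at most `‖x‖ ≤ 1`,
hence the factor `e^2`. -/
theorem softmax_add_le [Nonempty J] (w x : J → ℝ) (hx : ‖x‖ ≤ 1) (j : J) :
    softmax (w + x) j ≤ Real.exp 2 * softmax w j := by
  rw [softmax_eq_exp, softmax_eq_exp, ← Real.exp_add]
  apply Real.exp_le_exp.2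
  have h1 := (abs_le.1 (abs_logSumExp_add_sub_le w x)).1
  have h2 : x j ≤ ‖x‖ := (le_abs_self _).trans (norm_le_pi_norm x j)
  simp only [Pi.add_apply]; linarith

theorem le_softmax_add [Nonempty J] (w x : J → ℝ) (hx : ‖x‖ ≤ 1) (j : J) :
    softmax w j ≤ Real.exp 2 * softmax (w + x) j := by
  have := softmax_add_le (w + x) (-x) (by simpa using hx) j
  simpa using this

theorem shellWeight_nonneg (lo hi : ℝ) (w : J → ℝ) (j : J) : 0 ≤ shellWeight lo hi w j := by
  unfold shellWeight; split_ifs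
  exacts [softmax_nonneg w j, le_rfl]

theorem shellWeight_le_one [Nonempty J] (lo hi : ℝ) (w : J → ℝ) (j : J) :
    shellWeight lo hi w j ≤ 1 := by
  unfold shellWeight; split_ifs
  exacts [softmax_le_one w j, zero_le_one]

/-- Both ingredients are stable under a unit perturbation: the weight changes by a factor at most
`e^2`, and `logSumExp` by at most `1`, which the wider shell absorbs. This is what allows a left-out
summand to be put back. -/
theorem shellWeight_le_add [Nonempty J] {lo hi : ℝ} (w x : J → ℝ) (hx : ‖x‖ ≤ 1) (j : J) :
    shellWeight lo hi w j ≤ Real.exp 2 * shellWeight (lo - 1) (hi + 1) (w + x) j := by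
  unfold shellWeight
  have h := abs_le.1 (abs_logSumExp_add_sub_le w x)
  split_ifs with h1 h2
  · exact le_softmax_add w x hx j
  · exact absurd ⟨by linarith, by linarith⟩ h2
  · exact mul_nonneg (Real.exp_pos _).le (softmax_nonneg _ _)
  · simp

theorem softMoment_abs_le (k : ℕ) (w x : J → ℝ) :
    |softMoment k w x| ≤ softMoment k w (fun j => |x j|) := by
  unfold softMoment
  refine (Finset.abs_sum_le_sum_abs _ _).trans (Finset.sum_le_sum fun j _ => ?_)
  rw [abs_mul, abs_of_nonneg (softmax_nonneg w j), abs_pow]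

theorem softMoment_le_norm_pow [Nonempty J] (k : ℕ) (w x : J → ℝ) :
    |softMoment k w x| ≤ ‖x‖ ^ k := by
  refine (softMoment_abs_le k w x).trans ?_
  calc softMoment k w (fun j => |x j|) ≤ ∑ j, softmax w j * ‖x‖ ^ k := by
        refine Finset.sum_le_sum fun j _ => mul_le_mul_of_nonneg_left ?_ (softmax_nonneg _ _)
        exact pow_le_pow_left₀ (abs_nonneg _) (norm_le_pi_norm x j) k
    _ = ‖x‖ ^ k := by rw [← Finset.sum_mul, sum_softmax, one_mul]

/-- The difference of the two sides is `(y - s)^2 (2y + s)`. Averaging over `y` with `s` fixed turns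
this into moment inequalities. -/
theorem three_mul_sq_mul_le {y s : ℝ} (hy : 0 ≤ y) (hs : 0 ≤ s) :
    3 * (y ^ 2 * s) ≤ 2 * y ^ 3 + s ^ 3 := by
  nlinarith [mul_nonneg hy (sq_nonneg (y - s)), mul_nonneg hs (sq_nonneg (y - s))]

theorem softMoment_one_pow_three_le [Nonempty J] (w : J → ℝ) {x : J → ℝ} (hx : ∀ j, 0 ≤ x j) :
    softMoment 1 w x ^ 3 ≤ softMoment 3 w x := by
  have := Real.pow_arith_mean_le_arith_mean_pow Finset.univ (softmax w) x
    (fun j _ => softmax_nonneg w j) (sum_softmax w) (fun j _ => hx j) 3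
  simpa [softMoment] using this

/-- Average `3 y^2 s ≤ 2 y^3 + s^3` with `s` the mean, and use `s^3 ≤ E y^3`. It lets every product
of moments in a third derivative be bounded by the third moment alone. -/
theorem softMoment_one_mul_two_le [Nonempty J] (w : J → ℝ) {x : J → ℝ} (hx : ∀ j, 0 ≤ x j) :
    softMoment 1 w x * softMoment 2 w x ≤ softMoment 3 w x := by
  set s := softMoment 1 w x with hs
  have s0 : 0 ≤ s := Finset.sum_nonneg fun j _ => mul_nonneg (softmax_nonneg _ _) (by simpa using hx j)
  have h3 : s ^ 3 ≤ softMoment 3 w x := softMoment_one_pow_three_le w hx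
  have : 3 * (s * softMoment 2 w x) ≤ 2 * softMoment 3 w x + s ^ 3 := by
    have h1 : s ^ 3 = ∑ j, softmax w j * s ^ 3 := by rw [← Finset.sum_mul, sum_softmax, one_mul]
    rw [h1]
    unfold softMoment
    simp only [Finset.mul_sum]
    rw [← Finset.sum_add_distrib]
    refine Finset.sum_le_sum fun j _ => ?_
    have := mul_le_mul_of_nonneg_left (three_mul_sq_mul_le (hx j) s0) (softmax_nonneg w j)
    linarith
  linarith

/-! ### Derivatives along a line -/

theorem hasDerivAt_expSum_line (w x : J → ℝ) (r : ℝ) :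
    HasDerivAt (fun r : ℝ => expSum (w + r • x)) (∑ j, Real.exp ((w + r • x) j) * x j) r := by
  unfold expSum
  refine HasDerivAt.fun_sum fun j _ => ?_
  have : HasDerivAt (fun r : ℝ => (w + r • x) j) (x j) r := by
    simpa using ((hasDerivAt_id r).mul_const (x j)).const_add (w j)
  exact this.exp

theorem hasDerivAt_logSumExp_line [Nonempty J] (w x : J → ℝ) (r : ℝ) :
    HasDerivAt (fun r : ℝ => logSumExp (w + r • x)) (softMoment 1 (w + r • x) x) r := by
  refine ((hasDerivAt_expSum_line w x r).log (expSum_pos _).ne').congr_deriv ?_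
  unfold softMoment softmax
  rw [Finset.sum_div]
  exact Finset.sum_congr rfl fun j _ => by rw [pow_one]; ring

/-- The softmax weights form an exponential family: their logarithmic derivative in the direction
`x` is `x_j` minus the mean, so differentiating a moment gives a covariance. -/
theorem hasDerivAt_softMoment_line [Nonempty J] (k : ℕ) (w x : J → ℝ) (r : ℝ) :
    HasDerivAt (fun r : ℝ => softMoment k (w + r • x) x)
      (softMoment (k + 1) (w + r • x) x
        - softMoment k (w + r • x) x * softMoment 1 (w + r • x) x) r := by
  have hs : ∀ j, HasDerivAt (fun r : ℝ => softmax (w + r • x) j)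
      (softmax (w + r • x) j * (x j - softMoment 1 (w + r • x) x)) r := fun j => by
    have : HasDerivAt (fun r : ℝ => (w + r • x) j) (x j) r := by
      simpa using ((hasDerivAt_id r).mul_const (x j)).const_add (w j)
    simp_rw [softmax_eq_exp]
    exact (this.fun_sub (hasDerivAt_logSumExp_line w x r)).exp
  unfold softMoment at hs ⊢
  refine (HasDerivAt.fun_sum fun j _ => (hs j).mul_const (x j ^ k)).congr_deriv ?_
  rw [Finset.sum_mul, ← Finset.sum_sub_distrib]
  exact Finset.sum_congr rfl fun j _ => by ring

/-! ### The smoothed indicator of an orthant -/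

variable {K c : ℝ}

/-- The smoothed indicator function of the negative orthant. -/
def smoothInd (g : SmoothCutoff K c) (w : J → ℝ) : ℝ := g.G (logSumExp w)

/-- The second order Taylor polynomial of `smoothInd` at `w`. -/
def smoothTaylor (g : SmoothCutoff K c) (w x : J → ℝ) : ℝ :=
  g.G (logSumExp w) + g.G1 (logSumExp w) * softMoment 1 w x
    + (g.G2 (logSumExp w) * softMoment 1 w x ^ 2
      + g.G1 (logSumExp w) * (softMoment 2 w x - softMoment 1 w x ^ 2)) / 2

theorem smoothInd_eq_one [Nonempty J] (g : SmoothCutoff K c)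
    (hc : Real.log (Fintype.card J) ≤ c) {w : J → ℝ} (hw : ∀ j, w j ≤ 0) : smoothInd g w = 1 :=
  g.eq_one _ ((logSumExp_le hw).trans (by linarith))

theorem smoothInd_eq_zero [Nonempty J] (g : SmoothCutoff K c) {w : J → ℝ}
    (hw : ¬ ∀ j, w j ≤ 2 * c) : smoothInd g w = 0 := by
  push Not at hw
  obtain ⟨j, hj⟩ := hw
  exact g.eq_zero _ (hj.le.trans (le_logSumExp w j))

/-- The expression is the third derivative of `G ∘ logSumExp` along a line, written in terms of
moments. The constant counts monomials: `13 = 1 + 3·2 + (1 + 3 + 2)`, each of them at most `K' *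
a3`. -/
theorem abs_third_order_le {K' g1 g2 g3 e1 e2 e3 a1 a2 a3 : ℝ} (h1 : |g1| ≤ K') (h2 : |g2| ≤ K')
    (h3 : |g3| ≤ K') (he1 : |e1| ≤ a1) (he2 : |e2| ≤ a2) (he3 : |e3| ≤ a3)
    (h13 : a1 ^ 3 ≤ a3) (h12 : a1 * a2 ≤ a3) :
    |g3 * e1 ^ 3 + 3 * g2 * e1 * (e2 - e1 ^ 2) + g1 * (e3 - 3 * e1 * e2 + 2 * e1 ^ 3)|
      ≤ 13 * K' * a3 := by
  have a10 := (abs_nonneg _).trans he1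
  have K0 := (abs_nonneg _).trans h1
  have b1 : |e1 ^ 3| ≤ a3 := by
    rw [abs_pow]; exact (pow_le_pow_left₀ (abs_nonneg _) he1 3).trans h13
  have b2 : |e1 * e2| ≤ a3 := by
    rw [abs_mul]; exact (mul_le_mul he1 he2 (abs_nonneg _) a10).trans h12
  have k : ∀ {g y : ℝ}, |g| ≤ K' → |y| ≤ a3 → |g * y| ≤ K' * a3 := fun hg hy => by
    rw [abs_mul]; exact mul_le_mul hg hy (abs_nonneg _) K0
  have t1 := abs_le.1 (k h3 b1)
  have t2 := abs_le.1 (k h2 b2)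
  have t3 := abs_le.1 (k h2 b1)
  have t4 := abs_le.1 (k h1 he3)
  have t5 := abs_le.1 (k h1 b2)
  have t6 := abs_le.1 (k h1 b1)
  rw [abs_le]
  constructor <;> nlinarith

/-- The third derivative on the segment is nonzero only where `logSumExp` lies in `[c, 2c]`; the
starting point `w` is then in the shell `[0, 3c]` because `c ≥ 1`. The weights at intermediate
points are compared with those at `w` at the cost of `e^2 ≤ 7.5`, and `13 · 7.5 ≤ 100`. -/
theorem abs_smoothInd_sub_taylor_le_of_norm_le_one [Nonempty J] (g : SmoothCutoff K c)
    (hc : 1 ≤ c) (w x : J → ℝ) (hx : ‖x‖ ≤ 1) :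
    |smoothInd g (w + x) - smoothTaylor g w x|
      ≤ 100 * (K / c) * ∑ j, shellWeight 0 (3 * c) w j * |x j| ^ 3 := by
  set ℓ : ℝ → ℝ := fun r => logSumExp (w + r • x) with hℓ
  set e : ℕ → ℝ → ℝ := fun k r => softMoment k (w + r • x) x with he
  have dl : ∀ r, HasDerivAt ℓ (e 1 r) r := hasDerivAt_logSumExp_line w x
  have de : ∀ k r, HasDerivAt (e k) (e (k + 1) r - e k r * e 1 r) r :=
    fun k r => hasDerivAt_softMoment_line k w x r
  have K0 : 0 ≤ K / c := (abs_nonneg _).trans (g.abs_G1 0)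
  have S0 : 0 ≤ ∑ j, shellWeight 0 (3 * c) w j * |x j| ^ 3 :=
    Finset.sum_nonneg fun j _ => mul_nonneg (shellWeight_nonneg _ _ _ _) (by positivity)
  have key := abs_sub_taylor_two_le (f := fun r => g.G (ℓ r)) (f1 := fun r => g.G1 (ℓ r) * e 1 r)
    (f2 := fun r => g.G2 (ℓ r) * e 1 r ^ 2 + g.G1 (ℓ r) * (e 2 r - e 1 r ^ 2))
    (f3 := fun r => g.G3 (ℓ r) * e 1 r ^ 3 + 3 * g.G2 (ℓ r) * e 1 r * (e 2 r - e 1 r ^ 2)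
      + g.G1 (ℓ r) * (e 3 r - 3 * e 1 r * e 2 r + 2 * e 1 r ^ 3))
    (M := 100 * (K / c) * ∑ j, shellWeight 0 (3 * c) w j * |x j| ^ 3)
    (fun r => (g.hasDerivAt_G _).comp r (dl r))
    (fun r => by
      refine (((g.hasDerivAt_G1 _).comp r (dl r)).fun_mul (de 1 r)).congr_deriv ?_
      simp only [Function.comp_apply]; ring)
    (fun r => by
      refine ((((g.hasDerivAt_G2 _).comp r (dl r)).fun_mul ((de 1 r).fun_pow 2)).fun_add
        (((g.hasDerivAt_G1 _).comp r (dl r)).fun_mul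
          ((de 2 r).fun_sub ((de 1 r).fun_pow 2)))).congr_deriv ?_
      simp only [Function.comp_apply]; push_cast; ring)
    (fun r hr => by
      have hrx : ‖r • x‖ ≤ 1 := by
        rw [norm_smul, Real.norm_eq_abs, abs_of_nonneg hr.1]
        exact mul_le_one₀ hr.2 (norm_nonneg _) hx
      by_cases hl : ℓ r < c ∨ 2 * c < ℓ r
      · obtain ⟨h1, h2, h3⟩ := g.support _ hl
        simp only [h1, h2, h3, zero_mul, mul_zero, add_zero, abs_zero]
        positivity
      push Not at hl
      have habs : ∀ j, 0 ≤ |x j| := fun j => abs_nonneg _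
      refine (abs_third_order_le (g.abs_G1 _) (g.abs_G2 _) (g.abs_G3 _)
        (softMoment_abs_le 1 _ x) (softMoment_abs_le 2 _ x) (softMoment_abs_le 3 _ x)
        (softMoment_one_pow_three_le _ habs) (softMoment_one_mul_two_le _ habs)).trans ?_
      have hs : softMoment 3 (w + r • x) (fun j => |x j|)
          ≤ Real.exp 2 * ∑ j, shellWeight 0 (3 * c) w j * |x j| ^ 3 := by
        unfold softMoment
        rw [Finset.mul_sum]
        refine Finset.sum_le_sum fun j _ => ?_
        rw [← mul_assoc]
        refine mul_le_mul_of_nonneg_right ?_ (by positivity)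
        have hd := abs_le.1 (abs_logSumExp_add_sub_le w (r • x))
        have : shellWeight 0 (3 * c) w j = softmax w j := by
          unfold shellWeight
          rw [if_pos]
          simp only [hℓ] at hl
          constructor <;> linarith [hl.1, hl.2]
        rw [this]
        exact softmax_add_le w _ hrx j
      have e2 : Real.exp 2 ≤ 7.5 := by
        have := Real.exp_one_lt_d9
        have h2 : Real.exp 2 = Real.exp 1 * Real.exp 1 := by rw [← Real.exp_add]; norm_num
        rw [h2]; nlinarith [Real.exp_pos 1]
      have h' : Real.exp 2 * ∑ j, shellWeight 0 (3 * c) w j * |x j| ^ 3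
          ≤ 7.5 * ∑ j, shellWeight 0 (3 * c) w j * |x j| ^ 3 :=
        mul_le_mul_of_nonneg_right e2 S0
      have := mul_le_mul_of_nonneg_left (hs.trans h') K0
      nlinarith [mul_nonneg K0 S0])
  simpa [hℓ, he, smoothInd, smoothTaylor] using key

/-- No cancellation is needed for a large increment: the values of `G` differ by at most `1`, and
each Taylor term is bounded by a multiple of `K ‖x‖^2` since `‖x‖ ≤ ‖x‖^2`. -/
theorem abs_smoothInd_sub_taylor_le_of_one_lt_norm [Nonempty J] (g : SmoothCutoff K c)
    (hK : 1 ≤ K) (hc : 1 ≤ c) (w x : J → ℝ) (hx : 1 < ‖x‖) :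
    |smoothInd g (w + x) - smoothTaylor g w x| ≤ 4 * K * ‖x‖ ^ 2 := by
  have hKc : K / c ≤ K := div_le_self (by linarith) hc
  have G1 := abs_le.1 ((g.abs_G1 (logSumExp w)).trans hKc)
  have G2 := abs_le.1 ((g.abs_G2 (logSumExp w)).trans hKc)
  have hm : ‖x‖ ≤ ‖x‖ ^ 2 := by nlinarith
  have e1 := softMoment_le_norm_pow 1 w x
  have e2 := softMoment_le_norm_pow 2 w x
  rw [pow_one] at e1
  have e11 : |softMoment 1 w x ^ 2| ≤ ‖x‖ ^ 2 := by
    rw [abs_pow]; exact pow_le_pow_left₀ (abs_nonneg _) e1 2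
  have k : ∀ {a y : ℝ}, |a| ≤ K → |y| ≤ ‖x‖ ^ 2 → |a * y| ≤ K * ‖x‖ ^ 2 := fun ha hy => by
    rw [abs_mul]; exact mul_le_mul ha hy (abs_nonneg _) (by linarith)
  have t1 := abs_le.1 (k (abs_le.2 G1) (e1.trans hm))
  have t2 := abs_le.1 (k (abs_le.2 G2) e11)
  have t3 := abs_le.1 (k (abs_le.2 G1) e11)
  have t4 := abs_le.1 (k (abs_le.2 G1) e2)
  have n0 := g.nonneg (logSumExp w)
  have n1 := g.le_one (logSumExp w)
  have n2 := g.nonneg (logSumExp (w + x))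
  have n3 := g.le_one (logSumExp (w + x))
  have : 1 ≤ K * ‖x‖ ^ 2 := by nlinarith
  unfold smoothInd smoothTaylor
  rw [abs_le]; constructor <;> nlinarith

theorem abs_smoothInd_sub_taylor_le [Nonempty J] (g : SmoothCutoff K c)
    (hK : 1 ≤ K) (hc : 1 ≤ c) (w x : J → ℝ) :
    |smoothInd g (w + x) - smoothTaylor g w x|
      ≤ 100 * (K / c) * ∑ j, shellWeight 0 (3 * c) w j * |x j| ^ 3
        + 4 * K * (if 1 < ‖x‖ then ‖x‖ ^ 2 else 0) := by
  have K0 : 0 ≤ K / c := (abs_nonneg _).trans (g.abs_G1 0)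
  have S0 : 0 ≤ ∑ j, shellWeight 0 (3 * c) w j * |x j| ^ 3 :=
    Finset.sum_nonneg fun j _ => mul_nonneg (shellWeight_nonneg _ _ _ _) (by positivity)
  split_ifs with h
  · have := abs_smoothInd_sub_taylor_le_of_one_lt_norm g hK hc w x h
    have := mul_nonneg K0 S0
    linarith
  · have := abs_smoothInd_sub_taylor_le_of_norm_le_one g hc w x (not_lt.1 h)
    linarith

end SoftMax

/-! ### Replacing one summand -/

section Swap

variable {J : Type*} [Fintype J] {K c : ℝ}

theorem measurable_expSum : Measurable (expSum : (J → ℝ) → ℝ) := by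
  unfold expSum; fun_prop

theorem measurable_logSumExp : Measurable (logSumExp : (J → ℝ) → ℝ) :=
  Real.measurable_log.comp measurable_expSum

theorem measurable_softmax (j : J) : Measurable fun w : J → ℝ => softmax w j := by
  unfold softmax
  exact (Real.measurable_exp.comp (measurable_pi_apply j)).div measurable_expSum

theorem measurable_shellWeight (lo hi : ℝ) (j : J) :
    Measurable fun w : J → ℝ => shellWeight lo hi w j := by
  unfold shellWeight
  refine Measurable.ite ?_ (measurable_softmax j) measurable_const
  exact (measurableSet_le measurable_const measurable_logSumExp).inter
    (measurableSet_le measurable_logSumExp measurable_const)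

namespace SmoothCutoff

theorem measurable_G (g : SmoothCutoff K c) : Measurable g.G :=
  (continuous_iff_continuousAt.2 fun u => (g.hasDerivAt_G u).continuousAt).measurable

theorem measurable_G1 (g : SmoothCutoff K c) : Measurable g.G1 :=
  (continuous_iff_continuousAt.2 fun u => (g.hasDerivAt_G1 u).continuousAt).measurable

theorem measurable_G2 (g : SmoothCutoff K c) : Measurable g.G2 :=
  (continuous_iff_continuousAt.2 fun u => (g.hasDerivAt_G2 u).continuousAt).measurable

end SmoothCutoff

theorem measurable_smoothInd (g : SmoothCutoff K c) :
    Measurable (smoothInd g : (J → ℝ) → ℝ) :=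
  g.measurable_G.comp measurable_logSumExp

/-- First order coefficients of `smoothTaylor`. -/
def taylorCoeffOne (g : SmoothCutoff K c) (j : J) (w : J → ℝ) : ℝ :=
  g.G1 (logSumExp w) * softmax w j

/-- Second order coefficients of `smoothTaylor`. -/
def taylorCoeffTwo [DecidableEq J] (g : SmoothCutoff K c) (j k : J) (w : J → ℝ) : ℝ :=
  ((g.G2 (logSumExp w) - g.G1 (logSumExp w)) * (softmax w j * softmax w k)
    + if j = k then g.G1 (logSumExp w) * softmax w j else 0) / 2

/-- Separates the variables: bounded coefficients depending on `w` alone, times monomials in `x` of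
degree at most two. Under independence the expectation then depends on the increment only through
its first two moments. -/
theorem smoothTaylor_eq_sum [DecidableEq J] (g : SmoothCutoff K c) (w x : J → ℝ) :
    smoothTaylor g w x = smoothInd g w + ∑ j, taylorCoeffOne g j w * x j
      + ∑ j, ∑ k, taylorCoeffTwo g j k w * (x j * x k) := by
  have h1 : softMoment 1 w x ^ 2 = ∑ j, ∑ k, softmax w j * softmax w k * (x j * x k) := by
    unfold softMoment
    rw [sq, Finset.sum_mul_sum]
    exact Finset.sum_congr rfl fun j _ => Finset.sum_congr rfl fun k _ => by ring
  have h2 : softMoment 2 w x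
      = ∑ j, ∑ k, (if j = k then softmax w j else 0) * (x j * x k) := by
    unfold softMoment
    refine Finset.sum_congr rfl fun j _ => ?_
    simp [ite_mul, sq]
  have h3 : ∑ j, ∑ k, taylorCoeffTwo g j k w * (x j * x k)
      = ((g.G2 (logSumExp w) - g.G1 (logSumExp w)) * softMoment 1 w x ^ 2
        + g.G1 (logSumExp w) * softMoment 2 w x) / 2 := by
    rw [h1, h2, Finset.mul_sum, Finset.mul_sum, ← Finset.sum_add_distrib, Finset.sum_div]
    refine Finset.sum_congr rfl fun j _ => ?_
    rw [Finset.mul_sum, Finset.mul_sum, ← Finset.sum_add_distrib, Finset.sum_div]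
    refine Finset.sum_congr rfl fun k _ => ?_
    unfold taylorCoeffTwo
    split_ifs <;> ring
  have h4 : ∑ j, taylorCoeffOne g j w * x j = g.G1 (logSumExp w) * softMoment 1 w x := by
    unfold softMoment taylorCoeffOne
    rw [Finset.mul_sum]
    exact Finset.sum_congr rfl fun j _ => by ring
  rw [h3, h4]
  unfold smoothTaylor smoothInd
  ring

theorem measurable_taylorCoeffOne (g : SmoothCutoff K c) (j : J) :
    Measurable (taylorCoeffOne g j) :=
  (g.measurable_G1.comp measurable_logSumExp).mul (measurable_softmax j)

theorem measurable_taylorCoeffTwo [DecidableEq J] (g : SmoothCutoff K c) (j k : J) :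
    Measurable (taylorCoeffTwo g j k) := by
  unfold taylorCoeffTwo
  have h1 := g.measurable_G1.comp (measurable_logSumExp (J := J))
  have h2 := g.measurable_G2.comp (measurable_logSumExp (J := J))
  refine Measurable.div_const (Measurable.add ((h2.sub h1).mul
    ((measurable_softmax j).mul (measurable_softmax k))) ?_) 2
  split_ifs
  exacts [h1.mul (measurable_softmax j), measurable_const]

theorem abs_taylorCoeffOne_le [Nonempty J] (g : SmoothCutoff K c) (j : J) (w : J → ℝ) :
    |taylorCoeffOne g j w| ≤ K / c := by
  unfold taylorCoeffOne
  rw [abs_mul, abs_of_nonneg (softmax_nonneg w j)]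
  exact (mul_le_of_le_one_right (abs_nonneg _) (softmax_le_one w j)).trans (g.abs_G1 _)

theorem abs_taylorCoeffTwo_le [Nonempty J] [DecidableEq J] (g : SmoothCutoff K c) (j k : J)
    (w : J → ℝ) : |taylorCoeffTwo g j k w| ≤ 2 * (K / c) := by
  unfold taylorCoeffTwo
  have h1 := g.abs_G1 (logSumExp w)
  have h2 := g.abs_G2 (logSumExp w)
  have p0 := softmax_nonneg w j
  have p1 := softmax_le_one w j
  have q0 := softmax_nonneg w k
  have q1 := softmax_le_one w k
  have K0 := (abs_nonneg _).trans h1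
  have a1 : |(g.G2 (logSumExp w) - g.G1 (logSumExp w)) * (softmax w j * softmax w k)|
      ≤ 2 * (K / c) := by
    rw [abs_mul, abs_of_nonneg (mul_nonneg p0 q0)]
    refine (mul_le_of_le_one_right (abs_nonneg _) (mul_le_one₀ p1 q0 q1)).trans ?_
    exact (abs_sub _ _).trans (by linarith)
  have a2 : |if j = k then g.G1 (logSumExp w) * softmax w j else 0| ≤ K / c := by
    split_ifs
    · rw [abs_mul, abs_of_nonneg p0]
      exact (mul_le_of_le_one_right (abs_nonneg _) p1).trans h1
    · simpa using K0
  rw [abs_div, abs_two, div_le_iff₀ two_pos]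
  exact (abs_add_le _ _).trans (by linarith)

/-- The tail contribution `‖x‖² 1{‖x‖ > 1}`. -/
def tailSq (x : J → ℝ) : ℝ := if 1 < ‖x‖ then ‖x‖ ^ 2 else 0

theorem tailSq_nonneg (x : J → ℝ) : 0 ≤ tailSq x := by
  unfold tailSq; split_ifs <;> positivity

theorem measurable_tailSq : Measurable (tailSq : (J → ℝ) → ℝ) := by
  unfold tailSq
  exact Measurable.ite (measurableSet_lt measurable_const measurable_norm)
    (measurable_norm.pow_const 2) measurable_const

theorem sq_norm_le_sum_sq (x : J → ℝ) : ‖x‖ ^ 2 ≤ ∑ j, x j ^ 2 := by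
  have h : ‖x‖ ≤ Real.sqrt (∑ j, x j ^ 2) := by
    refine (pi_norm_le_iff_of_nonneg (Real.sqrt_nonneg _)).2 fun j => ?_
    rw [Real.norm_eq_abs]
    apply Real.abs_le_sqrt
    exact Finset.single_le_sum (f := fun j => x j ^ 2) (fun k _ => sq_nonneg _) (Finset.mem_univ j)
  calc ‖x‖ ^ 2 ≤ Real.sqrt (∑ j, x j ^ 2) ^ 2 := pow_le_pow_left₀ (norm_nonneg _) h 2
    _ = _ := Real.sq_sqrt (Finset.sum_nonneg fun _ _ => sq_nonneg _)

theorem tailSq_le_sum_sq (x : J → ℝ) : tailSq x ≤ ∑ j, x j ^ 2 := by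
  unfold tailSq; split_ifs
  · exact sq_norm_le_sum_sq x
  · exact Finset.sum_nonneg fun _ _ => sq_nonneg _

variable {Ω : Type*} [MeasurableSpace Ω] {P : Measure Ω}

theorem integrable_tailSq {ζ : Ω → J → ℝ} (hζ : Measurable ζ)
    (h2 : ∀ j, MemLp (fun ω => ζ ω j) 2 P) : Integrable (fun ω => tailSq (ζ ω)) P := by
  refine Integrable.mono' (integrable_finsetSum Finset.univ fun j _ => (h2 j).integrable_sq)
    (measurable_tailSq.comp hζ).aestronglyMeasurable (ae_of_all _ fun ω => ?_)
  rw [Real.norm_eq_abs, abs_of_nonneg (tailSq_nonneg _)]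
  exact tailSq_le_sum_sq _

theorem integrable_mul_of_abs_le {f h : Ω → ℝ} {M : ℝ} (hf : Measurable f)
    (hM : ∀ ω, |f ω| ≤ M) (hh : Integrable h P) : Integrable (fun ω => f ω * h ω) P :=
  hh.bdd_mul hf.aestronglyMeasurable (ae_of_all _ fun ω => hM ω)

theorem integrable_abs_pow_three {f : Ω → ℝ} (hf : MemLp f 3 P) :
    Integrable (fun ω => |f ω| ^ 3) P := by
  simpa using hf.integrable_norm_pow (by norm_num : (3 : ℕ) ≠ 0)

variable [IsProbabilityMeasure P]

theorem integrable_comp_of_abs_le {E : Type*} [MeasurableSpace E] {f : E → ℝ} {R : Ω → E} {M : ℝ}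
    (hf : Measurable f) (hR : Measurable R) (hM : ∀ x, |f x| ≤ M) :
    Integrable (fun ω => f (R ω)) P :=
  Integrable.of_bound (hf.comp hR).aestronglyMeasurable M (ae_of_all _ fun _ => hM _)

theorem abs_smoothInd_le (g : SmoothCutoff K c) (w : J → ℝ) : |smoothInd g w| ≤ 1 := by
  unfold smoothInd
  rw [abs_of_nonneg (g.nonneg _)]
  exact g.le_one _

theorem integrable_smoothInd (g : SmoothCutoff K c) {R : Ω → J → ℝ} (hR : Measurable R) :
    Integrable (fun ω => smoothInd g (R ω)) P :=
  integrable_comp_of_abs_le (measurable_smoothInd g) hR (abs_smoothInd_le g)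

theorem integrable_smoothTaylor [Nonempty J] (g : SmoothCutoff K c) {R ζ : Ω → J → ℝ}
    (hR : Measurable R) (h2 : ∀ j, MemLp (fun ω => ζ ω j) 2 P) :
    Integrable (fun ω => smoothTaylor g (R ω) (ζ ω)) P := by
  classical
  simp_rw [smoothTaylor_eq_sum]
  refine ((integrable_smoothInd g hR).add (integrable_finsetSum _ fun j _ => ?_)).add
    (integrable_finsetSum _ fun j _ => integrable_finsetSum _ fun k _ => ?_)
  · exact integrable_mul_of_abs_le ((measurable_taylorCoeffOne g j).comp hR)
      (fun ω => abs_taylorCoeffOne_le g j _) ((h2 j).integrable one_le_two)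
  · exact integrable_mul_of_abs_le ((measurable_taylorCoeffTwo g j k).comp hR)
      (fun ω => abs_taylorCoeffTwo_le g j k _) ((h2 j).integrable_mul (h2 k))

theorem integral_smoothTaylor [Nonempty J] [DecidableEq J] (g : SmoothCutoff K c)
    {R ζ : Ω → J → ℝ} (hR : Measurable R) (hζ : Measurable ζ) (hind : IndepFun R ζ P)
    (h2 : ∀ j, MemLp (fun ω => ζ ω j) 2 P) :
    ∫ ω, smoothTaylor g (R ω) (ζ ω) ∂P = ∫ ω, smoothInd g (R ω) ∂P
      + ∑ j, (∫ ω, taylorCoeffOne g j (R ω) ∂P) * ∫ ω, ζ ω j ∂P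
      + ∑ j, ∑ k, (∫ ω, taylorCoeffTwo g j k (R ω) ∂P) * ∫ ω, ζ ω j * ζ ω k ∂P := by
  have i1 : ∀ j, Integrable (fun ω => taylorCoeffOne g j (R ω) * ζ ω j) P := fun j =>
    integrable_mul_of_abs_le ((measurable_taylorCoeffOne g j).comp hR)
      (fun ω => abs_taylorCoeffOne_le g j _) ((h2 j).integrable one_le_two)
  have i2 : ∀ j k, Integrable (fun ω => taylorCoeffTwo g j k (R ω) * (ζ ω j * ζ ω k)) P :=
    fun j k => integrable_mul_of_abs_le ((measurable_taylorCoeffTwo g j k).comp hR)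
      (fun ω => abs_taylorCoeffTwo_le g j k _) ((h2 j).integrable_mul (h2 k))
  simp_rw [smoothTaylor_eq_sum]
  have iS1 : Integrable (fun ω => ∑ j, taylorCoeffOne g j (R ω) * ζ ω j) P :=
    integrable_finsetSum _ fun j _ => i1 j
  have iS2 : Integrable
      (fun ω => ∑ j, ∑ k, taylorCoeffTwo g j k (R ω) * (ζ ω j * ζ ω k)) P :=
    integrable_finsetSum _ fun j _ => integrable_finsetSum _ fun k _ => i2 j k
  have iS0 : Integrable (fun ω => smoothInd g (R ω)
      + ∑ j, taylorCoeffOne g j (R ω) * ζ ω j) P := (integrable_smoothInd g hR).add iS1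
  rw [integral_add iS0 iS2, integral_add (integrable_smoothInd g hR) iS1,
    integral_finsetSum _ fun j _ => i1 j,
    integral_finsetSum _ fun j _ => integrable_finsetSum _ fun k _ => i2 j k]
  congr 1
  · congr 1
    refine Finset.sum_congr rfl fun j _ => ?_
    have hi := hind.comp (measurable_taylorCoeffOne g j) (measurable_pi_apply j)
    exact hi.integral_fun_mul_eq_mul_integral
      ((measurable_taylorCoeffOne g j).comp hR).aestronglyMeasurable
      ((measurable_pi_apply j).comp hζ).aestronglyMeasurable
  · refine Finset.sum_congr rfl fun j _ => ?_
    rw [integral_finsetSum _ fun k _ => i2 j k]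
    refine Finset.sum_congr rfl fun k _ => ?_
    have hm : Measurable fun x : J → ℝ => x j * x k :=
      (measurable_pi_apply j).mul (measurable_pi_apply k)
    have hi := hind.comp (measurable_taylorCoeffTwo g j k) hm
    exact hi.integral_fun_mul_eq_mul_integral
      ((measurable_taylorCoeffTwo g j k).comp hR).aestronglyMeasurable
      (hm.comp hζ).aestronglyMeasurable

theorem integrable_shellWeight [Nonempty J] {R : Ω → J → ℝ} (hR : Measurable R) (lo hi : ℝ)
    (j : J) : Integrable (fun ω => shellWeight lo hi (R ω) j) P :=
  integrable_comp_of_abs_le (measurable_shellWeight lo hi j) hR (M := 1) fun w => by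
    rw [abs_of_nonneg (shellWeight_nonneg _ _ _ _)]
    exact shellWeight_le_one _ _ _ _

/-- The shell weights in the pointwise remainder are taken at `R`, which is independent of `ζ`, so
each expectation of a weight times `|ζ_j|^3` factorises. -/
theorem abs_integral_smoothInd_sub_taylor_le [Nonempty J] (g : SmoothCutoff K c)
    (hK : 1 ≤ K) (hc : 1 ≤ c) {R ζ : Ω → J → ℝ} (hR : Measurable R) (hζ : Measurable ζ)
    (hind : IndepFun R ζ P) (h3 : ∀ j, MemLp (fun ω => ζ ω j) 3 P) :
    |∫ ω, smoothInd g (R ω + ζ ω) ∂P - ∫ ω, smoothTaylor g (R ω) (ζ ω) ∂P|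
      ≤ 100 * (K / c) * ∑ j, (∫ ω, shellWeight 0 (3 * c) (R ω) j ∂P) * (∫ ω, |ζ ω j| ^ 3 ∂P)
        + 4 * K * ∫ ω, tailSq (ζ ω) ∂P := by
  have h2 : ∀ j, MemLp (fun ω => ζ ω j) 2 P := fun j => (h3 j).mono_exponent (by norm_num)
  have hp : ∀ j, IndepFun (fun ω => shellWeight 0 (3 * c) (R ω) j) (fun ω => |ζ ω j| ^ 3) P :=
    fun j => hind.comp (measurable_shellWeight 0 (3 * c) j)
      (((measurable_pi_apply j).abs).pow_const 3)
  have i3 : ∀ j, Integrable (fun ω => shellWeight 0 (3 * c) (R ω) j * |ζ ω j| ^ 3) P := fun j =>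
    (hp j).integrable_mul (integrable_shellWeight hR _ _ j) (integrable_abs_pow_three (h3 j))
  have iS : Integrable (fun ω => 100 * (K / c) * ∑ j, shellWeight 0 (3 * c) (R ω) j * |ζ ω j| ^ 3)
      P := (integrable_finsetSum _ fun j _ => i3 j).const_mul _
  have iT : Integrable (fun ω => 4 * K * tailSq (ζ ω)) P := (integrable_tailSq hζ h2).const_mul _
  have iI : Integrable (fun ω => smoothInd g (R ω + ζ ω)) P :=
    integrable_smoothInd g (hR.add hζ)
  rw [← integral_sub iI (integrable_smoothTaylor g hR h2)]
  refine (abs_integral_le_integral_abs).trans ?_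
  refine (integral_mono_of_nonneg (ae_of_all _ fun ω => abs_nonneg _) (iS.add iT)
    (ae_of_all _ fun ω => abs_smoothInd_sub_taylor_le g hK hc (R ω) (ζ ω))).trans ?_
  apply le_of_eq
  simp only [Pi.add_apply]
  rw [integral_add iS iT, integral_const_mul, integral_const_mul,
    integral_finsetSum _ fun j _ => i3 j]
  congr 2
  refine Finset.sum_congr rfl fun j _ => ?_
  exact (hp j).integral_fun_mul_eq_mul_integral
    (integrable_shellWeight hR _ _ j).aestronglyMeasurable
    (integrable_abs_pow_three (h3 j)).aestronglyMeasurable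

/-- The error made by replacing one summand by another one with the same first two moments. -/
theorem abs_integral_smoothInd_sub_le [Nonempty J] (g : SmoothCutoff K c)
    (hK : 1 ≤ K) (hc : 1 ≤ c) {R : Ω → J → ℝ} {ζ : Bool → Ω → J → ℝ} (hR : Measurable R)
    (hζ : ∀ b, Measurable (ζ b)) (hind : ∀ b, IndepFun R (ζ b) P)
    (h3 : ∀ b j, MemLp (fun ω => ζ b ω j) 3 P)
    (hm : ∀ j, ∫ ω, ζ true ω j ∂P = ∫ ω, ζ false ω j ∂P)
    (hv : ∀ j k, ∫ ω, ζ true ω j * ζ true ω k ∂P = ∫ ω, ζ false ω j * ζ false ω k ∂P) :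
    |∫ ω, smoothInd g (R ω + ζ true ω) ∂P - ∫ ω, smoothInd g (R ω + ζ false ω) ∂P|
      ≤ 100 * (K / c) * ∑ j, (∫ ω, shellWeight 0 (3 * c) (R ω) j ∂P)
          * ∑ b, ∫ ω, |ζ b ω j| ^ 3 ∂P
        + 4 * K * ∑ b, ∫ ω, tailSq (ζ b ω) ∂P := by
  classical
  have h2 : ∀ b j, MemLp (fun ω => ζ b ω j) 2 P := fun b j => (h3 b j).mono_exponent (by norm_num)
  have e1 := abs_integral_smoothInd_sub_taylor_le g hK hc hR (hζ true) (hind true) (h3 true)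
  have e2 := abs_integral_smoothInd_sub_taylor_le g hK hc hR (hζ false) (hind false) (h3 false)
  have e3 : ∫ ω, smoothTaylor g (R ω) (ζ true ω) ∂P = ∫ ω, smoothTaylor g (R ω) (ζ false ω) ∂P := by
    rw [integral_smoothTaylor g hR (hζ true) (hind true) (h2 true),
      integral_smoothTaylor g hR (hζ false) (hind false) (h2 false)]
    simp only [hm, hv]
  rw [e3, abs_sub_comm] at e1
  have tri := abs_sub_le (∫ ω, smoothInd g (R ω + ζ true ω) ∂P)
    (∫ ω, smoothTaylor g (R ω) (ζ false ω) ∂P) (∫ ω, smoothInd g (R ω + ζ false ω) ∂P)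
  rw [abs_sub_comm] at e1
  rw [abs_sub_comm (∫ ω, smoothTaylor g (R ω) (ζ false ω) ∂P)] at tri
  refine tri.trans ((add_le_add e1 e2).trans (le_of_eq ?_))
  simp only [Fintype.sum_bool, mul_add, Finset.sum_add_distrib]
  ring

/-- Markov's inequality: `tailSq` is at least `1` wherever the norm exceeds `1`. -/
theorem half_le_measureReal_norm_le_one {ζ : Ω → J → ℝ} (hζ : Measurable ζ)
    (hi : Integrable (fun ω => tailSq (ζ ω)) P) (h : ∫ ω, tailSq (ζ ω) ∂P ≤ 1 / 2) :
    1 / 2 ≤ P.real {ω | ‖ζ ω‖ ≤ 1} := by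
  have hs : MeasurableSet {ω | ‖ζ ω‖ ≤ 1} := measurableSet_le hζ.norm measurable_const
  have : P.real {ω | ‖ζ ω‖ ≤ 1}ᶜ ≤ ∫ ω, tailSq (ζ ω) ∂P := by
    rw [← integral_indicator_one hs.compl]
    refine integral_mono_of_nonneg (ae_of_all _ fun ω => Set.indicator_nonneg (by simp) _) hi
      (ae_of_all _ fun ω => ?_)
    by_cases hω : ‖ζ ω‖ ≤ 1
    · simp [hω, tailSq_nonneg]
    · have h1 : 1 < ‖ζ ω‖ := not_le.1 hω
      simp only [tailSq, if_pos h1]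
      rw [Set.indicator_of_mem (by simpa using h1)]
      simp only [Pi.one_apply]
      nlinarith
  rw [probReal_compl_eq_one_sub hs] at this
  linarith

/-- On `{‖ζ‖ ≤ 1}`, which has probability at least `1/2` and is independent of `R`, adding `ζ`
changes the weight by a factor at most `e^2 ≤ 7.5`. Dividing by the probability gives `15`. -/
theorem integral_shellWeight_le_add [Nonempty J] {R ζ : Ω → J → ℝ}
    (hR : Measurable R) (hζ : Measurable ζ) (hind : IndepFun R ζ P)
    (hh : 1 / 2 ≤ P.real {ω | ‖ζ ω‖ ≤ 1}) (lo hi : ℝ) (j : J) :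
    ∫ ω, shellWeight lo hi (R ω) j ∂P
      ≤ 15 * ∫ ω, shellWeight (lo - 1) (hi + 1) (R ω + ζ ω) j ∂P := by
  set B : Set (J → ℝ) := {x | ‖x‖ ≤ 1} with hB
  have hBm : MeasurableSet B := measurableSet_le measurable_norm measurable_const
  have hf : Measurable (B.indicator (1 : (J → ℝ) → ℝ)) := measurable_one.indicator hBm
  have hprod := (hind.comp (measurable_shellWeight lo hi j) hf).integral_fun_mul_eq_mul_integral
    ((measurable_shellWeight lo hi j).comp hR).aestronglyMeasurable
    (hf.comp hζ).aestronglyMeasurable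
  have hI : ∫ ω, (B.indicator (1 : (J → ℝ) → ℝ) ∘ ζ) ω ∂P = P.real {ω | ‖ζ ω‖ ≤ 1} := by
    have hs : MeasurableSet {ω | ‖ζ ω‖ ≤ 1} := hζ hBm
    rw [← integral_indicator_one hs]
    rfl
  have e2 : Real.exp 2 ≤ 7.5 := by
    have := Real.exp_one_lt_d9
    have h2 : Real.exp 2 = Real.exp 1 * Real.exp 1 := by rw [← Real.exp_add]; norm_num
    rw [h2]; nlinarith [Real.exp_pos 1]
  have hle : ∫ ω, ((fun w => shellWeight lo hi w j) ∘ R) ω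
        * (B.indicator (1 : (J → ℝ) → ℝ) ∘ ζ) ω ∂P
      ≤ ∫ ω, 7.5 * shellWeight (lo - 1) (hi + 1) (R ω + ζ ω) j ∂P := by
    refine integral_mono_of_nonneg (ae_of_all _ fun ω => mul_nonneg (shellWeight_nonneg _ _ _ _)
      (Set.indicator_nonneg (by simp) _))
      ((integrable_shellWeight (hR.add hζ) _ _ j).const_mul _) (ae_of_all _ fun ω => ?_)
    have n0 := shellWeight_nonneg (lo - 1) (hi + 1) (R ω + ζ ω) j
    by_cases hω : ‖ζ ω‖ ≤ 1
    · have hm : ζ ω ∈ B := hω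
      simp only [Function.comp_apply, Set.indicator_of_mem hm, Pi.one_apply, mul_one]
      exact (shellWeight_le_add (R ω) (ζ ω) hω j).trans (mul_le_mul_of_nonneg_right e2 n0)
    · have hm : ζ ω ∉ B := hω
      simp only [Function.comp_apply, Set.indicator_of_notMem hm, mul_zero]
      positivity
  rw [hprod, hI, integral_const_mul] at hle
  have n0 : 0 ≤ ∫ ω, ((fun w => shellWeight lo hi w j) ∘ R) ω ∂P :=
    integral_nonneg fun ω => shellWeight_nonneg _ _ _ _
  simp only [Function.comp_apply] at hle n0
  nlinarith

end Swap

/-! ### Bernoulli interpolation between two families of summands -/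

section Bernoulli

variable {ι : Type*} [Fintype ι] [DecidableEq ι]

/-- The Bernoulli weight of a single choice. -/
def bernWeight (θ : ℝ) (b : Bool) : ℝ := if b then θ else 1 - θ

/-- The product Bernoulli weight of a sequence of choices. -/
def bernProd (θ : ℝ) (s : ι → Bool) : ℝ := ∏ i, bernWeight θ (s i)

/-- The expectation of `a` under independent Bernoulli choices with parameter `θ`. -/
def bernExp (θ : ℝ) (a : (ι → Bool) → ℝ) : ℝ := ∑ s, bernProd θ s * a s

theorem bernProd_nonneg {θ : ℝ} (hθ : θ ∈ Set.Icc (0 : ℝ) 1) (s : ι → Bool) :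
    0 ≤ bernProd θ s := by
  refine Finset.prod_nonneg fun i _ => ?_
  unfold bernWeight
  split_ifs
  exacts [hθ.1, by linarith [hθ.2]]

theorem sum_bernProd (θ : ℝ) : ∑ s : ι → Bool, bernProd θ s = 1 := by
  unfold bernProd
  rw [← Fintype.piFinset_univ, ← Finset.prod_univ_sum]
  simp [bernWeight]

theorem bernExp_mono {θ : ℝ} (hθ : θ ∈ Set.Icc (0 : ℝ) 1) {a b : (ι → Bool) → ℝ}
    (h : ∀ s, a s ≤ b s) : bernExp θ a ≤ bernExp θ b :=
  Finset.sum_le_sum fun s _ => mul_le_mul_of_nonneg_left (h s) (bernProd_nonneg hθ s)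

theorem bernExp_const (θ x : ℝ) : bernExp θ (fun _ : ι → Bool => x) = x := by
  unfold bernExp
  rw [← Finset.sum_mul, sum_bernProd, one_mul]

theorem bernExp_add (θ : ℝ) (a b : (ι → Bool) → ℝ) :
    bernExp θ (fun s => a s + b s) = bernExp θ a + bernExp θ b := by
  simp [bernExp, mul_add, Finset.sum_add_distrib]

theorem bernExp_sub (θ : ℝ) (a b : (ι → Bool) → ℝ) :
    bernExp θ (fun s => a s - b s) = bernExp θ a - bernExp θ b := by
  simp [bernExp, mul_sub, Finset.sum_sub_distrib]

theorem bernExp_const_mul (θ x : ℝ) (a : (ι → Bool) → ℝ) :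
    bernExp θ (fun s => x * a s) = x * bernExp θ a := by
  unfold bernExp
  rw [Finset.mul_sum]
  exact Finset.sum_congr rfl fun s _ => by ring

theorem abs_bernExp_le {θ : ℝ} (hθ : θ ∈ Set.Icc (0 : ℝ) 1) (a : (ι → Bool) → ℝ) :
    |bernExp θ a| ≤ bernExp θ fun s => |a s| := by
  refine (Finset.abs_sum_le_sum_abs _ _).trans (le_of_eq ?_)
  exact Finset.sum_congr rfl fun s _ => by rw [abs_mul, abs_of_nonneg (bernProd_nonneg hθ s)]

theorem bernExp_zero (a : (ι → Bool) → ℝ) : bernExp 0 a = a fun _ => false := by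
  unfold bernExp
  rw [Finset.sum_eq_single fun _ => false]
  · simp [bernProd, bernWeight]
  · intro s _ hs
    obtain ⟨i, hi⟩ := Function.ne_iff.1 hs
    have : bernProd 0 s = 0 := Finset.prod_eq_zero (Finset.mem_univ i) (by simp_all [bernWeight])
    rw [this, zero_mul]
  · simp

theorem bernExp_one (a : (ι → Bool) → ℝ) : bernExp 1 a = a fun _ => true := by
  unfold bernExp
  rw [Finset.sum_eq_single fun _ => true]
  · simp [bernProd, bernWeight]
  · intro s _ hs
    obtain ⟨i, hi⟩ := Function.ne_iff.1 hs
    have : bernProd 1 s = 0 := Finset.prod_eq_zero (Finset.mem_univ i) (by simp_all [bernWeight])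
    rw [this, zero_mul]
  · simp

/-- Flipping the `i`-th choice. -/
def flipAt (i : ι) (s : ι → Bool) : ι → Bool := Function.update s i (!s i)

theorem flipAt_involutive (i : ι) : Function.Involutive (flipAt i) := by
  intro s
  simp [flipAt]

theorem sum_eq_half_sum_add_flipAt (i : ι) (F : (ι → Bool) → ℝ) :
    ∑ s, F s = (∑ s, (F s + F (flipAt i s))) / 2 := by
  rw [Finset.sum_add_distrib]
  have : ∑ s, F (flipAt i s) = ∑ s, F s := (flipAt_involutive i).bijective.sum_comp F
  rw [this]; ring

/-- Both sums are grouped into the pairs `{s, flipAt i s}`. On a pair the remaining Bernoulli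
weights agree, the signs produce the difference of the two values of `a`, and on the right the two
weights of the `i`-th choice add up to `θ + (1 - θ) = 1`. -/
theorem sum_prod_erase_mul_sign (θ : ℝ) (i : ι) (a : (ι → Bool) → ℝ) :
    ∑ s : ι → Bool, (∏ k ∈ Finset.univ.erase i, bernWeight θ (s k)) * (if s i then 1 else -1) * a s
      = bernExp θ fun s => a (Function.update s i true) - a (Function.update s i false) := by
  unfold bernExp
  rw [sum_eq_half_sum_add_flipAt i, sum_eq_half_sum_add_flipAt i (fun s => bernProd θ s * _)]
  congr 1
  refine Finset.sum_congr rfl fun s _ => ?_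
  have hq : ∏ k ∈ Finset.univ.erase i, bernWeight θ (flipAt i s k)
      = ∏ k ∈ Finset.univ.erase i, bernWeight θ (s k) := by
    refine Finset.prod_congr rfl fun k hk => ?_
    rw [flipAt, Function.update_of_ne (Finset.ne_of_mem_erase hk)]
  have hp : ∀ s : ι → Bool, bernProd θ s
      = bernWeight θ (s i) * ∏ k ∈ Finset.univ.erase i, bernWeight θ (s k) := fun s =>
    (Finset.mul_prod_erase Finset.univ (fun k => bernWeight θ (s k)) (Finset.mem_univ i)).symm
  have hu : ∀ b, Function.update (flipAt i s) i b = Function.update s i b := fun b => by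
    simp [flipAt]
  have hi : flipAt i s i = !s i := by simp [flipAt]
  rw [hp s, hp (flipAt i s), hq, hu, hu, hi]
  have hself : Function.update s i (s i) = s := Function.update_eq_self i s
  cases h : s i
  · rw [h] at hself
    have hf : flipAt i s = Function.update s i true := by simp [flipAt, h]
    rw [hf, hself]
    simp only [bernWeight]
    simp
    ring
  · rw [h] at hself
    have hf : flipAt i s = Function.update s i false := by simp [flipAt, h]
    rw [hf, hself]
    simp only [bernWeight]
    simp
    ring

/-- The product rule differentiates one Bernoulli factor at a time, and the derivative of that
factor is the sign `±1`; the previous identity then restores a genuine average. -/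
theorem hasDerivAt_bernExp (a : (ι → Bool) → ℝ) (θ : ℝ) :
    HasDerivAt (fun θ => bernExp θ a)
      (∑ i, bernExp θ fun s => a (Function.update s i true) - a (Function.update s i false)) θ := by
  have hw : ∀ b, HasDerivAt (fun θ => bernWeight θ b) (if b then 1 else -1) θ := fun b => by
    unfold bernWeight
    cases b
    · simpa using (hasDerivAt_id θ).const_sub 1
    · simpa using hasDerivAt_id' θ
  have hs : ∀ s : ι → Bool, HasDerivAt (fun θ => bernProd θ s * a s)
      (∑ i, (∏ k ∈ Finset.univ.erase i, bernWeight θ (s k)) * (if s i then 1 else -1) * a s) θ :=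
    fun s => by
      refine ((HasDerivAt.fun_finsetProd (u := Finset.univ)
        fun i _ => hw (s i)).mul_const (a s)).congr_deriv ?_
      rw [Finset.sum_mul]
      simp
  unfold bernExp at hs ⊢
  refine (HasDerivAt.fun_sum fun s _ => hs s).congr_deriv ?_
  rw [Finset.sum_comm]
  exact Finset.sum_congr rfl fun i _ => sum_prod_erase_mul_sign θ i a

/-- Mean value theorem in `θ`. The sum over `i` is kept inside the average, so that all single swaps
can be estimated together for each fixed `s`. -/
theorem abs_bernExp_sub_le {a : (ι → Bool) → ℝ} {D : ℝ}
    (hD : ∀ θ ∈ Set.Icc (0 : ℝ) 1, bernExp θ (fun s => ∑ i,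
      |a (Function.update s i true) - a (Function.update s i false)|) ≤ D)
    {θ : ℝ} (hθ : θ ∈ Set.Icc (0 : ℝ) 1) : |bernExp θ a - bernExp 0 a| ≤ D := by
  refine abs_le_of_hasDerivAt_of_abs_deriv_le (u := fun θ => bernExp θ a - bernExp 0 a) (by simp)
    (fun θ => (hasDerivAt_bernExp a θ).sub_const _) (fun r hr => ?_) θ hθ
  refine le_trans ?_ (hD r hr)
  refine (Finset.abs_sum_le_sum_abs _ _).trans ?_
  refine (Finset.sum_le_sum fun i _ => abs_bernExp_le hr _).trans (le_of_eq ?_)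
  unfold bernExp
  rw [Finset.sum_comm]
  exact Finset.sum_congr rfl fun s _ => by rw [Finset.mul_sum]

end Bernoulli

/-! ### Comparison of the distribution functions of two sums -/

section Comparison

variable {J : Type*} [Fintype J] {K c : ℝ} {ι : Type*} [Fintype ι] [DecidableEq ι]
  {Ω : Type*} [MeasurableSpace Ω]

/-- The sum in which the `i`-th summand is chosen according to `s i`. -/
def mixSum (Z : ι → Ω → Bool → J → ℝ) (s : ι → Bool) (ω : Ω) : J → ℝ := ∑ i, Z i ω (s i)

/-- `mixSum` with the `i`-th summand left out. -/
def mixSumErase (Z : ι → Ω → Bool → J → ℝ) (i : ι) (s : ι → Bool) (ω : Ω) : J → ℝ :=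
  ∑ k ∈ Finset.univ.erase i, Z k ω (s k)

/-- The distribution function of `mixSum`. -/
def mixCdf (P : Measure Ω) (Z : ι → Ω → Bool → J → ℝ) (s : ι → Bool) (t : J → ℝ) : ℝ :=
  P.real {ω | ∀ j, mixSum Z s ω j ≤ t j}

theorem mixSum_update (Z : ι → Ω → Bool → J → ℝ) (i : ι) (s : ι → Bool) (b : Bool) (ω : Ω) :
    mixSum Z (Function.update s i b) ω = mixSumErase Z i s ω + Z i ω b := by
  unfold mixSum mixSumErase
  rw [← Finset.sum_erase_add _ _ (Finset.mem_univ i), Function.update_self]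
  congr 1
  refine Finset.sum_congr rfl fun k hk => ?_
  rw [Function.update_of_ne (Finset.ne_of_mem_erase hk)]

theorem mixSum_eq_erase_add (Z : ι → Ω → Bool → J → ℝ) (i : ι) (s : ι → Bool) (ω : Ω) :
    mixSum Z s ω = mixSumErase Z i s ω + Z i ω (s i) := by
  rw [← mixSum_update, Function.update_eq_self]

variable {Z : ι → Ω → Bool → J → ℝ}

theorem measurable_mixSum (hZ : ∀ i, Measurable (Z i)) (s : ι → Bool) :
    Measurable (mixSum Z s) := by
  unfold mixSum
  exact Finset.measurable_sum _ fun i _ => (measurable_pi_apply (s i)).comp (hZ i)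

theorem measurable_mixSumErase (hZ : ∀ i, Measurable (Z i)) (i : ι) (s : ι → Bool) :
    Measurable (mixSumErase Z i s) := by
  unfold mixSumErase
  exact Finset.measurable_sum _ fun i _ => (measurable_pi_apply (s i)).comp (hZ i)

variable {P : Measure Ω}

theorem indepFun_mixSumErase (hZ : ∀ i, Measurable (Z i)) (hind : iIndepFun Z P) (i : ι)
    (s : ι → Bool) (b : Bool) : IndepFun (mixSumErase Z i s) (fun ω => Z i ω b) P := by
  have h := hind.indepFun_finset (Finset.univ.erase i) {i} (by simp) hZ
  have hf : Measurable fun z : (↥(Finset.univ.erase i) → Bool → J → ℝ) =>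
      ∑ k, z k (s k) :=
    Finset.measurable_sum _ fun k _ => (measurable_pi_apply (s k)).comp (measurable_pi_apply k)
  have hg : Measurable fun z : (↥({i} : Finset ι) → Bool → J → ℝ) =>
      z ⟨i, Finset.mem_singleton_self i⟩ b :=
    (measurable_pi_apply b).comp (measurable_pi_apply _)
  have := h.comp hf hg
  convert this using 1
  · funext ω
    unfold mixSumErase
    exact (Finset.sum_coe_sort (Finset.univ.erase i) fun k => Z k ω (s k)).symm
  · rfl

variable [IsProbabilityMeasure P]

theorem measurableSet_mixSum_le (hZ : ∀ i, Measurable (Z i)) (s : ι → Bool) (t : J → ℝ) :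
    MeasurableSet {ω | ∀ j, mixSum Z s ω j ≤ t j} := by
  have : {ω | ∀ j, mixSum Z s ω j ≤ t j} = ⋂ j, {ω | mixSum Z s ω j ≤ t j} := by
    ext ω; simp
  rw [this]
  exact MeasurableSet.iInter fun j =>
    measurableSet_le ((measurable_pi_apply j).comp (measurable_mixSum hZ s)) measurable_const

theorem mixCdf_mono (s : ι → Bool) {t t' : J → ℝ} (h : ∀ j, t j ≤ t' j) :
    mixCdf P Z s t ≤ mixCdf P Z s t' :=
  measureReal_mono fun _ hω j => (hω j).trans (h j)

theorem mixCdf_nonneg (s : ι → Bool) (t : J → ℝ) : 0 ≤ mixCdf P Z s t := measureReal_nonneg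

theorem mixCdf_le_one (s : ι → Bool) (t : J → ℝ) : mixCdf P Z s t ≤ 1 := measureReal_le_one

theorem mixCdf_le_integral_smoothInd [Nonempty J] (g : SmoothCutoff K c)
    (hJ : Real.log (Fintype.card J) ≤ c) (hZ : ∀ i, Measurable (Z i)) (s : ι → Bool)
    (t : J → ℝ) : mixCdf P Z s t ≤ ∫ ω, smoothInd g (mixSum Z s ω - t) ∂P := by
  unfold mixCdf
  rw [← integral_indicator_one (measurableSet_mixSum_le hZ s t)]
  refine integral_mono_of_nonneg (ae_of_all _ fun ω => Set.indicator_nonneg (by simp) _)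
    (integrable_smoothInd g ((measurable_mixSum hZ s).sub_const t)) (ae_of_all _ fun ω => ?_)
  by_cases hω : ∀ j, mixSum Z s ω j ≤ t j
  · rw [Set.indicator_of_mem (by exact hω)]
    have : smoothInd g (mixSum Z s ω - t) = 1 :=
      smoothInd_eq_one g hJ fun j => by simpa using hω j
    simp [this]
  · rw [Set.indicator_of_notMem (by exact hω)]
    exact g.nonneg _

theorem integral_smoothInd_le_mixCdf [Nonempty J] (g : SmoothCutoff K c)
    (hZ : ∀ i, Measurable (Z i)) (s : ι → Bool) (t : J → ℝ) :
    ∫ ω, smoothInd g (mixSum Z s ω - t) ∂P ≤ mixCdf P Z s fun j => t j + 2 * c := by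
  unfold mixCdf
  rw [← integral_indicator_one (measurableSet_mixSum_le hZ s _)]
  refine integral_mono_of_nonneg (ae_of_all _ fun ω => g.nonneg _)
    ((integrable_const (1 : ℝ)).indicator (measurableSet_mixSum_le hZ s _))
    (ae_of_all _ fun ω => ?_)
  by_cases hω : ∀ j, mixSum Z s ω j ≤ t j + 2 * c
  · rw [Set.indicator_of_mem (by exact hω)]
    exact g.le_one _
  · rw [Set.indicator_of_notMem (by exact hω)]
    refine (smoothInd_eq_zero g fun h => hω fun j => ?_).le
    have := h j
    simp only [Pi.sub_apply] at this
    linarith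

/-- The weights add up to the indicator of the shell. There every coordinate is at most `3c + 1 ≤
4c`, while not all of them are below `-3c`, since that would force `logSumExp ≤ log (card J) - 3c ≤
-2c < -1`. -/
theorem sum_integral_shellWeight_le [Nonempty J] (hc : 1 ≤ c)
    (hJ : Real.log (Fintype.card J) ≤ c) (hZ : ∀ i, Measurable (Z i)) (s : ι → Bool)
    (t : J → ℝ) :
    ∑ j, ∫ ω, shellWeight (0 - 1) (3 * c + 1) (mixSum Z s ω - t) j ∂P
      ≤ mixCdf P Z s (fun j => t j + 4 * c) - mixCdf P Z s fun j => t j + -(3 * c) := by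
  have hm : Measurable fun ω => mixSum Z s ω - t := (measurable_mixSum hZ s).sub_const t
  rw [← integral_finsetSum _ fun j _ => integrable_shellWeight hm _ _ j]
  unfold mixCdf
  have m1 := measurableSet_mixSum_le hZ s fun j => t j + 4 * c
  have m2 := measurableSet_mixSum_le hZ s fun j => t j + -(3 * c)
  rw [← measureReal_sdiff (fun ω hω j => (hω j).trans (by linarith)) m2,
    ← integral_indicator_one (m1.diff m2)]
  refine integral_mono_of_nonneg
    (ae_of_all _ fun ω => Finset.sum_nonneg fun j _ => shellWeight_nonneg _ _ _ _)
    ((integrable_const (1 : ℝ)).indicator (m1.diff m2)) (ae_of_all _ fun ω => ?_)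
  simp only
  by_cases hω : 0 - 1 ≤ logSumExp (mixSum Z s ω - t) ∧ logSumExp (mixSum Z s ω - t) ≤ 3 * c + 1
  · rw [Set.indicator_of_mem]
    · simp only [shellWeight, if_pos hω, sum_softmax, Pi.one_apply, le_refl]
    · constructor
      · intro j
        have := le_logSumExp (mixSum Z s ω - t) j
        simp only [Pi.sub_apply] at this
        linarith [hω.2]
      · intro h
        have := logSumExp_le (w := mixSum Z s ω - t) (M := -(3 * c)) fun j => by
          have := h j
          simp only [Pi.sub_apply]; linarith
        linarith [hω.1]
  · simp only [shellWeight, if_neg hω, Finset.sum_const_zero]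
    exact Set.indicator_nonneg (by simp) _

/-- After the left-out summand is put back, the weights `I j` refer to the full sum for `s` and no
longer to `i`. Exchanging the sums over `i` and `j` then bounds the total by the largest
coordinatewise third-moment sum `M` times one shell probability. The factor `1500` is `100 · 15`. -/
theorem sum_abs_integral_smoothInd_update_sub_le [Nonempty J] (g : SmoothCutoff K c)
    (hK : 1 ≤ K) (hc : 1 ≤ c) (hJ : Real.log (Fintype.card J) ≤ c)
    (hZ : ∀ i, Measurable (Z i)) (hind : iIndepFun Z P)
    (h3 : ∀ i b j, MemLp (fun ω => Z i ω b j) 3 P)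
    (hm : ∀ i j, ∫ ω, Z i ω true j ∂P = ∫ ω, Z i ω false j ∂P)
    (hv : ∀ i j k, ∫ ω, Z i ω true j * Z i ω true k ∂P = ∫ ω, Z i ω false j * Z i ω false k ∂P)
    {M Δ : ℝ} (hM : ∀ j, ∑ i, ∑ b, ∫ ω, |Z i ω b j| ^ 3 ∂P ≤ M)
    (hΔ : ∑ i, ∑ b, ∫ ω, tailSq (Z i ω b) ∂P ≤ Δ) (hΔ' : Δ ≤ 1 / 2) (s : ι → Bool) (t : J → ℝ) :
    ∑ i, |∫ ω, smoothInd g (mixSum Z (Function.update s i true) ω - t) ∂P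
        - ∫ ω, smoothInd g (mixSum Z (Function.update s i false) ω - t) ∂P|
      ≤ 1500 * (K / c) * M * (mixCdf P Z s (fun j => t j + 4 * c)
          - mixCdf P Z s fun j => t j + -(3 * c)) + 4 * K * Δ := by
  have hZb : ∀ i b, Measurable fun ω => Z i ω b := fun i b => (measurable_pi_apply b).comp (hZ i)
  have hKc : 0 ≤ K / c := by positivity
  have T0 : ∀ i b, 0 ≤ ∫ ω, tailSq (Z i ω b) ∂P := fun i b =>
    integral_nonneg fun ω => tailSq_nonneg _
  have Tle : ∀ i b, ∫ ω, tailSq (Z i ω b) ∂P ≤ 1 / 2 := fun i b => by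
    refine le_trans ?_ (hΔ.trans hΔ')
    refine le_trans ?_ (Finset.single_le_sum
      (f := fun i => ∑ b, ∫ ω, tailSq (Z i ω b) ∂P)
      (fun i _ => Finset.sum_nonneg fun b _ => T0 i b) (Finset.mem_univ i))
    exact Finset.single_le_sum (f := fun b => ∫ ω, tailSq (Z i ω b) ∂P)
      (fun b _ => T0 i b) (Finset.mem_univ b)
  have A0 : ∀ i j, 0 ≤ ∑ b, ∫ ω, |Z i ω b j| ^ 3 ∂P := fun i j =>
    Finset.sum_nonneg fun b _ => integral_nonneg fun ω => by positivity
  set I : J → ℝ := fun j => ∫ ω, shellWeight (0 - 1) (3 * c + 1) (mixSum Z s ω - t) j ∂P with hI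
  have I0 : ∀ j, 0 ≤ I j := fun j => integral_nonneg fun ω => shellWeight_nonneg _ _ _ _
  have step : ∀ i, |∫ ω, smoothInd g (mixSum Z (Function.update s i true) ω - t) ∂P
        - ∫ ω, smoothInd g (mixSum Z (Function.update s i false) ω - t) ∂P|
      ≤ 1500 * (K / c) * ∑ j, I j * ∑ b, ∫ ω, |Z i ω b j| ^ 3 ∂P
        + 4 * K * ∑ b, ∫ ω, tailSq (Z i ω b) ∂P := by
    intro i
    have hRm : Measurable fun ω => mixSumErase Z i s ω - t :=
      (measurable_mixSumErase hZ i s).sub_const t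
    have hRi : ∀ b, IndepFun (fun ω => mixSumErase Z i s ω - t) (fun ω => Z i ω b) P := fun b =>
      (indepFun_mixSumErase hZ hind i s b).comp (measurable_id.sub_const t) measurable_id
    have h := abs_integral_smoothInd_sub_le g hK hc (R := fun ω => mixSumErase Z i s ω - t)
      (ζ := fun b ω => Z i ω b) hRm (hZb i) hRi (h3 i) (hm i) (hv i)
    have e : ∀ b ω, mixSum Z (Function.update s i b) ω - t
        = mixSumErase Z i s ω - t + Z i ω b := fun b ω => by
      rw [mixSum_update]; abel
    simp_rw [e]
    -- The summand put back is `Z i (s i)`, whichever type it has, so that the sum obtained is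
    -- `mixSum Z s` for every `i`.
    refine h.trans (add_le_add ?_ le_rfl)
    have hj : ∀ j, ∫ ω, shellWeight 0 (3 * c) (mixSumErase Z i s ω - t) j ∂P ≤ 15 * I j := by
      intro j
      have h15 := integral_shellWeight_le_add hRm (hZb i (s i)) (hRi (s i))
        (half_le_measureReal_norm_le_one (hZb i (s i))
          (integrable_tailSq (hZb i (s i)) fun j => (h3 i (s i) j).mono_exponent (by norm_num))
          (Tle i (s i))) 0 (3 * c) j
      refine h15.trans (le_of_eq ?_)
      congr 1
      refine integral_congr_ae (ae_of_all _ fun ω => ?_)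
      simp only
      rw [mixSum_eq_erase_add Z i s]
      congr 1
      abel
    have : ∑ j, (∫ ω, shellWeight 0 (3 * c) (mixSumErase Z i s ω - t) j ∂P)
          * ∑ b, ∫ ω, |Z i ω b j| ^ 3 ∂P
        ≤ 15 * ∑ j, I j * ∑ b, ∫ ω, |Z i ω b j| ^ 3 ∂P := by
      rw [Finset.mul_sum]
      refine Finset.sum_le_sum fun j _ => ?_
      rw [← mul_assoc]
      exact mul_le_mul_of_nonneg_right (hj j) (A0 i j)
    have := mul_le_mul_of_nonneg_left this hKc
    nlinarith
  refine (Finset.sum_le_sum fun i _ => step i).trans ?_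
  rw [Finset.sum_add_distrib, ← Finset.mul_sum, ← Finset.mul_sum]
  refine add_le_add ?_ (mul_le_mul_of_nonneg_left hΔ (by linarith))
  rw [mul_assoc (1500 * (K / c))]
  refine mul_le_mul_of_nonneg_left ?_ (by positivity)
  have hM0 : 0 ≤ M := by
    obtain ⟨j⟩ := ‹Nonempty J›
    exact (Finset.sum_nonneg fun i _ => A0 i j).trans (hM j)
  calc ∑ i, ∑ j, I j * ∑ b, ∫ ω, |Z i ω b j| ^ 3 ∂P
      = ∑ j, I j * ∑ i, ∑ b, ∫ ω, |Z i ω b j| ^ 3 ∂P := by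
        rw [Finset.sum_comm]
        exact Finset.sum_congr rfl fun j _ => by rw [Finset.mul_sum]
    _ ≤ ∑ j, I j * M := Finset.sum_le_sum fun j _ => mul_le_mul_of_nonneg_left (hM j) (I0 j)
    _ = M * ∑ j, I j := by rw [← Finset.sum_mul, mul_comm]
    _ ≤ _ := mul_le_mul_of_nonneg_left (sum_integral_shellWeight_le hc hJ hZ s t) hM0

/-- Comparison of distribution functions, for sums of independent vectors with matching first two
moments, under an anti-concentration bound for one of the sums. -/
theorem abs_mixCdf_sub_le [Nonempty J] (g : SmoothCutoff K c)
    (hK : 1 ≤ K) (hc : 1 ≤ c) (hJ : Real.log (Fintype.card J) ≤ c)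
    (hZ : ∀ i, Measurable (Z i)) (hind : iIndepFun Z P)
    (h3 : ∀ i b j, MemLp (fun ω => Z i ω b j) 3 P)
    (hm : ∀ i j, ∫ ω, Z i ω true j ∂P = ∫ ω, Z i ω false j ∂P)
    (hv : ∀ i j k, ∫ ω, Z i ω true j * Z i ω true k ∂P = ∫ ω, Z i ω false j * Z i ω false k ∂P)
    {M Δ N : ℝ} (hM : ∀ j, ∑ i, ∑ b, ∫ ω, |Z i ω b j| ^ 3 ∂P ≤ M)
    (hΔ : ∑ i, ∑ b, ∫ ω, tailSq (Z i ω b) ∂P ≤ Δ)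
    (hN : ∀ (t : J → ℝ) (h : ℝ), 0 ≤ h → mixCdf P Z (fun _ => false) (fun j => t j + h)
      - mixCdf P Z (fun _ => false) t ≤ N * h)
    (hsmall : 6000 * K * M ≤ c) (t : J → ℝ) :
    |mixCdf P Z (fun _ => true) t - mixCdf P Z (fun _ => false) t| ≤ 8 * N * c + 8 * K * Δ := by
  have c0 : 0 < c := by linarith
  have N0 : 0 ≤ N := by
    have h1 := hN t 1 zero_le_one
    have h2 := mixCdf_mono (P := P) (Z := Z) (fun _ => false) (t := t) (t' := fun j => t j + 1)
      fun j => by linarith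
    linarith
  have one : ∀ {θ : ℝ}, θ ∈ Set.Icc (0 : ℝ) 1 → ∀ t : J → ℝ,
      |bernExp θ (fun s => mixCdf P Z s t) - bernExp 0 (fun s => mixCdf P Z s t)| ≤ 1 := by
    intro θ hθ t
    have b0 : ∀ {θ : ℝ}, θ ∈ Set.Icc (0 : ℝ) 1 → 0 ≤ bernExp θ (fun s => mixCdf P Z s t) := fun h =>
      Finset.sum_nonneg fun s _ => mul_nonneg (bernProd_nonneg h s) (mixCdf_nonneg s t)
    have b1 : ∀ {θ : ℝ}, θ ∈ Set.Icc (0 : ℝ) 1 → bernExp θ (fun s => mixCdf P Z s t) ≤ 1 := fun h =>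
      (bernExp_mono h fun s => mixCdf_le_one s t).trans (bernExp_const _ _).le
    have z : (0 : ℝ) ∈ Set.Icc (0 : ℝ) 1 := ⟨le_rfl, zero_le_one⟩
    rw [abs_le]
    constructor <;> linarith [b0 hθ, b1 hθ, b0 z, b1 z]
  -- For larger `Δ` the term `8 K Δ` already exceeds `1`, so the bound is trivial.
  by_cases hΔ' : Δ ≤ 1 / 2
  swap
  · have h := one (θ := 1) (by simp) t
    rw [bernExp_one, bernExp_zero] at h
    have h1 : 1 / 2 * 1 ≤ Δ * K := mul_le_mul (not_le.1 hΔ').le hK zero_le_one (by linarith)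
    have := mul_nonneg N0 c0.le
    nlinarith
  have hKM : 1500 * (K / c) * M ≤ 1 / 4 := by
    rw [mul_div_assoc', div_mul_eq_mul_div, div_le_iff₀ c0]
    linarith
  have hM0 : 0 ≤ M := by
    obtain ⟨j⟩ := ‹Nonempty J›
    exact (Finset.sum_nonneg fun i _ => Finset.sum_nonneg fun b _ =>
      integral_nonneg fun ω => by positivity).trans (hM j)
  have hKM0 : 0 ≤ 1500 * (K / c) * M := by positivity
  -- The supremum runs over all intermediate mixtures as well, because the shell probabilities met
  -- along the interpolation are those of the mixtures.
  set S : ℝ := ⨆ q : Set.Icc (0 : ℝ) 1 × (J → ℝ),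
    |bernExp q.1.1 (fun s => mixCdf P Z s q.2) - bernExp 0 (fun s => mixCdf P Z s q.2)| with hS
  have bdd : BddAbove (Set.range fun q : Set.Icc (0 : ℝ) 1 × (J → ℝ) =>
      |bernExp q.1.1 (fun s => mixCdf P Z s q.2) - bernExp 0 (fun s => mixCdf P Z s q.2)|) := by
    refine ⟨1, ?_⟩
    rintro _ ⟨q, rfl⟩
    exact one q.1.2 q.2
  have leS : ∀ {θ : ℝ}, θ ∈ Set.Icc (0 : ℝ) 1 → ∀ t : J → ℝ,
      |bernExp θ (fun s => mixCdf P Z s t) - bernExp 0 (fun s => mixCdf P Z s t)| ≤ S :=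
    fun {θ} hθ t => le_ciSup bdd (⟨θ, hθ⟩, t)
  have S0 : 0 ≤ S := (abs_nonneg _).trans (leS (θ := 0) (by simp) t)
  set D : ℝ := S / 2 + 2 * c * N + 4 * K * Δ with hD
  have smooth : ∀ {θ : ℝ}, θ ∈ Set.Icc (0 : ℝ) 1 → ∀ t : J → ℝ,
      |bernExp θ (fun s => ∫ ω, smoothInd g (mixSum Z s ω - t) ∂P)
        - bernExp 0 (fun s => ∫ ω, smoothInd g (mixSum Z s ω - t) ∂P)| ≤ D := by
    intro θ hθ t
    refine abs_bernExp_sub_le (fun r hr => ?_) hθ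
    refine (bernExp_mono hr fun s => sum_abs_integral_smoothInd_update_sub_le g hK hc hJ hZ hind h3
      hm hv hM hΔ hΔ' s t).trans ?_
    rw [bernExp_add, bernExp_const_mul, bernExp_const, bernExp_sub]
    -- The shell probability under the mixture is compared with the Gaussian one at both corners,
    -- costing `2S`; the Gaussian shell has width `7c`. Multiplication by the coefficient `1/4`
    -- leaves `S / 2 + 7cN / 4`.
    have h1 := (abs_le.1 (leS hr fun j => t j + 4 * c)).2
    have h2 := (abs_le.1 (leS hr fun j => t j + -(3 * c))).1
    have h3 := hN (fun j => t j + -(3 * c)) (7 * c) (by linarith)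
    have e : (fun j => t j + -(3 * c) + 7 * c) = fun j => t j + 4 * c := by
      funext j; ring
    rw [e] at h3
    rw [bernExp_zero] at h1 h2
    have h4 : bernExp r (fun s => mixCdf P Z s fun j => t j + 4 * c)
        - bernExp r (fun s => mixCdf P Z s fun j => t j + -(3 * c)) ≤ 2 * S + N * (7 * c) := by
      linarith
    have h5 : 0 ≤ 2 * S + N * (7 * c) := by positivity
    have h6 := mul_le_mul_of_nonneg_left h4 hKM0
    have h7 := mul_le_mul_of_nonneg_right hKM h5
    have h8 := mul_nonneg N0 c0.le
    rw [hD]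
    linarith
  have main : ∀ {θ : ℝ}, θ ∈ Set.Icc (0 : ℝ) 1 → ∀ t : J → ℝ,
      |bernExp θ (fun s => mixCdf P Z s t) - bernExp 0 (fun s => mixCdf P Z s t)|
        ≤ 2 * c * N + D := by
    intro θ hθ t
    rw [abs_le]
    constructor
    · have u1 := bernExp_mono hθ fun s =>
        integral_smoothInd_le_mixCdf (P := P) g hZ s fun j => t j + -(2 * c)
      have u2 := mixCdf_le_integral_smoothInd (P := P) g hJ hZ (fun _ => false)
        fun j => t j + -(2 * c)
      have u3 := (abs_le.1 (smooth hθ fun j => t j + -(2 * c))).1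
      have u4 := hN (fun j => t j + -(2 * c)) (2 * c) (by linarith)
      have e : (fun j => t j + -(2 * c) + 2 * c) = t := by funext j; ring
      rw [e] at u1 u4
      rw [bernExp_zero] at u3 ⊢
      linarith
    · have u1 := bernExp_mono hθ fun s => mixCdf_le_integral_smoothInd (P := P) g hJ hZ s t
      have u2 := integral_smoothInd_le_mixCdf (P := P) g hZ (fun _ => false) t
      have u3 := (abs_le.1 (smooth hθ t)).2
      have u4 := hN t (2 * c) (by linarith)
      rw [bernExp_zero] at u3 ⊢
      linarith
  -- Since `D` contains `S / 2` and `S` is finite, this inequality can be solved for `S`.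
  have hSle : S ≤ 2 * c * N + D := by
    have : Nonempty (Set.Icc (0 : ℝ) 1 × (J → ℝ)) := ⟨(⟨0, by simp⟩, t)⟩
    exact ciSup_le fun q => main q.1.2 q.2
  have fin := leS (θ := 1) (by simp) t
  rw [bernExp_one, bernExp_zero] at fin
  refine fin.trans ?_
  rw [hD] at hSle
  linarith

end Comparison

/-! ### Gaussian anti-concentration -/

/-- The exponent loses `(v - x)(v + x) / 2`, and `(v - x)(v + x) ≤ (1 / R)(2R + 3) ≤ 5` when the sum
is positive. -/
theorem gaussianPDF_mul_le {x v R : ℝ} (hR : 1 ≤ R) (hx : x ≤ R + 1) (hxv : x ≤ v)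
    (hv : v ≤ x + 1 / R) :
    gaussianPDF 0 1 x ≤ ENNReal.ofReal (Real.exp (5 / 2)) * gaussianPDF 0 1 v := by
  unfold gaussianPDF
  rw [← ENNReal.ofReal_mul (Real.exp_pos _).le]
  apply ENNReal.ofReal_le_ofReal
  unfold gaussianPDFReal
  rw [mul_left_comm, ← Real.exp_add]
  refine mul_le_mul_of_nonneg_left (Real.exp_le_exp.2 ?_) (by positivity)
  have hR0 : 0 < R := by linarith
  have hi : 1 / R ≤ 1 := by rw [div_le_one hR0]; exact hR
  have hi0 : 0 < 1 / R := by positivity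
  have hRi : 1 / R * R = 1 := by field_simp
  have h1 : (v - x) * (v + x) ≤ 5 := by
    by_cases hs : v + x ≤ 0
    · nlinarith
    · have h2 : (v - x) * (v + x) ≤ 1 / R * (v + x) :=
        mul_le_mul_of_nonneg_right (by linarith) (by linarith)
      have h3 : 1 / R * (v + x) ≤ 1 / R * (2 * R + 3) :=
        mul_le_mul_of_nonneg_left (by linarith) hi0.le
      nlinarith
  simp only [NNReal.coe_one, mul_one, sub_zero]
  nlinarith

/-- A half-line carries at least a fixed multiple of the Gaussian density at its end point. -/
theorem gaussianPDF_le_of_upward_closed {S : Set ℝ} {R x : ℝ} (hR : 1 ≤ R) (hx : x ≤ R + 1)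
    (hS : Set.Ici x ⊆ S) :
    gaussianPDF 0 1 x ≤ ENNReal.ofReal (13 * R) * gaussianReal 0 1 S := by
  have hR0 : 0 < R := by linarith
  have h1 : gaussianPDF 0 1 x * ENNReal.ofReal (1 / R)
      ≤ ENNReal.ofReal (Real.exp (5 / 2)) * gaussianReal 0 1 S := by
    calc gaussianPDF 0 1 x * ENNReal.ofReal (1 / R)
        = ∫⁻ _ in Set.Icc x (x + 1 / R), gaussianPDF 0 1 x := by
          rw [setLIntegral_const, Real.volume_Icc, add_sub_cancel_left]
      _ ≤ ∫⁻ v in Set.Icc x (x + 1 / R),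
            ENNReal.ofReal (Real.exp (5 / 2)) * gaussianPDF 0 1 v :=
          setLIntegral_mono ((measurable_gaussianPDF 0 1).const_mul _)
            fun v hv => gaussianPDF_mul_le hR hx hv.1 hv.2
      _ = ENNReal.ofReal (Real.exp (5 / 2)) * gaussianReal 0 1 (Set.Icc x (x + 1 / R)) := by
          rw [lintegral_const_mul _ (measurable_gaussianPDF 0 1),
            gaussianReal_apply 0 one_ne_zero]
      _ ≤ _ := by
          gcongr
          exact fun v hv => hS hv.1
  have e1 : Real.exp (5 / 2) ≤ 13 := by
    have h := Real.exp_one_lt_d9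
    have h0 := Real.exp_pos 1
    have h2 : Real.exp (5 / 2) ^ 2 = Real.exp 1 ^ 5 := by
      rw [← Real.exp_nat_mul, ← Real.exp_nat_mul]; norm_num
    have h3 : Real.exp 1 ^ 5 ≤ 2.72 ^ 5 := pow_le_pow_left₀ h0.le (by linarith) 5
    exact le_of_sq_le_sq (by rw [h2]; exact h3.trans (by norm_num)) (by norm_num)
  calc gaussianPDF 0 1 x
      = gaussianPDF 0 1 x * ENNReal.ofReal (1 / R) * ENNReal.ofReal R := by
        rw [mul_assoc, ← ENNReal.ofReal_mul (by positivity), one_div_mul_cancel hR0.ne']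
        simp
    _ ≤ ENNReal.ofReal 13 * gaussianReal 0 1 S * ENNReal.ofReal R := by
        exact mul_le_mul_left (h1.trans (mul_le_mul_left (ENNReal.ofReal_le_ofReal e1) _)) _
    _ = _ := by
        rw [ENNReal.ofReal_mul (by norm_num)]; ring

/-- At every point of the set the density is at most `13R` times the mass of the half-line above it,
hence of all of `S`; integrate this over a set of length at most `h`. -/
theorem gaussianReal_inter_Iic_le {S : Set ℝ} {R t h : ℝ} (hR : 1 ≤ R) (hSm : MeasurableSet S)
    (hup : ∀ x ∈ S, Set.Ici x ⊆ S) (hS : S ⊆ Set.Ioi t) (ht : t + h ≤ R + 1) :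
    gaussianReal 0 1 (S ∩ Set.Iic (t + h))
      ≤ ENNReal.ofReal (13 * R) * gaussianReal 0 1 S * ENNReal.ofReal h := by
  rw [gaussianReal_apply 0 one_ne_zero]
  calc ∫⁻ x in S ∩ Set.Iic (t + h), gaussianPDF 0 1 x
      ≤ ∫⁻ _ in S ∩ Set.Iic (t + h), ENNReal.ofReal (13 * R) * gaussianReal 0 1 S :=
        setLIntegral_mono' (hSm.inter measurableSet_Iic) fun x hx =>
          gaussianPDF_le_of_upward_closed hR (le_trans hx.2 ht) (hup x hx.1)
    _ = ENNReal.ofReal (13 * R) * gaussianReal 0 1 S * volume (S ∩ Set.Iic (t + h)) := by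
        rw [setLIntegral_const]
    _ ≤ ENNReal.ofReal (13 * R) * gaussianReal 0 1 S * volume (Set.Ioc t (t + h)) := by
        gcongr
        exact fun x hx => ⟨hS hx.1, hx.2⟩
    _ = _ := by rw [Real.volume_Ioc, add_sub_cancel_left]

/-- Covers thresholds beyond `R`, where the density is below `exp (-R^2 / 2)`; summed over all
indices this remains of order `h` if the number of indices is at most `exp (R^2 / 2)`. -/
theorem gaussianReal_Ioc_le {R t h : ℝ} (hR : 0 ≤ R) (ht : R < t) :
    gaussianReal 0 1 (Set.Ioc t (t + h))
      ≤ ENNReal.ofReal (Real.exp (-(R ^ 2 / 2))) * ENNReal.ofReal h := by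
  rw [gaussianReal_apply 0 one_ne_zero]
  calc ∫⁻ x in Set.Ioc t (t + h), gaussianPDF 0 1 x
      ≤ ∫⁻ _ in Set.Ioc t (t + h), ENNReal.ofReal (Real.exp (-(R ^ 2 / 2))) := by
        refine setLIntegral_mono' measurableSet_Ioc fun x hx => ENNReal.ofReal_le_ofReal ?_
        unfold gaussianPDFReal
        have hx1 : R < x := ht.trans hx.1
        have hpi : 1 ≤ Real.sqrt (2 * Real.pi * (1 : NNReal)) := by
          rw [Real.one_le_sqrt]
          have := Real.pi_gt_three
          simp only [NNReal.coe_one, mul_one]; linarith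
        refine (mul_le_of_le_one_left (Real.exp_pos _).le (inv_le_one_of_one_le₀ hpi)).trans ?_
        apply Real.exp_le_exp.2
        simp only [NNReal.coe_one, mul_one, sub_zero]
        nlinarith
    _ = _ := by rw [setLIntegral_const, Real.volume_Ioc, add_sub_cancel_left]

section Nazarov

variable {J : Type*} [Fintype J] {Ω : Type*} [MeasurableSpace Ω] {P : Measure Ω}
  [IsProbabilityMeasure P]

/-- The points at which the `j`-th constraint is violated, and is the first among the most violated
ones, in the coordinates `x = v_j`, `r_k = v_k - c_k v_j`. -/
def violatedCone [LT J] (c u : J → ℝ) (j : J) : Set (ℝ × (J → ℝ)) :=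
  {q | u j < q.1 ∧ ∀ k, q.2 k + c k * q.1 - u k ≤ q.1 - u j
    ∧ (k < j → q.2 k + c k * q.1 - u k < q.1 - u j)}

theorem measurableSet_violatedCone [LT J] (c u : J → ℝ) (j : J) :
    MeasurableSet (violatedCone c u j) := by
  have hk : ∀ k, Measurable fun q : ℝ × (J → ℝ) => q.2 k + c k * q.1 - u k := fun k =>
    (((measurable_pi_apply k).comp measurable_snd).add
      (measurable_fst.const_mul (c k))).sub_const _
  have hj : Measurable fun q : ℝ × (J → ℝ) => q.1 - u j := measurable_fst.sub_const _
  have : violatedCone c u j = {q | u j < q.1} ∩ ⋂ k, ({q | q.2 k + c k * q.1 - u k ≤ q.1 - u j}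
      ∩ {q | k < j → q.2 k + c k * q.1 - u k < q.1 - u j}) := by
    ext q; simp [violatedCone]
  rw [this]
  refine (measurableSet_lt measurable_const measurable_fst).inter
    (MeasurableSet.iInter fun k => (measurableSet_le (hk k) hj).inter ?_)
  by_cases h : k < j
  · simpa [h] using measurableSet_lt (hk k) hj
  · simp [h]

/-- The residual of the regression on `V_j` is uncorrelated with `V_j`, as `V_j` has unit variance,
and the two are jointly Gaussian. -/
theorem indepFun_residual {V : Ω → J → ℝ} (hV : HasGaussianLaw V P)
    (h0 : ∀ j, ∫ ω, V ω j ∂P = 0) (h1 : ∀ j, ∫ ω, V ω j * V ω j ∂P = 1) (j : J) :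
    IndepFun (fun ω => V ω j) (fun ω k => V ω k - (∫ ω, V ω k * V ω j ∂P) * V ω j) P := by
  set c : J → ℝ := fun k => ∫ ω, V ω k * V ω j ∂P with hc
  have hV' : HasGaussianLaw (fun ω => (V ω ·)) P := hV
  have h2 : ∀ k, MemLp (fun ω => V ω k) 2 P := fun k => (hV'.eval k).memLp_two
  let L : (J → ℝ) →L[ℝ] (Unit → ℝ) × (J → ℝ) :=
    (ContinuousLinearMap.pi fun _ => ContinuousLinearMap.proj j).prod
      (ContinuousLinearMap.pi fun k =>
        ContinuousLinearMap.proj k - c k • ContinuousLinearMap.proj j)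
  have hL := hV.map_fun L
  have hXY : HasGaussianLaw (fun ω => ((fun _ : Unit => V ω j), fun k => V ω k - c k * V ω j)) P :=
    hL
  have := hXY.indepFun_of_covariance_eval (X := fun _ ω => V ω j)
    (Y := fun k ω => V ω k - c k * V ω j) (fun _ k => by
      have i1 : Integrable (fun ω => V ω j * V ω k) P := (h2 j).integrable_mul (h2 k)
      have i2 : Integrable (fun ω => V ω j * V ω j) P := (h2 j).integrable_mul (h2 j)
      have hk : MemLp (fun ω => V ω k - c k * V ω j) 2 P := (h2 k).sub ((h2 j).const_mul (c k))
      rw [covariance_eq_sub (h2 j) hk, h0 j, zero_mul, sub_zero]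
      simp only [Pi.mul_apply]
      have e : ∀ ω, V ω j * (V ω k - c k * V ω j) = V ω j * V ω k - c k * (V ω j * V ω j) :=
        fun ω => by ring
      simp_rw [e]
      rw [integral_sub i1 (i2.const_mul _), integral_const_mul, h1 j, mul_one, hc]
      simp_rw [mul_comm (V _ k)]
      exact sub_self _)
  exact this.comp (measurable_pi_apply ()) measurable_id

/-- The probability that the `j`-th constraint is the first most violated one, by at most `h`. -/
theorem measure_violated_le [LinearOrder J] {V : Ω → J → ℝ} (hVm : Measurable V)
    (hV : HasGaussianLaw V P) (h0 : ∀ j, ∫ ω, V ω j ∂P = 0)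
    (h1 : ∀ j, ∫ ω, V ω j * V ω j ∂P = 1) {R h : ℝ} (hR : 1 ≤ R) (u : J → ℝ) (h' : h ≤ 1) (j : J) :
    P {ω | (u j < V ω j ∧ ∀ k, V ω k - u k ≤ V ω j - u j ∧ (k < j → V ω k - u k < V ω j - u j))
        ∧ V ω j ≤ u j + h}
      ≤ ENNReal.ofReal (13 * R) * P {ω | u j < V ω j ∧ ∀ k, V ω k - u k ≤ V ω j - u j
            ∧ (k < j → V ω k - u k < V ω j - u j)} * ENNReal.ofReal h
        + ENNReal.ofReal (Real.exp (-(R ^ 2 / 2))) * ENNReal.ofReal h := by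
  have hV' : HasGaussianLaw (fun ω => (V ω ·)) P := hV
  have h2 : ∀ k, MemLp (fun ω => V ω k) 2 P := fun k => (hV'.eval k).memLp_two
  have hVj : Measurable fun ω => V ω j := (measurable_pi_apply j).comp hVm
  have hlaw : P.map (fun ω => V ω j) = gaussianReal 0 1 := by
    rw [(hV'.eval j).map_eq_gaussianReal, h0 j,
      variance_of_integral_eq_zero hVj.aemeasurable (h0 j)]
    have : ∫ ω, V ω j ^ 2 ∂P = 1 := by simp_rw [sq]; exact h1 j
    simp [this]
  by_cases hj : R < u j
  · refine le_trans ?_ le_add_self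
    refine le_trans ?_ (gaussianReal_Ioc_le (h := h) (by linarith) hj)
    rw [← hlaw, Measure.map_apply hVj measurableSet_Ioc]
    exact measure_mono fun ω hω => ⟨hω.1.1, hω.2⟩
  refine le_trans ?_ le_self_add
  set c : J → ℝ := fun k => ∫ ω, V ω k * V ω j ∂P with hc
  -- Correlations are at most `1`: this is where equal variances enter, and it makes the fibres
  -- below upward closed.
  have hc1 : ∀ k, c k ≤ 1 := by
    intro k
    have hs : ∀ k, Integrable (fun ω => V ω k * V ω k) P := fun k => (h2 k).integrable_mul (h2 k)
    have i1 : Integrable (fun ω => (V ω k * V ω k + V ω j * V ω j) / 2) P :=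
      ((hs k).add (hs j)).div_const 2
    have i2 : Integrable (fun ω => V ω k * V ω j) P := (h2 k).integrable_mul (h2 j)
    have := integral_mono i2 i1 fun ω => by
      simp only
      nlinarith [sq_nonneg (V ω k - V ω j)]
    rw [integral_div, integral_add (hs k) (hs j), h1 k, h1 j] at this
    linarith
  set ρ : Ω → J → ℝ := fun ω k => V ω k - c k * V ω j with hρ
  have hρm : Measurable ρ := measurable_pi_lambda _ fun k =>
    ((measurable_pi_apply k).comp hVm).sub (hVj.const_mul _)
  have hind : IndepFun (fun ω => V ω j) ρ P := indepFun_residual hV h0 h1 j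
  have hmap : P.map (fun ω => (V ω j, ρ ω)) = (gaussianReal 0 1).prod (P.map ρ) := by
    rw [← hlaw]
    exact (indepFun_iff_map_prod_eq_prod_map_map hVj.aemeasurable hρm.aemeasurable).1 hind
  have hpair : Measurable fun ω => (V ω j, ρ ω) := hVj.prodMk hρm
  have hA := measurableSet_violatedCone c u j
  have hρP : IsProbabilityMeasure (P.map ρ) := Measure.isProbabilityMeasure_map hρm.aemeasurable
  have hAi : MeasurableSet (violatedCone c u j ∩ {q | q.1 ≤ u j + h}) :=
    hA.inter (measurableSet_le measurable_fst measurable_const)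
  have e1 : {ω | u j < V ω j ∧ ∀ k, V ω k - u k ≤ V ω j - u j
      ∧ (k < j → V ω k - u k < V ω j - u j)}
      = (fun ω => (V ω j, ρ ω)) ⁻¹' violatedCone c u j := by
    ext ω; simp [violatedCone, hρ]
  have e2 : {ω | (u j < V ω j ∧ ∀ k, V ω k - u k ≤ V ω j - u j
      ∧ (k < j → V ω k - u k < V ω j - u j)) ∧ V ω j ≤ u j + h}
      = (fun ω => (V ω j, ρ ω)) ⁻¹' (violatedCone c u j ∩ {q | q.1 ≤ u j + h}) := by
    ext ω; simp [violatedCone, hρ]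
  rw [e1, e2, ← Measure.map_apply hpair hA, ← Measure.map_apply hpair hAi, hmap,
    Measure.prod_apply_symm hA, Measure.prod_apply_symm hAi,
    ← lintegral_const_mul _ (measurable_measure_prodMk_right hA),
    ← lintegral_mul_const _ ((measurable_measure_prodMk_right hA).const_mul _)]
  refine lintegral_mono fun r => ?_
  -- Conditionally on the residual `r`, only the one-dimensional Gaussian variable `V_j` remains.
  -- The threshold satisfies `u j + h ≤ R + 1` in this case.
  refine gaussianReal_inter_Iic_le (S := (fun x => (x, r)) ⁻¹' violatedCone c u j) hR
    (measurable_prodMk_right hA) ?_ (fun x hx => hx.1) (by linarith [not_lt.1 hj])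
  intro x hx y hy
  have hxy : x ≤ y := hy
  refine ⟨hx.1.trans_le hxy, fun k => ?_⟩
  -- Raising `V_j` by `y - x` raises every other coordinate by at most as much, so constraint `j`
  -- stays the most violated, with the same ties broken in its favour.
  have hck : c k * y ≤ c k * x + (y - x) := by nlinarith [hc1 k]
  refine ⟨?_, fun hk => ?_⟩
  · have := (hx.2 k).1
    simp only at this ⊢
    linarith
  · have := (hx.2 k).2 hk
    simp only at this ⊢
    linarith

/-- Nazarov's inequality for unit variances. -/
theorem gaussian_anticoncentration_unit [LinearOrder J] {V : Ω → J → ℝ}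
    (hVm : Measurable V) (hV : HasGaussianLaw V P) (h0 : ∀ j, ∫ ω, V ω j ∂P = 0)
    (h1 : ∀ j, ∫ ω, V ω j * V ω j ∂P = 1) {R h : ℝ} (hR : 1 ≤ R)
    (hcard : (Fintype.card J : ℝ) ≤ Real.exp (R ^ 2 / 2)) (hh : 0 ≤ h) (u : J → ℝ) :
    P.real {ω | ∀ j, V ω j ≤ u j + h} - P.real {ω | ∀ j, V ω j ≤ u j} ≤ 14 * R * h := by
  -- For `h > 1` the right-hand side exceeds `1`.
  by_cases h' : h ≤ 1
  swap
  · have : P.real {ω | ∀ j, V ω j ≤ u j + h} ≤ 1 := measureReal_le_one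
    have h3 : 0 ≤ P.real {ω | ∀ j, V ω j ≤ u j} := measureReal_nonneg
    nlinarith
  set A : J → Set Ω := fun j => {ω | u j < V ω j ∧ ∀ k, V ω k - u k ≤ V ω j - u j
    ∧ (k < j → V ω k - u k < V ω j - u j)} with hA
  have hAm : ∀ j, MeasurableSet (A j) := by
    intro j
    have hk : ∀ k, Measurable fun ω => V ω k - u k := fun k =>
      ((measurable_pi_apply k).comp hVm).sub_const _
    have : A j = {ω | u j < V ω j} ∩ ⋂ k, ({ω | V ω k - u k ≤ V ω j - u j}
      ∩ {ω | k < j → V ω k - u k < V ω j - u j}) := by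
      ext ω; simp [hA]
    rw [this]
    refine (measurableSet_lt measurable_const ((measurable_pi_apply j).comp hVm)).inter
      (MeasurableSet.iInter fun k => (measurableSet_le (hk k) (hk j)).inter ?_)
    by_cases h : k < j
    · simpa [h] using measurableSet_lt (hk k) (hk j)
    · simp [h]
  have hdisj : Pairwise (Function.onFun Disjoint A) := by
    have key : ∀ j k, j < k → ∀ ω, ω ∈ A j → ω ∉ A k := fun j k hjk ω h1 h2 =>
      absurd ((h2.2 j).2 hjk) (not_lt.2 (h1.2 k).1)
    intro j k hjk
    refine Set.disjoint_left.2 fun ω h1 h2 => ?_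
    rcases lt_or_gt_of_ne hjk with h | h
    · exact key j k h ω h1 h2
    · exact key k j h ω h2 h1
  have hsum : ∑ j, P (A j) ≤ 1 := by
    rw [← measure_biUnion_finset (fun j _ k _ hjk => hdisj hjk) fun j _ => hAm j]
    exact prob_le_one
  have hcover : {ω | ∀ j, V ω j ≤ u j + h} \ {ω | ∀ j, V ω j ≤ u j}
      ⊆ ⋃ j ∈ (Finset.univ : Finset J), {ω | (u j < V ω j ∧ ∀ k, V ω k - u k ≤ V ω j - u j
        ∧ (k < j → V ω k - u k < V ω j - u j)) ∧ V ω j ≤ u j + h} := by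
    rintro ω ⟨hω1, hω2⟩
    simp only [Set.mem_ofPred_eq, not_forall, not_le] at hω1 hω2
    obtain ⟨i, hi⟩ := hω2
    obtain ⟨m, -, hm⟩ := Finset.exists_max_image Finset.univ (fun k => V ω k - u k)
      ⟨i, Finset.mem_univ i⟩
    -- Among the indices of maximal violation the smallest is taken; this tie-break makes the events
    -- `A j` disjoint, so their probabilities add up to at most `1`.
    set T : Finset J := Finset.univ.filter fun k => V ω k - u k = V ω m - u m with hT
    have hTne : T.Nonempty := ⟨m, by simp [hT]⟩
    have hjT := T.min'_mem hTne
    set j := T.min' hTne with hj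
    have hjm : V ω j - u j = V ω m - u m := by simpa [hT] using hjT
    simp only [Set.mem_iUnion, Finset.mem_univ, exists_prop, true_and]
    refine ⟨j, ⟨⟨?_, fun k => ⟨?_, fun hk => ?_⟩⟩, hω1 j⟩⟩
    · have := hm i (Finset.mem_univ i)
      linarith
    · rw [hjm]; exact hm k (Finset.mem_univ k)
    · rw [hjm]
      refine lt_of_le_of_ne (hm k (Finset.mem_univ k)) fun he => ?_
      have : k ∈ T := by simp [hT, he]
      exact absurd (T.min'_le k this) (not_le.2 hk)
  have hmain : P ({ω | ∀ j, V ω j ≤ u j + h} \ {ω | ∀ j, V ω j ≤ u j})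
      ≤ ENNReal.ofReal (14 * R * h) := by
    refine (measure_mono hcover).trans ((measure_biUnion_finset_le _ _).trans ?_)
    refine (Finset.sum_le_sum fun j _ => measure_violated_le hVm hV h0 h1 hR u h' j).trans ?_
    rw [Finset.sum_add_distrib, ← Finset.sum_mul, ← Finset.mul_sum, Finset.sum_const,
      Finset.card_univ, nsmul_eq_mul, ← mul_assoc]
    calc ENNReal.ofReal (13 * R) * (∑ j, P (A j)) * ENNReal.ofReal h
          + (Fintype.card J : ℝ≥0∞) * ENNReal.ofReal (Real.exp (-(R ^ 2 / 2))) * ENNReal.ofReal h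
        ≤ ENNReal.ofReal (13 * R) * 1 * ENNReal.ofReal h + 1 * ENNReal.ofReal h := by
          gcongr
          rw [← ENNReal.ofReal_natCast, ← ENNReal.ofReal_mul (by positivity),
            ← ENNReal.ofReal_one]
          apply ENNReal.ofReal_le_ofReal
          rw [Real.exp_neg, ← div_eq_mul_inv, div_le_one (Real.exp_pos _)]
          exact hcard
      _ = ENNReal.ofReal ((13 * R + 1) * h) := by
          rw [mul_one, ← add_mul, ← ENNReal.ofReal_one, ← ENNReal.ofReal_add (by linarith)
            zero_le_one, ← ENNReal.ofReal_mul (by linarith)]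
      _ ≤ _ := ENNReal.ofReal_le_ofReal (mul_le_mul_of_nonneg_right (by linarith) hh)
  have hreal : P.real ({ω | ∀ j, V ω j ≤ u j + h} \ {ω | ∀ j, V ω j ≤ u j}) ≤ 14 * R * h :=
    ENNReal.toReal_le_of_le_ofReal (by positivity) hmain
  have := le_measureReal_sdiff (μ := P) (s₁ := {ω | ∀ j, V ω j ≤ u j + h})
    (s₂ := {ω | ∀ j, V ω j ≤ u j})
  linarith

/-- Nazarov's inequality. -/
theorem gaussian_anticoncentration [LinearOrder J] {Y : Ω → J → ℝ}
    (hYm : Measurable Y) (hY : HasGaussianLaw Y P) (h0 : ∀ j, ∫ ω, Y ω j ∂P = 0) {b : ℝ}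
    (hb : 0 < b) (h1 : ∀ j, b ≤ ∫ ω, Y ω j * Y ω j ∂P) {R h : ℝ} (hR : 1 ≤ R)
    (hcard : (Fintype.card J : ℝ) ≤ Real.exp (R ^ 2 / 2)) (hh : 0 ≤ h) (t : J → ℝ) :
    P.real {ω | ∀ j, Y ω j ≤ t j + h} - P.real {ω | ∀ j, Y ω j ≤ t j}
      ≤ 14 * R / Real.sqrt b * h := by
  set σ : J → ℝ := fun j => Real.sqrt (∫ ω, Y ω j * Y ω j ∂P) with hσ
  have hσb : ∀ j, Real.sqrt b ≤ σ j := fun j => Real.sqrt_le_sqrt (h1 j)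
  have hb0 : 0 < Real.sqrt b := Real.sqrt_pos.2 hb
  have hσ0 : ∀ j, 0 < σ j := fun j => hb0.trans_le (hσb j)
  have hσ2 : ∀ j, σ j * σ j = ∫ ω, Y ω j * Y ω j ∂P := fun j =>
    Real.mul_self_sqrt (hb.le.trans (h1 j))
  let L : (J → ℝ) →L[ℝ] (J → ℝ) :=
    ContinuousLinearMap.pi fun j => (σ j)⁻¹ • ContinuousLinearMap.proj j
  have hV : HasGaussianLaw (fun ω j => (σ j)⁻¹ * Y ω j) P := hY.map_fun L
  have hVm : Measurable fun ω j => (σ j)⁻¹ * Y ω j := measurable_pi_lambda _ fun j =>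
    ((measurable_pi_apply j).comp hYm).const_mul _
  have key := gaussian_anticoncentration_unit hVm hV
    (fun j => by rw [integral_const_mul, h0 j, mul_zero])
    (fun j => by
      have e : ∀ ω, (σ j)⁻¹ * Y ω j * ((σ j)⁻¹ * Y ω j) = (σ j * σ j)⁻¹ * (Y ω j * Y ω j) :=
        fun ω => by rw [mul_inv]; ring
      simp_rw [e]
      rw [integral_const_mul, hσ2 j]
      exact inv_mul_cancel₀ (hb.trans_le (h1 j)).ne')
    -- After normalising to unit variances the shift in coordinate `j` is `h / σ j`, at most `h /
    -- √b`.
    hR hcard (h := h / Real.sqrt b) (by positivity) fun j => (σ j)⁻¹ * t j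
  have e1 : {ω | ∀ j, (σ j)⁻¹ * Y ω j ≤ (σ j)⁻¹ * t j} = {ω | ∀ j, Y ω j ≤ t j} := by
    ext ω
    exact forall_congr' fun j => mul_le_mul_iff_right₀ (inv_pos.2 (hσ0 j))
  have e2 : {ω | ∀ j, Y ω j ≤ t j + h}
      ⊆ {ω | ∀ j, (σ j)⁻¹ * Y ω j ≤ (σ j)⁻¹ * t j + h / Real.sqrt b} := by
    intro ω hω j
    have s1 := mul_le_mul_of_nonneg_left (hω j) (inv_pos.2 (hσ0 j)).le
    have s2 : (σ j)⁻¹ * h ≤ h / Real.sqrt b := by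
      rw [inv_mul_eq_div]
      exact div_le_div_of_nonneg_left hh hb0 (hσb j)
    rw [mul_add] at s1
    linarith
  rw [e1] at key
  have := measureReal_mono (μ := P) e2
  calc _ ≤ 14 * R * (h / Real.sqrt b) := by linarith
    _ = _ := by ring

end Nazarov

/-! ### Moment bounds -/

section MomentBounds

variable {Ω : Type*} [MeasurableSpace Ω] {P : Measure Ω} [IsProbabilityMeasure P]

theorem map_eq_gaussianReal_of_centered {y : Ω → ℝ} (hy : HasGaussianLaw y P)
    (h0 : ∫ ω, y ω ∂P = 0) : P.map y = gaussianReal 0 (∫ ω, y ω ^ 2 ∂P).toNNReal := by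
  rw [hy.map_eq_gaussianReal, h0, variance_of_integral_eq_zero hy.aemeasurable h0]

/-- The third absolute moment of the standard Gaussian law. -/
def gaussianThirdMoment : ℝ := ∫ x, |x| ^ 3 ∂(gaussianReal 0 1)

theorem gaussianThirdMoment_nonneg : 0 ≤ gaussianThirdMoment :=
  integral_nonneg fun _ => by positivity

theorem integral_abs_pow_three_gaussian {y : Ω → ℝ} (hy : HasGaussianLaw y P)
    (h0 : ∫ ω, y ω ∂P = 0) :
    ∫ ω, |y ω| ^ 3 ∂P = gaussianThirdMoment * Real.sqrt (∫ ω, y ω ^ 2 ∂P) ^ 3 := by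
  set s := Real.sqrt (∫ ω, y ω ^ 2 ∂P) with hs
  have hv : 0 ≤ ∫ ω, y ω ^ 2 ∂P := integral_nonneg fun _ => sq_nonneg _
  have hm : P.map y = (gaussianReal 0 1).map (s * ·) := by
    rw [map_eq_gaussianReal_of_centered hy h0, gaussianReal_map_const_mul, mul_zero, mul_one]
    congr 1
    ext
    simp [hs, Real.sq_sqrt hv, hv]
  have hf : AEStronglyMeasurable (fun x : ℝ => |x| ^ 3) (P.map y) := by fun_prop
  rw [← integral_map hy.aemeasurable hf, hm, integral_map (by fun_prop) (by fun_prop)]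
  simp_rw [abs_mul, mul_pow]
  rw [integral_const_mul, abs_of_nonneg (Real.sqrt_nonneg _), mul_comm]
  rfl

/-- `exp |x| ≤ exp x + exp (-x)`, and each of the two Gaussian transforms is at most `exp (1/2) ≤
2`. -/
theorem integral_exp_abs_div_gaussian_le {y : Ω → ℝ} (hy : HasGaussianLaw y P)
    (h0 : ∫ ω, y ω ∂P = 0) {l : ℝ} (hl : 0 < l) (h2 : ∫ ω, y ω ^ 2 ∂P ≤ l ^ 2) :
    Integrable (fun ω => Real.exp (|y ω| / l)) P ∧ ∫ ω, Real.exp (|y ω| / l) ∂P ≤ 4 := by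
  have hv : 0 ≤ ∫ ω, y ω ^ 2 ∂P := integral_nonneg fun _ => sq_nonneg _
  have hm := map_eq_gaussianReal_of_centered hy h0
  have hi : ∀ t : ℝ, Integrable (fun ω => Real.exp (t * y ω)) P := fun t => by
    have : Integrable (fun x => Real.exp (t * x)) (P.map y) := by
      rw [hm]; exact integrable_exp_mul_gaussianReal t
    exact this.comp_aemeasurable hy.aemeasurable
  have he : ∀ t : ℝ, t ^ 2 = (l ^ 2)⁻¹ → ∫ ω, Real.exp (t * y ω) ∂P ≤ 2 := fun t ht => by
    have := mgf_gaussianReal hm t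
    unfold mgf at this
    rw [this, zero_mul, zero_add, Real.coe_toNNReal _ hv, ht, ← div_eq_mul_inv]
    have h1 : (∫ ω, y ω ^ 2 ∂P) / l ^ 2 / 2 ≤ 1 / 2 := by
      have : (∫ ω, y ω ^ 2 ∂P) / l ^ 2 ≤ 1 := by rw [div_le_one (by positivity)]; exact h2
      linarith
    refine (Real.exp_le_exp.2 h1).trans ?_
    have h2 : Real.exp (1 / 2) ^ 2 = Real.exp 1 := by rw [← Real.exp_nat_mul]; norm_num
    have := Real.exp_one_lt_d9
    nlinarith [Real.exp_pos (1 / 2)]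
  have hb : ∀ ω, Real.exp (|y ω| / l) ≤ Real.exp (l⁻¹ * y ω) + Real.exp (-l⁻¹ * y ω) := fun ω => by
    have e : |y ω| / l = |l⁻¹ * y ω| := by
      rw [abs_mul, abs_of_pos (inv_pos.2 hl), div_eq_inv_mul]
    rw [e, neg_mul]
    rcases abs_choice (l⁻¹ * y ω) with h | h <;> rw [h]
    · linarith [Real.exp_pos (-(l⁻¹ * y ω))]
    · linarith [Real.exp_pos (l⁻¹ * y ω)]
  have hsum := (hi l⁻¹).add (hi (-l⁻¹))
  refine ⟨hsum.mono' ?_ (ae_of_all _ fun ω => ?_), ?_⟩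
  · exact ((hy.aemeasurable.abs.div_const l).exp).aestronglyMeasurable
  · rw [Real.norm_eq_abs, abs_of_pos (Real.exp_pos _)]
    exact hb ω
  · refine (integral_mono_of_nonneg (ae_of_all _ fun ω => (Real.exp_pos _).le) hsum
      (ae_of_all _ hb)).trans ?_
    simp only [Pi.add_apply]
    rw [integral_add (hi _) (hi _)]
    linarith [he l⁻¹ (by rw [inv_pow]), he (-l⁻¹) (by rw [neg_sq, inv_pow])]

/-- Lyapunov's inequality, from averaging `3 y^2 s ≤ 2 y^3 + s^3` with `s` the `L²` norm. It bounds
the third moments of the Gaussian analogue by those of the original summand. -/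
theorem sqrt_integral_sq_pow_three_le {x : Ω → ℝ} (hx : MemLp x 3 P) :
    Real.sqrt (∫ ω, x ω ^ 2 ∂P) ^ 3 ≤ ∫ ω, |x ω| ^ 3 ∂P := by
  set s := Real.sqrt (∫ ω, x ω ^ 2 ∂P) with hs
  have s0 : 0 ≤ s := Real.sqrt_nonneg _
  have hv : 0 ≤ ∫ ω, x ω ^ 2 ∂P := integral_nonneg fun _ => sq_nonneg _
  have h2 : MemLp x 2 P := hx.mono_exponent (by norm_num)
  have i2 : Integrable (fun ω => 3 * (|x ω| ^ 2 * s)) P := by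
    simp_rw [sq_abs]
    exact (h2.integrable_sq.mul_const s).const_mul 3
  have i3 := integrable_abs_pow_three hx
  have i3' : Integrable (fun ω => 2 * |x ω| ^ 3 + s ^ 3) P :=
    (i3.const_mul 2).add (integrable_const _)
  have := integral_mono i2 i3' fun ω => three_mul_sq_mul_le (abs_nonneg (x ω)) s0
  rw [integral_add (i3.const_mul 2) (integrable_const _), integral_const_mul, integral_const_mul,
    integral_mul_const] at this
  simp_rw [sq_abs] at this
  rw [← Real.sq_sqrt hv, ← hs] at this
  simp only [integral_const, probReal_univ, smul_eq_mul, one_mul] at this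
  nlinarith

theorem sq_le_two_mul_exp {t : ℝ} (ht : 0 ≤ t) : t ^ 2 ≤ 2 * Real.exp t := by
  have := Real.quadratic_le_exp_of_nonneg ht
  nlinarith

theorem natCast_mul_exp_neg_le {n : ℕ} {c : ℝ} (hn : 0 < n) (hnc : (n : ℝ) ≤ Real.exp c) :
    n * Real.exp (-(2 * c)) ≤ (n : ℝ)⁻¹ := by
  have hn0 : (0 : ℝ) < n := Nat.cast_pos.2 hn
  have h1 : Real.exp (-(2 * c)) = (Real.exp c)⁻¹ * (Real.exp c)⁻¹ := by
    rw [← Real.exp_neg, ← Real.exp_add]; congr 1; ring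
  have h2 : (Real.exp c)⁻¹ ≤ (n : ℝ)⁻¹ := inv_anti₀ hn0 hnc
  have h3 : 0 < (Real.exp c)⁻¹ := inv_pos.2 (Real.exp_pos c)
  rw [h1]
  calc n * ((Real.exp c)⁻¹ * (Real.exp c)⁻¹) ≤ n * ((n : ℝ)⁻¹ * (n : ℝ)⁻¹) := by gcongr
    _ = (n : ℝ)⁻¹ := mul_inv_cancel_left₀ hn0.ne' _

variable {J : Type*} [Fintype J]

/-- Only the largest coordinate matters. With `t = |z_j| / (2l)`, the norm exceeding `1` forces `t ≥
3c`. Half of the exponent `2t` absorbs the square `t^2`, the other half provides the factor `exp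
(-3c)`. -/
theorem tailSq_le_sum_exp {z : J → ℝ} {γ l c : ℝ} (hγ : 0 < γ) (hl : 0 < l)
    (h : 6 * c * (γ * l) ≤ 1) :
    tailSq (γ • z) ≤ ∑ j, 8 * (γ * l) ^ 2 * Real.exp (-(3 * c)) * Real.exp (|z j| / l) := by
  have n0 : ∀ j, 0 ≤ 8 * (γ * l) ^ 2 * Real.exp (-(3 * c)) * Real.exp (|z j| / l) := fun j => by
    positivity
  unfold tailSq
  split_ifs with h1
  swap
  · exact Finset.sum_nonneg fun j _ => n0 j
  have hne : Nonempty J := by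
    by_contra hJ
    rw [not_nonempty_iff] at hJ
    have : γ • z = 0 := Subsingleton.elim _ _
    rw [this, norm_zero] at h1
    linarith
  obtain ⟨j, -, hj⟩ := Finset.exists_max_image Finset.univ (fun j => |(γ • z) j|)
    ⟨Classical.arbitrary J, Finset.mem_univ _⟩
  have hn : ‖γ • z‖ = |(γ • z) j| := by
    refine le_antisymm ((pi_norm_le_iff_of_nonneg (abs_nonneg _)).2 fun k => ?_)
      (norm_le_pi_norm (γ • z) j)
    exact hj k (Finset.mem_univ k)
  refine le_trans ?_ (Finset.single_le_sum (fun j _ => n0 j) (Finset.mem_univ j))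
  rw [hn] at h1 ⊢
  have hz : |(γ • z) j| = γ * |z j| := by
    rw [Pi.smul_apply, smul_eq_mul, abs_mul, abs_of_pos hγ]
  rw [hz] at h1 ⊢
  set t := |z j| / (2 * l) with ht
  have t0 : 0 ≤ t := by positivity
  have hzt : |z j| = 2 * l * t := by rw [ht]; field_simp
  have h3 : 3 * c ≤ t := by
    rw [hzt] at h1
    have hgl : 0 < γ * l := by positivity
    by_contra hlt
    push Not at hlt
    nlinarith
  have e1 : |z j| / l = t + t := by rw [hzt]; field_simp; ring
  have e2 : Real.exp t ≤ Real.exp (-(3 * c)) * Real.exp (t + t) := by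
    rw [← Real.exp_add]; exact Real.exp_le_exp.2 (by linarith)
  rw [e1, hzt]
  calc (γ * (2 * l * t)) ^ 2 = 4 * (γ * l) ^ 2 * t ^ 2 := by ring
    _ ≤ 4 * (γ * l) ^ 2 * (2 * (Real.exp (-(3 * c)) * Real.exp (t + t))) := by
        refine mul_le_mul_of_nonneg_left ?_ (by positivity)
        exact (sq_le_two_mul_exp t0).trans (by linarith)
    _ = _ := by ring

/-- The sum over at most `exp c` coordinates uses up one of the three factors `exp (-c)`; the
numerical constants fit because `6γl ≤ 1` gives `8 · 4 · (γl)^2 ≤ 32/36`. -/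
theorem integral_tailSq_le_of_exp {z : Ω → J → ℝ} {γ l c : ℝ} (hγ : 0 < γ) (hl : 0 < l)
    (hc : 1 ≤ c) (h : 6 * c * (γ * l) ≤ 1) (hcard : (Fintype.card J : ℝ) ≤ Real.exp c)
    (hi : ∀ j, Integrable (fun ω => Real.exp (|z ω j| / l)) P)
    (h4 : ∀ j, ∫ ω, Real.exp (|z ω j| / l) ∂P ≤ 4) :
    ∫ ω, tailSq (γ • z ω) ∂P ≤ Real.exp (-(2 * c)) := by
  have hs := integrable_finsetSum (μ := P) Finset.univ fun j _ =>
    (hi j).const_mul (8 * (γ * l) ^ 2 * Real.exp (-(3 * c)))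
  refine (integral_mono_of_nonneg (ae_of_all _ fun ω => tailSq_nonneg _) hs
    (ae_of_all _ fun ω => tailSq_le_sum_exp hγ hl h)).trans ?_
  rw [integral_finsetSum _ fun j _ => (hi j).const_mul _]
  simp_rw [integral_const_mul]
  have hgl : 0 < γ * l := by positivity
  have h6 : 6 * (γ * l) ≤ 1 := by nlinarith
  calc ∑ j, 8 * (γ * l) ^ 2 * Real.exp (-(3 * c)) * ∫ ω, Real.exp (|z ω j| / l) ∂P
      ≤ ∑ _j : J, Real.exp (-(3 * c)) := by
        refine Finset.sum_le_sum fun j _ => ?_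
        have e0 := Real.exp_pos (-(3 * c))
        have := mul_le_mul_of_nonneg_left (h4 j)
          (show 0 ≤ 8 * (γ * l) ^ 2 * Real.exp (-(3 * c)) by positivity)
        have h36 : 36 * (γ * l) ^ 2 ≤ 1 := by nlinarith
        nlinarith
    _ = Fintype.card J * Real.exp (-(3 * c)) := by simp
    _ ≤ Real.exp c * Real.exp (-(3 * c)) := mul_le_mul_of_nonneg_right hcard (Real.exp_pos _).le
    _ = _ := by rw [← Real.exp_add]; congr 1; ring

end MomentBounds

/-! ### Comparison with a Gaussian sum over rectangles -/

section Rectangles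

variable {J : Type*} [Fintype J] {Ω : Type*} [MeasurableSpace Ω] {Q : Measure Ω}
  [IsProbabilityMeasure Q] {n : ℕ} {z : Fin n → Ω → Bool → J → ℝ}

/-- The distribution function of `n^{-1/2} ∑_i z_i(b)`. -/
def sumCdf (Q : Measure Ω) (z : Fin n → Ω → Bool → J → ℝ) (b : Bool) (t : J → ℝ) : ℝ :=
  Q.real {ω | ∀ j, (Real.sqrt n)⁻¹ * ∑ i, z i ω b j ≤ t j}

theorem sumCdf_eq_mixCdf {β : ℝ} (hβ : 0 < β) (b : Bool) (t : J → ℝ) :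
    sumCdf Q z b t
      = mixCdf Q (fun i ω b => (β * (Real.sqrt n)⁻¹) • z i ω b) (fun _ => b) fun j => β * t j := by
  unfold sumCdf mixCdf
  congr 1
  ext ω
  refine forall_congr' fun j => ?_
  unfold mixSum
  rw [← Finset.smul_sum, Pi.smul_apply, Finset.sum_apply, smul_eq_mul, mul_assoc,
    mul_le_mul_iff_right₀ hβ]

theorem integral_sq_normalized_sum (hz : ∀ i, Measurable (z i)) (hind : iIndepFun z Q) (b : Bool)
    (j : J) (h2 : ∀ i, MemLp (fun ω => z i ω b j) 2 Q) (h0 : ∀ i, ∫ ω, z i ω b j ∂Q = 0) :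
    ∫ ω, ((Real.sqrt n)⁻¹ * ∑ i, z i ω b j) * ((Real.sqrt n)⁻¹ * ∑ i, z i ω b j) ∂Q
      = (n : ℝ)⁻¹ * ∑ i, ∫ ω, z i ω b j ^ 2 ∂Q := by
  have e : ∀ ω, ((Real.sqrt n)⁻¹ * ∑ i, z i ω b j) * ((Real.sqrt n)⁻¹ * ∑ i, z i ω b j)
      = (n : ℝ)⁻¹ * (∑ i, z i ω b j) ^ 2 := fun ω => by
    have : (Real.sqrt n)⁻¹ * (Real.sqrt n)⁻¹ = (n : ℝ)⁻¹ := by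
      rw [← mul_inv, Real.mul_self_sqrt (Nat.cast_nonneg n)]
    rw [← this]; ring
  simp_rw [e]
  rw [integral_const_mul]
  congr 1
  have hm : Measurable fun x : Bool → J → ℝ => x b j :=
    (measurable_pi_apply j).comp (measurable_pi_apply b)
  have hpair : Set.Pairwise (↑(Finset.univ : Finset (Fin n)))
      fun i k => IndepFun (fun ω => z i ω b j) (fun ω => z k ω b j) Q := fun i _ k _ hik =>
    (hind.indepFun hik).comp hm hm
  have hvar := IndepFun.variance_sum (s := Finset.univ) (fun i _ => h2 i) hpair
  have hs : ∫ ω, (∑ i, fun ω => z i ω b j) ω ∂Q = 0 := by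
    simp only [Finset.sum_apply]
    rw [integral_finsetSum _ fun i _ => (h2 i).integrable one_le_two]
    simp [h0]
  have hae : ∀ i, AEMeasurable (fun ω => z i ω b j) Q := fun i => (hm.comp (hz i)).aemeasurable
  rw [variance_of_integral_eq_zero (Finset.aemeasurable_sum _ fun i _ => hae i) hs] at hvar
  simp only [Finset.sum_apply] at hvar
  rw [hvar]
  exact Finset.sum_congr rfl fun i _ => variance_of_integral_eq_zero (hae i) (h0 i)

/-- Anti-concentration for the normalized Gaussian sum. -/
theorem sumCdf_add_sub_le [LinearOrder J] (hz : ∀ i, Measurable (z i)) (hind : iIndepFun z Q)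
    (hg : ∀ i, HasGaussianLaw (fun ω => z i ω false) Q)
    (h0 : ∀ i j, ∫ ω, z i ω false j ∂Q = 0) {b c : ℝ} (hb : 0 < b)
    (hM1 : ∀ j, b ≤ (n : ℝ)⁻¹ * ∑ i, ∫ ω, z i ω false j ^ 2 ∂Q) (hc : 1 ≤ c)
    (hcard : (Fintype.card J : ℝ) ≤ Real.exp c) (t : J → ℝ) {h : ℝ} (hh : 0 ≤ h) :
    sumCdf Q z false (fun j => t j + h) - sumCdf Q z false t
      ≤ 14 * Real.sqrt (2 * c) / Real.sqrt b * h := by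
  have hg' : ∀ i, HasGaussianLaw (fun ω => (z i ω false ·)) Q := hg
  have hzf : ∀ i, Measurable fun ω => z i ω false := fun i => (measurable_pi_apply false).comp (hz i)
  have hsumG : HasGaussianLaw (fun ω => ∑ i, z i ω false) Q :=
    iIndepFun.hasGaussianLaw_fun_sum hg
      (hind.comp (fun _ (x : Bool → J → ℝ) => x false) fun _ => measurable_pi_apply false)
  have hY : HasGaussianLaw (fun ω j => (Real.sqrt n)⁻¹ * ∑ i, z i ω false j) Q := by
    have e : (fun ω j => (Real.sqrt n)⁻¹ * ∑ i, z i ω false j)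
        = fun ω => (Real.sqrt n)⁻¹ • ∑ i, z i ω false := by
      funext ω j
      simp
    rw [e]
    exact hsumG.fun_smul (Real.sqrt n)⁻¹
  have h2 : ∀ i j, MemLp (fun ω => z i ω false j) 2 Q := fun i j => ((hg' i).eval j).memLp_two
  refine gaussian_anticoncentration ?_ hY (fun j => ?_) hb (fun j => ?_) ?_ ?_ hh t
  · exact measurable_pi_lambda _ fun j => (Finset.measurable_sum _ fun i _ =>
      (measurable_pi_apply j).comp (hzf i)).const_mul _
  · rw [integral_const_mul, integral_finsetSum _ fun i _ => (h2 i j).integrable one_le_two]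
    simp [h0]
  · rw [integral_sq_normalized_sum hz hind false j (fun i => h2 i j) fun i => h0 i j]
    exact hM1 j
  -- Nazarov's inequality is used with `R = √(2c)`, so that `exp (R^2 / 2) = exp c` bounds the
  -- number of coordinates.
  · rw [Real.one_le_sqrt]; linarith
  · rw [Real.sq_sqrt (by linarith)]
    convert hcard using 2
    ring

/-- Comparison of a normalized sum with its Gaussian analogue over rectangles. -/
theorem abs_sumCdf_sub_le [Nonempty J] [LinearOrder J] {K c : ℝ} (g : SmoothCutoff K c)
    (hK : 1 ≤ K) (hc : 1 ≤ c) (hn : 0 < n) (hnc : (n : ℝ) ≤ Real.exp c)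
    (hcard : (Fintype.card J : ℝ) ≤ Real.exp c)
    (hz : ∀ i, Measurable (z i)) (hind : iIndepFun z Q)
    (h3 : ∀ i j, MemLp (fun ω => z i ω true j) 3 Q)
    (hg : ∀ i, HasGaussianLaw (fun ω => z i ω false) Q)
    (h0 : ∀ i b j, ∫ ω, z i ω b j ∂Q = 0)
    (hv : ∀ i j k, ∫ ω, z i ω true j * z i ω true k ∂Q = ∫ ω, z i ω false j * z i ω false k ∂Q)
    {b B β Δ : ℝ} (hb : 0 < b) (hB : 1 ≤ B)
    (hM1 : ∀ j, b ≤ (n : ℝ)⁻¹ * ∑ i, ∫ ω, z i ω true j ^ 2 ∂Q)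
    (hM2 : ∀ j, (n : ℝ)⁻¹ * ∑ i, ∫ ω, |z i ω true j| ^ 3 ∂Q ≤ B)
    (hvar : ∀ i j, ∫ ω, z i ω true j ^ 2 ∂Q ≤ 4 * B ^ 2)
    (hβ : 0 < β) (hβ1 : 12 * c * (β * B) ≤ Real.sqrt n)
    (hβ2 : 6000 * K * (1 + gaussianThirdMoment) * (β ^ 3 * B) ≤ c * Real.sqrt n)
    (hΔ : ∑ i, ∫ ω, tailSq ((β * (Real.sqrt n)⁻¹) • z i ω true) ∂Q ≤ Δ) (t : J → ℝ) :
    |sumCdf Q z true t - sumCdf Q z false t|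
      ≤ 8 * (14 * Real.sqrt (2 * c) / Real.sqrt b / β) * c + 8 * K * (Δ + (n : ℝ)⁻¹) := by
  have hn0 : (0 : ℝ) < n := Nat.cast_pos.2 hn
  have hsn : 0 < Real.sqrt n := Real.sqrt_pos.2 hn0
  have hsq : Real.sqrt n * Real.sqrt n = n := Real.mul_self_sqrt hn0.le
  have hK3 := gaussianThirdMoment_nonneg
  set γ : ℝ := β * (Real.sqrt n)⁻¹ with hγ
  have γ0 : 0 < γ := by positivity
  have hγn : γ * Real.sqrt n = β := by rw [hγ]; field_simp
  have hg' : ∀ i, HasGaussianLaw (fun ω => (z i ω false ·)) Q := hg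
  have hgj : ∀ i j, HasGaussianLaw (fun ω => z i ω false j) Q := fun i j => (hg' i).eval j
  have h3b : ∀ i b j, MemLp (fun ω => z i ω b j) 3 Q := by
    intro i b j
    cases b
    · exact (hgj i j).memLp (by norm_num)
    · exact h3 i j
  have hzb : ∀ i b, Measurable fun ω => z i ω b := fun i b => (measurable_pi_apply b).comp (hz i)
  have hv2 : ∀ i j, ∫ ω, z i ω false j ^ 2 ∂Q = ∫ ω, z i ω true j ^ 2 ∂Q := fun i j => by
    simp_rw [sq]; exact (hv i j j).symm
  have hy3 : ∀ i j, ∫ ω, |z i ω false j| ^ 3 ∂Q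
      ≤ gaussianThirdMoment * ∫ ω, |z i ω true j| ^ 3 ∂Q := fun i j => by
    rw [integral_abs_pow_three_gaussian (hgj i j) (h0 i false j), hv2 i j]
    exact mul_le_mul_of_nonneg_left (sqrt_integral_sq_pow_three_le (h3 i j)) hK3
  have hanti := fun (t : J → ℝ) (h : ℝ) (hh : 0 ≤ h) =>
    sumCdf_add_sub_le hz hind hg (fun i j => h0 i false j) hb
      (fun j => by simp_rw [hv2]; exact hM1 j) hc hcard t hh
  set N : ℝ := 14 * Real.sqrt (2 * c) / Real.sqrt b with hN
  set M : ℝ := (1 + gaussianThirdMoment) * (β ^ 3 * B) / Real.sqrt n with hM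
  have htail : ∀ i, ∫ ω, tailSq (γ • z i ω false) ∂Q ≤ Real.exp (-(2 * c)) := by
    intro i
    -- Matching variances are at most `4 B^2`, which makes `2B` an admissible exponential scale for
    -- the Gaussian summands.
    have he := fun j => integral_exp_abs_div_gaussian_le (hgj i j) (h0 i false j)
      (l := 2 * B) (by linarith) (by rw [hv2]; exact (hvar i j).trans (by ring_nf; rfl))
    refine integral_tailSq_le_of_exp (l := 2 * B) γ0 (by linarith) hc ?_ hcard
      (fun j => (he j).1) fun j => (he j).2
    have : 12 * c * (β * B) * (Real.sqrt n)⁻¹ ≤ 1 := by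
      rw [← div_eq_mul_inv, div_le_one hsn]; exact hβ1
    calc 6 * c * (γ * (2 * B)) = 12 * c * (β * B) * (Real.sqrt n)⁻¹ := by rw [hγ]; ring
      _ ≤ 1 := this
  have key := abs_mixCdf_sub_le (Z := fun i ω b => γ • z i ω b) (P := Q) g hK hc
    (by
      rw [Real.log_le_iff_le_exp (by exact_mod_cast Fintype.card_pos)]
      exact hcard)
    (fun i => (hz i).const_smul γ)
    (hind.comp (fun _ (x : Bool → J → ℝ) => γ • x) fun _ => measurable_id.const_smul γ)
    (fun i b j => (h3b i b j).const_mul γ)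
    (fun i j => by
      simp only [Pi.smul_apply, smul_eq_mul]
      rw [integral_const_mul, integral_const_mul, h0, h0])
    (fun i j k => by
      have e : ∀ b ω, (γ • z i ω b) j * (γ • z i ω b) k = γ * γ * (z i ω b j * z i ω b k) :=
        fun b ω => by simp only [Pi.smul_apply, smul_eq_mul]; ring
      simp_rw [e]
      rw [integral_const_mul, integral_const_mul, hv])
    -- The added `1/n` is the total tail of the Gaussian summands, at most `n exp (-2c)`; rescaling
    -- by `β` divides the anti-concentration constant by `β`.
    (M := M) (Δ := Δ + (n : ℝ)⁻¹) (N := N / β)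
    (fun j => by
      have e : ∀ i b ω, |(γ • z i ω b) j| ^ 3 = γ ^ 3 * |z i ω b j| ^ 3 := fun i b ω => by
        rw [Pi.smul_apply, smul_eq_mul, abs_mul, mul_pow, abs_of_pos γ0]
      simp_rw [e, integral_const_mul, ← Finset.mul_sum]
      have h1 : ∑ i, ∑ b, ∫ ω, |z i ω b j| ^ 3 ∂Q ≤ (1 + gaussianThirdMoment) * (n * B) := by
        calc ∑ i, ∑ b, ∫ ω, |z i ω b j| ^ 3 ∂Q
            ≤ ∑ i, (1 + gaussianThirdMoment) * ∫ ω, |z i ω true j| ^ 3 ∂Q := by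
              refine Finset.sum_le_sum fun i _ => ?_
              rw [Fintype.sum_bool]
              linarith [hy3 i j]
          _ = (1 + gaussianThirdMoment) * (n * ((n : ℝ)⁻¹ * ∑ i, ∫ ω, |z i ω true j| ^ 3 ∂Q)) := by
              rw [← Finset.mul_sum, mul_inv_cancel_left₀ hn0.ne']
          _ ≤ _ := by
              refine mul_le_mul_of_nonneg_left ?_ (by linarith)
              exact mul_le_mul_of_nonneg_left (hM2 j) hn0.le
      refine (mul_le_mul_of_nonneg_left h1 (by positivity)).trans (le_of_eq ?_)
      rw [hM, eq_div_iff hsn.ne', ← hγn]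
      linear_combination -(γ ^ 3 * (1 + gaussianThirdMoment) * B * Real.sqrt n) * hsq)
    (by
      simp_rw [Fintype.sum_bool]
      rw [Finset.sum_add_distrib]
      refine add_le_add hΔ ?_
      refine (Finset.sum_le_sum fun i _ => htail i).trans ?_
      rw [Finset.sum_const, Finset.card_univ, Fintype.card_fin, nsmul_eq_mul]
      exact natCast_mul_exp_neg_le hn hnc)
    (fun t h hh => by
      have := hanti (fun j => t j / β) (h / β) (by positivity)
      rw [sumCdf_eq_mixCdf hβ, sumCdf_eq_mixCdf hβ] at this
      have e1 : (fun j => β * (t j / β + h / β)) = fun j => t j + h := by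
        funext j; field_simp
      have e2 : (fun j => β * (t j / β)) = t := by
        funext j; field_simp
      rw [e1, e2] at this
      refine this.trans (le_of_eq ?_)
      ring)
    (by
      rw [hM, mul_div_assoc', div_le_iff₀ hsn]
      calc 6000 * K * ((1 + gaussianThirdMoment) * (β ^ 3 * B))
          = 6000 * K * (1 + gaussianThirdMoment) * (β ^ 3 * B) := by ring
        _ ≤ _ := hβ2)
    (fun j => β * t j)
  rw [sumCdf_eq_mixCdf hβ, sumCdf_eq_mixCdf hβ]
  exact key

end Rectangles

/-! ### Transfer to a product space -/

section Transfer

variable {Ω Ω' : Type*} [MeasurableSpace Ω] [MeasurableSpace Ω'] {P : Measure Ω}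
  [IsProbabilityMeasure P] {P' : Measure Ω'} [IsProbabilityMeasure P']

/-- By independence the joint law is the product of the marginals, so matching marginals is enough.
-/
theorem map_pi_eq_map_of_iIndepFun {E F : Type*} [MeasurableSpace E] [MeasurableSpace F] {n : ℕ}
    {X : Fin n → Ω → E} (hX : ∀ i, AEMeasurable (X i) P) (hind : iIndepFun X P)
    {ν : Fin n → Measure F} [∀ i, IsProbabilityMeasure (ν i)] {f : F → E} (hf : Measurable f)
    (hν : ∀ i, (ν i).map f = P.map (X i)) :
    IdentDistrib (fun (ω : Fin n → F) i => f (ω i)) (fun ω i => X i ω) (Measure.pi ν) P where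
  aemeasurable_fst :=
    (measurable_pi_lambda _ fun i => hf.comp (measurable_pi_apply i)).aemeasurable
  aemeasurable_snd := aemeasurable_pi_lambda _ hX
  map_eq := by
    have : ∀ i, IsProbabilityMeasure ((ν i).map f) := fun i =>
      Measure.isProbabilityMeasure_map hf.aemeasurable
    rw [hind.map_fun_eq_pi_map hX, Measure.pi_map_pi fun i => hf.aemeasurable]
    simp_rw [hν]

/-- Two independent families can be realised as the coordinates of independent pairs. -/
theorem exists_independent_pairs {E : Type*} [MeasurableSpace E] {n : ℕ} {X : Fin n → Ω → E}
    {Y : Fin n → Ω' → E} (hX : ∀ i, AEMeasurable (X i) P) (hXi : iIndepFun X P)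
    (hY : ∀ i, AEMeasurable (Y i) P') (hYi : iIndepFun Y P') :
    ∃ Q : Measure (Fin n → E × E), IsProbabilityMeasure Q ∧ iIndepFun (fun i ω => ω i) Q ∧
      IdentDistrib (fun (ω : Fin n → E × E) i => (ω i).1) (fun ω i => X i ω) Q P ∧
      IdentDistrib (fun (ω : Fin n → E × E) i => (ω i).2) (fun ω i => Y i ω) Q P' := by
  have p1 : ∀ i, IsProbabilityMeasure (P.map (X i)) := fun i =>
    Measure.isProbabilityMeasure_map (hX i)
  have p2 : ∀ i, IsProbabilityMeasure (P'.map (Y i)) := fun i =>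
    Measure.isProbabilityMeasure_map (hY i)
  refine ⟨Measure.pi fun i => (P.map (X i)).prod (P'.map (Y i)), inferInstance,
    iIndepFun_pi (X := fun _ q => q) fun i => aemeasurable_id,
    map_pi_eq_map_of_iIndepFun hX hXi measurable_fst fun i => ?_,
    map_pi_eq_map_of_iIndepFun hY hYi measurable_snd fun i => ?_⟩
  · rw [Measure.map_fst_prod, measure_univ, one_smul]
  · rw [Measure.map_snd_prod, measure_univ, one_smul]

variable {p n : ℕ}

/-- The inner products with the elements of a finite set of vectors. -/
def projSet (W : Finset (Vec p)) : Vec p →L[ℝ] (W → ℝ) :=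
  ContinuousLinearMap.pi fun v => innerSL ℝ (v : Vec p)

theorem projSet_apply (W : Finset (Vec p)) (x : Vec p) (v : W) :
    projSet W x v = inner ℝ (v : Vec p) x := rfl

/-- The distribution function of the inner products of the normalized sum with the vectors of a
finite set. -/
def rectCdf (P : Measure Ω) (X : Fin n → Ω → Vec p) (W : Finset (Vec p)) (t : W → ℝ) : ℝ :=
  P.real {ω | ∀ v : W, inner ℝ (normalizedSum X ω) (v : Vec p) ≤ t v}

theorem rectCdf_eq_of_identDistrib {Ω₀ : Type*} [MeasurableSpace Ω₀] {Q : Measure Ω₀}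
    {X₀ : Fin n → Ω₀ → Vec p} {X : Fin n → Ω → Vec p}
    (h : IdentDistrib (fun ω i => X₀ i ω) (fun ω i => X i ω) Q P)
    (W : Finset (Vec p)) (t : W → ℝ) : rectCdf Q X₀ W t = rectCdf P X W t := by
  set s : Set (Fin n → Vec p) :=
    {x | ∀ v : W, inner ℝ ((Real.sqrt n)⁻¹ • ∑ i, x i) (v : Vec p) ≤ t v} with hs
  have hsm : MeasurableSet s := by
    have : s = ⋂ v : W, {x | inner ℝ ((Real.sqrt n)⁻¹ • ∑ i, x i) (v : Vec p) ≤ t v} := by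
      ext x; simp [hs]
    rw [this]
    refine MeasurableSet.iInter fun v => measurableSet_le ?_ measurable_const
    have hm : Measurable fun x : Fin n → Vec p => (Real.sqrt n)⁻¹ • ∑ i, x i := by fun_prop
    exact hm.inner_const
  unfold rectCdf Measure.real
  exact congrArg ENNReal.toReal (h.measure_mem_eq hsm)

theorem inner_eq_sum (v x : Vec p) : inner ℝ v x = ∑ k, v k * x k := by
  simp [PiLp.inner_apply, mul_comm]

theorem integral_inner_eq_zero {X : Ω → Vec p} (h2 : MemLp X 2 P)
    (h0 : ∀ k, ∫ ω, X ω k ∂P = 0) (v : Vec p) : ∫ ω, inner ℝ v (X ω) ∂P = 0 := by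
  simp_rw [inner_eq_sum]
  rw [integral_finsetSum _ fun k _ => ((h2.eval_piLp k).integrable one_le_two).const_mul _]
  simp_rw [integral_const_mul, h0]
  simp

theorem integral_inner_mul_inner {X : Ω → Vec p} (h2 : MemLp X 2 P) (v w : Vec p) :
    ∫ ω, inner ℝ v (X ω) * inner ℝ w (X ω) ∂P
      = ∑ k, ∑ l, v k * w l * ∫ ω, X ω k * X ω l ∂P := by
  have hi : ∀ k l, Integrable (fun ω => v k * w l * (X ω k * X ω l)) P := fun k l =>
    ((h2.eval_piLp k).integrable_mul (h2.eval_piLp l)).const_mul _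
  have e : ∀ ω, inner ℝ v (X ω) * inner ℝ w (X ω)
      = ∑ k, ∑ l, v k * w l * (X ω k * X ω l) := fun ω => by
    rw [inner_eq_sum, inner_eq_sum, Finset.sum_mul_sum]
    exact Finset.sum_congr rfl fun k _ => Finset.sum_congr rfl fun l _ => by ring
  simp_rw [e]
  rw [integral_finsetSum _ fun k _ => integrable_finsetSum _ fun l _ => hi k l]
  refine Finset.sum_congr rfl fun k _ => ?_
  rw [integral_finsetSum _ fun l _ => hi k l]
  simp_rw [integral_const_mul]

/-- Comparison of the normalized sums over the half-spaces with normals in a finite set, together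
with anti-concentration of the Gaussian one. -/
theorem GaussianAnalogue.rectCdf_bounds {X : Fin n → Ω → Vec p} {Y : Fin n → Ω' → Vec p}
    (hXY : GaussianAnalogue P X P' Y) {W : Finset (Vec p)} (hW : W.Nonempty)
    {K c : ℝ} (g : SmoothCutoff K c) (hK : 1 ≤ K) (hc : 1 ≤ c) (hn : 0 < n)
    (hnc : (n : ℝ) ≤ Real.exp c) (hcard : (W.card : ℝ) ≤ Real.exp c)
    (h3 : ∀ i, ∀ v ∈ W, MemLp (fun ω => inner ℝ v (X i ω)) 3 P)
    {b B β Δ : ℝ} (hb : 0 < b) (hB : 1 ≤ B)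
    (hM1 : ∀ v ∈ W, b ≤ (n : ℝ)⁻¹ * ∑ i, ∫ ω, inner ℝ v (X i ω) ^ 2 ∂P)
    (hM2 : ∀ v ∈ W, (n : ℝ)⁻¹ * ∑ i, ∫ ω, |inner ℝ v (X i ω)| ^ 3 ∂P ≤ B)
    (hvar : ∀ i, ∀ v ∈ W, ∫ ω, inner ℝ v (X i ω) ^ 2 ∂P ≤ 4 * B ^ 2)
    (hβ : 0 < β) (hβ1 : 12 * c * (β * B) ≤ Real.sqrt n)
    (hβ2 : 6000 * K * (1 + gaussianThirdMoment) * (β ^ 3 * B) ≤ c * Real.sqrt n)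
    (hΔ : ∑ i, ∫ ω, tailSq ((β * (Real.sqrt n)⁻¹) • projSet W (X i ω)) ∂P ≤ Δ) (t : W → ℝ) :
    |rectCdf P X W t - rectCdf P' Y W t|
        ≤ 8 * (14 * Real.sqrt (2 * c) / Real.sqrt b / β) * c + 8 * K * (Δ + (n : ℝ)⁻¹) ∧
      ∀ h : ℝ, 0 ≤ h → rectCdf P' Y W (fun v => t v + h) - rectCdf P' Y W t
        ≤ 14 * Real.sqrt (2 * c) / Real.sqrt b * h := by
  obtain ⟨Q, hQ, hQi, dX, dY⟩ := exists_independent_pairs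
    (fun i => (hXY.memLp_X i).aestronglyMeasurable.aemeasurable) hXY.indep_X
    (fun i => (hXY.gaussian_Y i).aemeasurable) hXY.indep_Y
  have dXi : ∀ i, IdentDistrib (fun ω : Fin n → Vec p × Vec p => (ω i).1) (X i) Q P := fun i =>
    dX.comp (measurable_pi_apply i)
  have dYi : ∀ i, IdentDistrib (fun ω : Fin n → Vec p × Vec p => (ω i).2) (Y i) Q P' := fun i =>
    dY.comp (measurable_pi_apply i)
  have hX2 : ∀ i, MemLp (X i) 2 P := hXY.memLp_X
  have hY2 : ∀ i, MemLp (Y i) 2 P' := fun i => (hXY.gaussian_Y i).memLp_two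
  have hWne : Nonempty W := hW.to_subtype
  -- An arbitrary order, needed only to break ties in the proof of Nazarov's inequality.
  let : LinearOrder W := LinearOrder.lift' (Fintype.equivFin W) (Fintype.equivFin W).injective
  let sel : Bool → Vec p × Vec p → Vec p := fun b q => if b then q.1 else q.2
  have hsel : ∀ b, Measurable (sel b) := fun b => by
    cases b
    exacts [measurable_snd, measurable_fst]
  let z : Fin n → (Fin n → Vec p × Vec p) → Bool → W → ℝ := fun i ω b => projSet W (sel b (ω i))
  have hpm : Measurable (projSet W) := (projSet W).continuous.measurable
  have hφ : Measurable fun (q : Vec p × Vec p) (b : Bool) => projSet W (sel b q) :=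
    measurable_pi_lambda _ fun b => hpm.comp (hsel b)
  have hz : ∀ i, Measurable (z i) := fun i => hφ.comp (measurable_pi_apply i)
  have hind : iIndepFun z Q := hQi.comp (fun _ q b => projSet W (sel b q)) fun _ => hφ
  have ix : ∀ i (f : Vec p → ℝ), Measurable f → ∫ ω, f (ω i).1 ∂Q = ∫ ω, f (X i ω) ∂P :=
    fun i f hf => ((dXi i).comp hf).integral_eq
  have iy : ∀ i (f : Vec p → ℝ), Measurable f → ∫ ω, f (ω i).2 ∂Q = ∫ ω, f (Y i ω) ∂P' :=
    fun i f hf => ((dYi i).comp hf).integral_eq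
  have hin : ∀ v : Vec p, Measurable fun x : Vec p => inner ℝ v x := fun v =>
    (innerSL ℝ v).continuous.measurable
  have cX : ∀ t, sumCdf Q z true t = rectCdf P X W t := fun t => by
    rw [← rectCdf_eq_of_identDistrib (X₀ := fun i (ω : Fin n → Vec p × Vec p) => (ω i).1) dX]
    unfold sumCdf rectCdf normalizedSum
    congr 1
    ext ω
    refine forall_congr' fun v => ?_
    simp only [z, sel, projSet_apply, if_true]
    rw [real_inner_smul_left, sum_inner]
    simp_rw [real_inner_comm]
  have cY : ∀ t, sumCdf Q z false t = rectCdf P' Y W t := fun t => by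
    rw [← rectCdf_eq_of_identDistrib (X₀ := fun i (ω : Fin n → Vec p × Vec p) => (ω i).2) dY]
    unfold sumCdf rectCdf normalizedSum
    congr 1
    ext ω
    refine forall_congr' fun v => ?_
    simp only [z, sel, projSet_apply, Bool.false_eq_true, if_false]
    rw [real_inner_smul_left, sum_inner]
    simp_rw [real_inner_comm]
  have hg : ∀ i, HasGaussianLaw (fun ω => z i ω false) Q := fun i => by
    have h1 := (hXY.gaussian_Y i).map_fun (projSet W)
    have h2 : Q.map (fun ω => z i ω false) = P'.map fun ω => projSet W (Y i ω) :=
      ((dYi i).comp hpm).map_eq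
    exact ⟨by rw [h2]; exact h1.isGaussian_map⟩
  have hcov : ∀ i (v w : Vec p), ∫ ω, inner ℝ v (X i ω) * inner ℝ w (X i ω) ∂P
      = ∫ ω, inner ℝ v (Y i ω) * inner ℝ w (Y i ω) ∂P' := fun i v w => by
    rw [integral_inner_mul_inner (hX2 i), integral_inner_mul_inner (hY2 i)]
    simp_rw [hXY.cov_eq]
  have hcard' : (Fintype.card W : ℝ) ≤ Real.exp c := by simpa using hcard
  have e2 : ∀ i (v : W), ∫ ω, z i ω true v ^ 2 ∂Q = ∫ ω, inner ℝ (v : Vec p) (X i ω) ^ 2 ∂P :=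
    fun i v => ix i (fun x => inner ℝ (v : Vec p) x ^ 2) ((hin v).pow_const 2)
  have e3 : ∀ i (v : W), ∫ ω, |z i ω true v| ^ 3 ∂Q
      = ∫ ω, |inner ℝ (v : Vec p) (X i ω)| ^ 3 ∂P :=
    fun i v => ix i (fun x => |inner ℝ (v : Vec p) x| ^ 3) ((hin v).abs.pow_const 3)
  have h0 : ∀ i b v, ∫ ω, z i ω b v ∂Q = 0 := by
    intro i b v
    cases b
    · exact (iy i (fun x => inner ℝ (v : Vec p) x) (hin v)).trans
        (integral_inner_eq_zero (hY2 i) (hXY.centered_Y i) v)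
    · exact (ix i (fun x => inner ℝ (v : Vec p) x) (hin v)).trans
        (integral_inner_eq_zero (hX2 i) (hXY.centered_X i) v)
  have hv : ∀ i (v w : W), ∫ ω, z i ω true v * z i ω true w ∂Q
      = ∫ ω, z i ω false v * z i ω false w ∂Q := fun i v w =>
    (ix i (fun x => inner ℝ (v : Vec p) x * inner ℝ (w : Vec p) x) ((hin v).mul (hin w))).trans
      ((hcov i v w).trans
        (iy i (fun x => inner ℝ (v : Vec p) x * inner ℝ (w : Vec p) x)
          ((hin v).mul (hin w))).symm)
  have hM1' : ∀ v : W, b ≤ (n : ℝ)⁻¹ * ∑ i, ∫ ω, z i ω true v ^ 2 ∂Q := fun v => by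
    simp_rw [e2]; exact hM1 v v.2
  constructor
  · rw [← cX, ← cY]
    refine abs_sumCdf_sub_le g hK hc hn hnc hcard' hz hind (fun i v => ?_) hg h0 hv hb hB hM1'
      (fun v => ?_) (fun i v => ?_) hβ hβ1 hβ2 ?_ t
    · exact ((dXi i).comp (hin v)).memLp_iff.2 (h3 i v v.2)
    · simp_rw [e3]; exact hM2 v v.2
    · rw [e2]; exact hvar i v v.2
    · refine le_trans (le_of_eq ?_) hΔ
      refine Finset.sum_congr rfl fun i _ => ?_
      exact ix i (fun x => tailSq ((β * (Real.sqrt n)⁻¹) • projSet W x))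
        (measurable_tailSq.comp ((measurable_const_smul _).comp hpm))
  · intro h hh
    rw [← cY, ← cY]
    refine sumCdf_add_sub_le hz hind hg (fun i v => h0 i false v) hb (fun v => ?_) hc hcard' t hh
    have e : ∀ i, ∫ ω, z i ω false v ^ 2 ∂Q = ∫ ω, z i ω true v ^ 2 ∂Q := fun i => by
      simp_rw [sq]; exact (hv i v v).symm
    simp_rw [e]
    exact hM1' v

end Transfer

/-! ### Simple convex sets -/

section Simple

variable {p n : ℕ}

/-- Directions with infinite support function impose no constraint, and for nonempty `Am` the value
`⊥` does not occur. What remains is a rectangle with finite real thresholds in the inner products.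
-/
theorem mem_enlargement_iff {V : Finset (Vec p)} {Am : Set (Vec p)} (hAm : Am.Nonempty)
    {W : Finset (Vec p)} (hW : ∀ v, v ∈ W ↔ v ∈ V ∧ supportFun Am v ≠ ⊤) (ε : ℝ) (w : Vec p) :
    w ∈ enlargement V Am ε
      ↔ ∀ v : W, inner ℝ w (v : Vec p) ≤ (supportFun Am v).toReal + ε := by
  have hbot : ∀ v, supportFun Am v ≠ ⊥ := by
    intro v h
    obtain ⟨x, hx⟩ := hAm
    have h1 : ((inner ℝ x v : ℝ) : EReal) ≤ supportFun Am v :=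
      le_iSup₂ (f := fun w (_ : w ∈ Am) => ((inner ℝ w v : ℝ) : EReal)) x hx
    rw [h, le_bot_iff] at h1
    exact EReal.coe_ne_bot _ h1
  have key : ∀ v, supportFun Am v ≠ ⊤ → (((inner ℝ w v : ℝ) : EReal) ≤ supportFun Am v + (ε : EReal)
      ↔ inner ℝ w v ≤ (supportFun Am v).toReal + ε) := by
    intro v hv
    conv_lhs => rw [← EReal.coe_toReal hv (hbot v)]
    norm_cast
  constructor
  · intro h v
    obtain ⟨h1, h2⟩ := (hW v).1 v.2
    exact (key v h2).1 (h v h1)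
  · intro h v hv
    by_cases h2 : supportFun Am v = ⊤
    · rw [h2, EReal.top_add_coe]
      exact le_top
    · exact (key v h2).2 (h ⟨v, (hW v).2 ⟨hv, h2⟩⟩)

theorem GeneratedBy.eq_enlargement_zero {V : Finset (Vec p)} {Am : Set (Vec p)}
    (h : GeneratedBy V Am) : Am = enlargement V Am 0 := by
  conv_lhs => rw [h.2]
  simp [enlargement]

/-- All support values are `⊥`, and `⊥ + ε = ⊥`, so enlarging does not relax the constraints. -/
theorem enlargement_empty_subset {V : Finset (Vec p)} (h : GeneratedBy V (∅ : Set (Vec p)))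
    (ε : ℝ) : enlargement V (∅ : Set (Vec p)) ε = ∅ := by
  have hb : ∀ v : Vec p, supportFun (∅ : Set (Vec p)) v = ⊥ := fun v => by simp [supportFun]
  have h1 := h.eq_enlargement_zero
  have h2 : ∀ ε : ℝ, enlargement V (∅ : Set (Vec p)) ε
      = {w | ∀ v ∈ V, ((inner ℝ w v : ℝ) : EReal) ≤ ⊥} := fun ε => by
    simp [enlargement, hb]
  rw [h2, ← h2 0, ← h1]

variable {Ω Ω' : Type*} [MeasurableSpace Ω] [MeasurableSpace Ω'] {P : Measure Ω}
  [IsProbabilityMeasure P] {P' : Measure Ω'} [IsProbabilityMeasure P']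

/-- From rectangles to simple convex sets. -/
theorem IsSimpleApprox.abs_prob_sub_le {a d : ℝ} (ha : 0 ≤ a) {A : Set (Vec p)}
    {V : Finset (Vec p)} {Am : Set (Vec p)} (hA : IsSimpleApprox n a d A V Am)
    (X : Fin n → Ω → Vec p) (Y : Fin n → Ω' → Vec p) {ε N : ℝ} (hε : 0 ≤ ε) (hN : 0 ≤ N)
    (h : ∀ W ⊆ V, W.Nonempty → ∀ t : W → ℝ, |rectCdf P X W t - rectCdf P' Y W t| ≤ ε ∧
      ∀ h : ℝ, 0 ≤ h → rectCdf P' Y W (fun v => t v + h) - rectCdf P' Y W t ≤ N * h) :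
    |P.real {ω | normalizedSum X ω ∈ A} - P'.real {ω | normalizedSum Y ω ∈ A}|
      ≤ ε + N * (a / n) := by
  classical
  have han : 0 ≤ a / n := by positivity
  have hr : 0 ≤ ε + N * (a / n) := by positivity
  rcases Am.eq_empty_or_nonempty with hAm | hAm
  · have : A = ∅ := by
      have h1 := hA.subset_enlargement
      have h2 := hA.generated
      rw [hAm] at h1 h2
      rw [enlargement_empty_subset h2] at h1
      exact Set.subset_empty_iff.1 h1
    simpa [this] using hr
  set W : Finset (Vec p) := V.filter fun v => supportFun Am v ≠ ⊤ with hWdef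
  have hW : ∀ v, v ∈ W ↔ v ∈ V ∧ supportFun Am v ≠ ⊤ := fun v => Finset.mem_filter
  have hmem := mem_enlargement_iff hAm hW
  have hsub : enlargement V Am 0 ⊆ A := by
    rw [← hA.generated.eq_enlargement_zero]; exact hA.subset
  -- With no finite constraint the set is the whole space, and both probabilities are `1`.
  rcases W.eq_empty_or_nonempty with hWe | hWne
  · have : A = Set.univ := by
      refine Set.eq_univ_of_forall fun w => hsub ((hmem 0 w).2 fun v => ?_)
      exact absurd v.2 (Finset.eq_empty_iff_forall_notMem.1 hWe v)
    simpa [this] using hr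
  set t : W → ℝ := fun v => (supportFun Am v).toReal with ht
  have hWV : W ⊆ V := Finset.filter_subset _ _
  obtain ⟨b0, c0⟩ := h W hWV hWne t
  -- `A` lies between the rectangles with thresholds `t` and `t + a / n`. The comparison is used at
  -- both, and anti-concentration bounds the Gaussian mass between them.
  obtain ⟨b1, -⟩ := h W hWV hWne fun v => t v + a / n
  have c1 := c0 (a / n) han
  have lo : rectCdf P X W t ≤ P.real {ω | normalizedSum X ω ∈ A} :=
    measureReal_mono fun ω hω => hsub ((hmem 0 _).2 fun v => by simpa using hω v)
  have lo' : rectCdf P' Y W t ≤ P'.real {ω | normalizedSum Y ω ∈ A} :=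
    measureReal_mono fun ω hω => hsub ((hmem 0 _).2 fun v => by simpa using hω v)
  have hi : P.real {ω | normalizedSum X ω ∈ A} ≤ rectCdf P X W fun v => t v + a / n :=
    measureReal_mono fun ω hω => (hmem (a / n) _).1 (hA.subset_enlargement hω)
  have hi' : P'.real {ω | normalizedSum Y ω ∈ A} ≤ rectCdf P' Y W fun v => t v + a / n :=
    measureReal_mono fun ω hω => (hmem (a / n) _).1 (hA.subset_enlargement hω)
  rw [abs_le] at b0 b1 ⊢
  constructor <;> linarith [b0.1, b0.2, b1.1, b1.2]

end Simple

/-! ### Moment conditions in terms of Bochner integrals -/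

section Expect

variable {Ω : Type*} [MeasurableSpace Ω] {P : Measure Ω} [IsProbabilityMeasure P] {n : ℕ}

theorem integrable_of_expect_ne_top {f : Ω → ℝ} (hf : AEStronglyMeasurable f P) (h0 : ∀ ω, 0 ≤ f ω)
    (h : expect P f ≠ ⊤) : Integrable f P :=
  (lintegral_ofReal_ne_top_iff_integrable hf (ae_of_all _ h0)).1 h

theorem expect_eq_ofReal {f : Ω → ℝ} (hf : Integrable f P) (h0 : ∀ ω, 0 ≤ f ω) :
    expect P f = ENNReal.ofReal (∫ ω, f ω ∂P) :=
  (ofReal_integral_eq_lintegral_ofReal hf (ae_of_all _ h0)).symm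

theorem average_expect_eq_ofReal (hn : 0 < n) {f : Fin n → Ω → ℝ} (hf : ∀ i, Integrable (f i) P)
    (h0 : ∀ i ω, 0 ≤ f i ω) : (n : ℝ≥0∞)⁻¹ * ∑ i, expect P (f i)
      = ENNReal.ofReal ((n : ℝ)⁻¹ * ∑ i, ∫ ω, f i ω ∂P) := by
  have hn0 : (0 : ℝ) < n := Nat.cast_pos.2 hn
  simp_rw [fun i => expect_eq_ofReal (hf i) (h0 i)]
  rw [← ENNReal.ofReal_sum_of_nonneg fun i _ => integral_nonneg (h0 i),
    ENNReal.ofReal_mul (inv_nonneg.2 hn0.le), ENNReal.ofReal_inv_of_pos hn0, ENNReal.ofReal_natCast]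

theorem average_integral_le_of_expect (hn : 0 < n) {f : Fin n → Ω → ℝ} {M : ℝ} (hM : 0 ≤ M)
    (hf : ∀ i, AEStronglyMeasurable (f i) P) (h0 : ∀ i ω, 0 ≤ f i ω)
    (h : (n : ℝ≥0∞)⁻¹ * ∑ i, expect P (f i) ≤ ENNReal.ofReal M) :
    (∀ i, Integrable (f i) P) ∧ (n : ℝ)⁻¹ * ∑ i, ∫ ω, f i ω ∂P ≤ M := by
  have hi : ∀ i, Integrable (f i) P := fun i => by
    refine integrable_of_expect_ne_top (hf i) (h0 i) fun htop => ?_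
    have hs : ∑ i, expect P (f i) = ⊤ := by
      refine top_unique ?_
      rw [← htop]
      exact Finset.single_le_sum (f := fun i => expect P (f i)) (fun _ _ => zero_le)
        (Finset.mem_univ i)
    rw [hs, ENNReal.mul_top (by simp)] at h
    exact ENNReal.ofReal_ne_top (top_unique h)
  refine ⟨hi, ?_⟩
  rw [average_expect_eq_ofReal hn hi h0] at h
  exact (ENNReal.ofReal_le_ofReal_iff hM).1 h

variable {p : ℕ} {X : Fin n → Ω → Vec p} {V : Finset (Vec p)} {B : ℝ}

theorem aemeasurable_inner (hX : ∀ i, AEMeasurable (X i) P) (i : Fin n) (v : Vec p) :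
    AEMeasurable (fun ω => inner ℝ v (X i ω)) P :=
  (innerSL ℝ v).continuous.measurable.comp_aemeasurable (hX i)

theorem CondM2.third_moment (hn : 0 < n) (hB : 0 ≤ B) (hX : ∀ i, AEMeasurable (X i) P)
    (h : CondM2 P X B V) {v : Vec p} (hv : v ∈ V) :
    (∀ i, MemLp (fun ω => inner ℝ v (X i ω)) 3 P) ∧
      (n : ℝ)⁻¹ * ∑ i, ∫ ω, |inner ℝ v (X i ω)| ^ 3 ∂P ≤ B := by
  have h1 : (n : ℝ≥0∞)⁻¹ * ∑ i, expect P (fun ω => |inner ℝ v (X i ω)| ^ 3)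
      ≤ ENNReal.ofReal B := by
    have := h v hv 1 (by simp)
    simpa only [pow_one, Nat.reduceAdd] using this
  have hmeas : ∀ i, AEStronglyMeasurable (fun ω => |inner ℝ v (X i ω)| ^ 3) P := fun i =>
    ((aemeasurable_inner hX i v).abs.pow_const 3).aestronglyMeasurable
  obtain ⟨hi, hle⟩ := average_integral_le_of_expect hn hB hmeas
    (fun i ω => pow_nonneg (abs_nonneg _) 3) h1
  refine ⟨fun i => ?_, hle⟩
  rw [← integrable_norm_rpow_iff (aemeasurable_inner hX i v).aestronglyMeasurable (by norm_num)
    (by norm_num)]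
  refine (hi i).congr (ae_of_all _ fun ω => ?_)
  beta_reduce
  rw [Real.norm_eq_abs, ENNReal.toReal_ofNat, ← Real.rpow_natCast, Nat.cast_ofNat]

theorem CondM1.second_moment (hn : 0 < n) {b : ℝ} (hb : 0 < b)
    (h2 : ∀ i, ∀ v ∈ V, MemLp (fun ω => inner ℝ v (X i ω)) 2 P) (h : CondM1 P X b V) {v : Vec p}
    (hv : v ∈ V) : b ≤ (n : ℝ)⁻¹ * ∑ i, ∫ ω, inner ℝ v (X i ω) ^ 2 ∂P := by
  have h1 := h v hv
  rw [average_expect_eq_ofReal hn (fun i => (h2 i v hv).integrable_sq) fun i ω => sq_nonneg _] at h1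
  by_contra hlt
  exact absurd h1 (not_le.2 ((ENNReal.ofReal_lt_ofReal_iff hb).2 (not_le.1 hlt)))

theorem CondE1.integral_exp_le (hX : ∀ i, AEMeasurable (X i) P) (h : CondE1 P X B V) (i : Fin n)
    {v : Vec p} (hv : v ∈ V) : Integrable (fun ω => Real.exp (|inner ℝ v (X i ω)| / B)) P ∧
      ∫ ω, Real.exp (|inner ℝ v (X i ω)| / B) ∂P ≤ 2 := by
  have h1 := h i v hv
  have hi : Integrable (fun ω => Real.exp (|inner ℝ v (X i ω)| / B)) P :=
    integrable_of_expect_ne_top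
      (((aemeasurable_inner hX i v).abs.div_const B).exp).aestronglyMeasurable
      (fun ω => (Real.exp_pos _).le) fun htop => by
        rw [htop, top_le_iff] at h1
        exact ENNReal.ofNat_ne_top h1
  refine ⟨hi, ?_⟩
  rw [expect_eq_ofReal hi fun ω => (Real.exp_pos _).le] at h1
  have := ENNReal.toReal_mono ENNReal.ofNat_ne_top h1
  rwa [ENNReal.toReal_ofReal (integral_nonneg fun ω => (Real.exp_pos _).le),
    ENNReal.toReal_ofNat] at this

theorem CondE1.integral_sq_le (hB : 0 < B) (hX : ∀ i, AEMeasurable (X i) P) (h : CondE1 P X B V)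
    (i : Fin n) {v : Vec p} (hv : v ∈ V) : ∫ ω, inner ℝ v (X i ω) ^ 2 ∂P ≤ 4 * B ^ 2 := by
  obtain ⟨hi, hle⟩ := h.integral_exp_le hX i hv
  have := integral_mono_of_nonneg (ae_of_all _ fun ω => sq_nonneg (inner ℝ v (X i ω)))
    (hi.const_mul (2 * B ^ 2)) (ae_of_all _ fun ω => by
      have h1 := sq_le_two_mul_exp (t := |inner ℝ v (X i ω)| / B) (by positivity)
      rw [div_pow, sq_abs, div_le_iff₀ (by positivity)] at h1
      simp only
      linarith)
  rw [integral_const_mul] at this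
  nlinarith [sq_nonneg B]

/-- The maximum in condition (E.2'). -/
def maxProj (V : Finset (Vec p)) (B : ℝ) (x : Vec p) : ℝ := ⨆ v : V, |inner ℝ (v : Vec p) x| / B

theorem le_maxProj (B : ℝ) (x : Vec p) {v : Vec p} (hv : v ∈ V) :
    |inner ℝ v x| / B ≤ maxProj V B x :=
  le_ciSup (f := fun v : V => |inner ℝ (v : Vec p) x| / B) (Set.finite_range _).bddAbove ⟨v, hv⟩

theorem maxProj_nonneg (hB : 0 ≤ B) (x : Vec p) : 0 ≤ maxProj V B x :=
  Real.iSup_nonneg fun _ => by positivity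

/-- The majorant `m` is only controlled through its lower integral, so no measurability of `m` is
required. -/
theorem integral_le_of_le_of_expect_le {f m : Ω → ℝ} {k M : ℝ} (hf : AEStronglyMeasurable f P)
    (h0 : ∀ ω, 0 ≤ f ω) (hk : 0 ≤ k) (hM : 0 ≤ M) (hfm : ∀ ω, f ω ≤ k * m ω)
    (hm : expect P m ≤ ENNReal.ofReal M) : ∫ ω, f ω ∂P ≤ k * M := by
  rw [integral_eq_lintegral_of_nonneg_ae (ae_of_all _ h0) hf]
  refine ENNReal.toReal_le_of_le_ofReal (by positivity) ?_
  calc ∫⁻ ω, ENNReal.ofReal (f ω) ∂P ≤ ∫⁻ ω, ENNReal.ofReal k * ENNReal.ofReal (m ω) ∂P :=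
        lintegral_mono fun ω => by
          rw [← ENNReal.ofReal_mul hk]
          exact ENNReal.ofReal_le_ofReal (hfm ω)
    _ = ENNReal.ofReal k * expect P m := lintegral_const_mul' _ _ ENNReal.ofReal_ne_top
    _ ≤ _ := by
        rw [ENNReal.ofReal_mul hk]
        gcongr

/-- With `s = |v'X_i| / B`, one has `s^2 ≤ 1 + max^q` for `q ≥ 2`, whose expectation is at most `3`.
-/
theorem CondE2.integral_sq_le {q : ℝ} (hq : 2 ≤ q) (hB : 0 < B)
    (hX : ∀ i, AEMeasurable (X i) P) (h : CondE2 P X B q V) (i : Fin n) {v : Vec p} (hv : v ∈ V) :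
    ∫ ω, inner ℝ v (X i ω) ^ 2 ∂P ≤ 4 * B ^ 2 := by
  have hm : expect P (fun ω => 1 + maxProj V B (X i ω) ^ q) ≤ ENNReal.ofReal 3 := by
    unfold expect
    calc ∫⁻ ω, ENNReal.ofReal (1 + maxProj V B (X i ω) ^ q) ∂P
        = ∫⁻ ω, (1 + ENNReal.ofReal (maxProj V B (X i ω) ^ q)) ∂P := by
          refine lintegral_congr fun ω => ?_
          rw [ENNReal.ofReal_add zero_le_one (Real.rpow_nonneg (maxProj_nonneg hB.le _) _),
            ENNReal.ofReal_one]
      _ = 1 + expect P (fun ω => maxProj V B (X i ω) ^ q) := by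
          rw [lintegral_add_left measurable_const]
          simp [expect]
      _ ≤ 1 + 2 := by gcongr; exact h i
      _ = _ := by rw [← ENNReal.ofReal_one, ← ENNReal.ofReal_ofNat 2,
                    ← ENNReal.ofReal_add zero_le_one (by norm_num)]; norm_num
  have := integral_le_of_le_of_expect_le (k := B ^ 2) (M := 3)
    ((aemeasurable_inner hX i v).pow_const 2).aestronglyMeasurable (fun ω => sq_nonneg _)
    (by positivity) (by norm_num) (fun ω => by
      set s := |inner ℝ v (X i ω)| / B with hs
      have s0 : 0 ≤ s := by positivity
      have e : inner ℝ v (X i ω) ^ 2 = B ^ 2 * s ^ 2 := by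
        rw [hs, div_pow, sq_abs]; field_simp
      rw [e]
      refine mul_le_mul_of_nonneg_left ?_ (by positivity)
      have hsm : s ^ q ≤ maxProj V B (X i ω) ^ q :=
        Real.rpow_le_rpow s0 (le_maxProj B _ hv) (by linarith)
      by_cases h1 : s ≤ 1
      · have := Real.rpow_nonneg (maxProj_nonneg (V := V) hB.le (X i ω)) q
        nlinarith
      · have h2 : s ^ (2 : ℝ) ≤ s ^ q := Real.rpow_le_rpow_of_exponent_le (not_le.1 h1).le hq
        rw [Real.rpow_two] at h2
        linarith) hm
  nlinarith [sq_nonneg B]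

/-- Where the norm exceeds `1`, its square is at most its `q`-th power, and the norm itself is at
most `γB` times the maximum in (E.2'). -/
theorem CondE2.integral_tailSq_le {q : ℝ} (hq : 2 ≤ q) (hB : 0 < B)
    (hX : ∀ i, AEMeasurable (X i) P) (h : CondE2 P X B q V) (i : Fin n) {W : Finset (Vec p)}
    (hW : W ⊆ V) {γ : ℝ} (hγ : 0 < γ) :
    ∫ ω, tailSq (γ • projSet W (X i ω)) ∂P ≤ 2 * (γ * B) ^ q := by
  have hm : expect P (fun ω => maxProj V B (X i ω) ^ q) ≤ ENNReal.ofReal 2 := by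
    rw [ENNReal.ofReal_ofNat]; exact h i
  have hmeas : AEStronglyMeasurable (fun ω => tailSq (γ • projSet W (X i ω))) P :=
    ((measurable_tailSq.comp ((measurable_const_smul γ).comp
      (projSet W).continuous.measurable)).comp_aemeasurable (hX i)).aestronglyMeasurable
  rw [mul_comm]
  refine integral_le_of_le_of_expect_le hmeas (fun ω => tailSq_nonneg _)
    (by positivity) zero_le_two (fun ω => ?_) hm
  have m0 := maxProj_nonneg (V := V) hB.le (X i ω)
  unfold tailSq
  split_ifs with h1
  · have hn : ‖γ • projSet W (X i ω)‖ ≤ γ * B * maxProj V B (X i ω) := by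
      refine (pi_norm_le_iff_of_nonneg (by positivity)).2 fun v => ?_
      rw [Pi.smul_apply, smul_eq_mul, Real.norm_eq_abs, abs_mul, abs_of_pos hγ, mul_assoc,
        projSet_apply]
      refine mul_le_mul_of_nonneg_left ?_ hγ.le
      have := le_maxProj B (X i ω) (hW v.2)
      rwa [div_le_iff₀' hB] at this
    rw [← Real.mul_rpow (by positivity) m0, ← Real.rpow_two]
    exact (Real.rpow_le_rpow_of_exponent_le h1.le hq).trans
      (Real.rpow_le_rpow (norm_nonneg _) hn (by linarith))
  · positivity

end Expect

/-! ### Rates -/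

section Rates

variable {n p : ℕ}

theorem one_le_log_mul (hn : 4 ≤ n) (hp : 3 ≤ p) : 1 ≤ Real.log ((p : ℝ) * n) := by
  have hn' : (4 : ℝ) ≤ n := by exact_mod_cast hn
  have hp' : (3 : ℝ) ≤ p := by exact_mod_cast hp
  rw [Real.le_log_iff_exp_le (by positivity)]
  nlinarith [Real.exp_one_lt_d9]

theorem exp_log_mul (hn : 4 ≤ n) (hp : 3 ≤ p) :
    Real.exp (Real.log ((p : ℝ) * n)) = p * n := by
  have hn' : (4 : ℝ) ≤ n := by exact_mod_cast hn
  have hp' : (3 : ℝ) ≤ p := by exact_mod_cast hp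
  exact Real.exp_log (by positivity)

theorem natCast_le_exp_log_mul (hn : 4 ≤ n) (hp : 3 ≤ p) {d : ℝ} (hd : 0 ≤ d) :
    (n : ℝ) ≤ Real.exp ((d + 1) * Real.log ((p : ℝ) * n)) := by
  have hL := one_le_log_mul hn hp
  have hp' : (3 : ℝ) ≤ p := by exact_mod_cast hp
  calc (n : ℝ) ≤ p * n := by nlinarith [Nat.cast_nonneg (α := ℝ) n]
    _ = Real.exp (Real.log ((p : ℝ) * n)) := (exp_log_mul hn hp).symm
    _ ≤ _ := Real.exp_le_exp.2 (by nlinarith)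

theorem rpow_le_exp_log_mul (hn : 4 ≤ n) (hp : 3 ≤ p) (d : ℝ) :
    ((p : ℝ) * n) ^ d ≤ Real.exp ((d + 1) * Real.log ((p : ℝ) * n)) := by
  have hL := one_le_log_mul hn hp
  have hn' : (4 : ℝ) ≤ n := by exact_mod_cast hn
  have hp' : (3 : ℝ) ≤ p := by exact_mod_cast hp
  rw [Real.rpow_def_of_pos (by positivity)]
  exact Real.exp_le_exp.2 (by nlinarith)

/-- Compares cubes: `(√L)^3 ≤ B L^{7/2} ≤ D^3 √n ≤ D^3 n^3`. It absorbs both the `1/n` terms and the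
error from enlarging by `a / n`. -/
theorem sqrt_div_le_of_le_mul_sqrt (hn : 0 < n) {L B D : ℝ} (hL : 1 ≤ L) (hB : 1 ≤ B) (hD : 0 < D)
    (h : B * (L ^ 3 * √L) ≤ D ^ 3 * √n) : √L / n ≤ D := by
  have hn1 : (1 : ℝ) ≤ n := by exact_mod_cast hn
  have hs : 1 ≤ √L := Real.one_le_sqrt.2 hL
  have hs2 : √L ^ 2 = L := Real.sq_sqrt (by linarith)
  have hr : 1 ≤ √(n : ℝ) := Real.one_le_sqrt.2 hn1
  have hr2 : √(n : ℝ) ^ 2 = n := Real.sq_sqrt (by linarith)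
  refine (pow_le_pow_iff_left₀ (by positivity) hD.le three_ne_zero).1 ?_
  have h1 : L * √L ≤ L ^ 3 * √L :=
    mul_le_mul_of_nonneg_right (le_self_pow₀ hL three_ne_zero) (by positivity)
  have h2 : L ^ 3 * √L ≤ B * (L ^ 3 * √L) := le_mul_of_one_le_left (by positivity) hB
  have h3 : √(n : ℝ) ≤ (n : ℝ) ^ 3 := by
    calc √(n : ℝ) ≤ √(n : ℝ) ^ 2 := le_self_pow₀ hr two_ne_zero
      _ = n := hr2
      _ ≤ _ := le_self_pow₀ hn1 three_ne_zero
  rw [div_pow, div_le_iff₀ (by positivity)]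
  calc √L ^ 3 = L * √L := by rw [pow_succ, hs2]
    _ ≤ D ^ 3 * √n := h1.trans (h2.trans h)
    _ ≤ _ := mul_le_mul_of_nonneg_left h3 (by positivity)

theorem D1_nonneg (hn : 4 ≤ n) (hp : 3 ≤ p) (B : ℝ) : 0 ≤ D1 n p B :=
  Real.rpow_nonneg (by have := one_le_log_mul hn hp; positivity) _

theorem D1_pos (hn : 4 ≤ n) (hp : 3 ≤ p) {B : ℝ} (hB : 1 ≤ B) : 0 < D1 n p B := by
  have := one_le_log_mul hn hp
  have hn' : (4 : ℝ) ≤ n := by exact_mod_cast hn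
  exact Real.rpow_pos_of_pos (by positivity) _

/-- In fact an equality: the sixth power of `D1` is `B^2 L^7 / n`. This is the form in which the
rate enters the third-moment condition. -/
theorem mul_le_D1_pow_mul_sqrt (hn : 4 ≤ n) (hp : 3 ≤ p) {B : ℝ} (hB : 1 ≤ B) :
    B * (Real.log ((p : ℝ) * n) ^ 3 * √(Real.log ((p : ℝ) * n))) ≤ D1 n p B ^ 3 * √n := by
  have hL := one_le_log_mul hn hp
  have hn' : (4 : ℝ) ≤ n := by exact_mod_cast hn
  have hD := D1_nonneg hn hp B
  have h6 : D1 n p B ^ 6 = B ^ 2 * Real.log ((p : ℝ) * n) ^ 7 / n := by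
    rw [D1, ← Real.rpow_natCast, ← Real.rpow_mul (by positivity)]
    norm_num
  refine (pow_le_pow_iff_left₀ (by positivity) (by positivity) two_ne_zero).1 (le_of_eq ?_)
  rw [mul_pow, mul_pow, mul_pow (D1 n p B ^ 3), Real.sq_sqrt (by positivity),
    Real.sq_sqrt (by positivity), ← pow_mul, ← pow_mul, h6]
  field_simp

theorem D2_nonneg (hn : 4 ≤ n) (hp : 3 ≤ p) (B q : ℝ) : 0 ≤ D2 n p B q :=
  Real.rpow_nonneg (by have := one_le_log_mul hn hp; positivity) _

theorem D2_pow_three (hn : 4 ≤ n) (hp : 3 ≤ p) (B q : ℝ) :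
    D2 n p B q ^ 3 = B ^ 2 * Real.log ((p : ℝ) * n) ^ 3 / (n : ℝ) ^ (1 - 2 / q) := by
  have hL := one_le_log_mul hn hp
  rw [D2, ← Real.rpow_natCast, ← Real.rpow_mul (by positivity)]
  norm_num

/-- For `q ≤ 2` the exponent `1 - 2/q` is not positive, so the claimed bound on probabilities is
void. -/
theorem one_le_D2 (hn : 4 ≤ n) (hp : 3 ≤ p) {B q : ℝ} (hB : 1 ≤ B) (hq0 : 0 < q) (hq : q ≤ 2) :
    1 ≤ D2 n p B q := by
  have hL := one_le_log_mul hn hp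
  have hn' : (4 : ℝ) ≤ n := by exact_mod_cast hn
  refine Real.one_le_rpow ?_ (by norm_num)
  have h1 : (n : ℝ) ^ (1 - 2 / q) ≤ 1 :=
    Real.rpow_le_one_of_one_le_of_nonpos (by linarith) (by
      rw [sub_nonpos, le_div_iff₀ hq0]; linarith)
  rw [le_div_iff₀ (by positivity), one_mul]
  have h2 : 1 ≤ B ^ 2 * Real.log ((p : ℝ) * n) ^ 3 :=
    one_le_mul_of_one_le_of_one_le (one_le_pow₀ hB) (one_le_pow₀ hL)
  linarith

/-- The constant in the rate of convergence. -/
def rateConst (a b d K κ : ℝ) : ℝ :=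
  112 * (d + 1) * √(2 * (d + 1)) / (√b * κ) + 40 * K + 14 * √(2 * (d + 1)) / √b * a + 12 * (d + 1)

theorem one_le_rateConst {a b d K κ : ℝ} (ha : 0 ≤ a) (hd : 0 ≤ d) (hK : 1 ≤ K) (hκ : 0 ≤ κ) :
    1 ≤ rateConst a b d K κ := by
  have h1 : 0 ≤ 112 * (d + 1) * √(2 * (d + 1)) / (√b * κ) := by positivity
  have h2 : 0 ≤ 14 * √(2 * (d + 1)) / √b * a := by positivity
  unfold rateConst
  linarith

variable {Ω Ω' : Type*} [MeasurableSpace Ω] [MeasurableSpace Ω'] {P : Measure Ω}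
  [IsProbabilityMeasure P] {P' : Measure Ω'} [IsProbabilityMeasure P']
  {X : Fin n → Ω → Vec p} {Y : Fin n → Ω' → Vec p}

theorem abs_measureReal_sub_le_one (s : Set Ω) (t : Set Ω') : |P.real s - P'.real t| ≤ 1 := by
  rw [abs_le]
  constructor <;> linarith [measureReal_nonneg (μ := P) (s := s), measureReal_le_one (μ := P) (s := s),
    measureReal_nonneg (μ := P') (s := t), measureReal_le_one (μ := P') (s := t)]

/-- The rate `D` is left abstract so that both moment conditions are handled at once: it must
dominate the third-moment term, and the tail sum must be at most `2 (D + 1/n)` for the resulting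
`β`. -/
theorem GaussianAnalogue.abs_prob_sub_le {a b d K κ B D : ℝ} (ha : 0 ≤ a) (hb : 0 < b) (hd : 0 < d)
    (hK : 1 ≤ K) (hcut : ∀ c : ℝ, 1 ≤ c → Nonempty (SmoothCutoff K c)) (hκ0 : 0 < κ) (hκ1 : κ ≤ 1)
    (hκ : 6000 * K * (1 + gaussianThirdMoment) * κ ^ 3 ≤ 1) (hn : 4 ≤ n) (hp : 3 ≤ p)
    (hXY : GaussianAnalogue P X P' Y) (hB : 1 ≤ B) {A : Set (Vec p)} {V : Finset (Vec p)}
    {Am : Set (Vec p)} (hA : IsSimpleApprox n a d A V Am) (hM1 : CondM1 P X b V)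
    (hM2 : CondM2 P X B V) (hvar : ∀ i, ∀ v ∈ V, ∫ ω, inner ℝ v (X i ω) ^ 2 ∂P ≤ 4 * B ^ 2)
    (hD : 0 < D)
    (hBD : B * (Real.log ((p : ℝ) * n) ^ 3 * √(Real.log ((p : ℝ) * n))) ≤ D ^ 3 * √n)
    (hΔ : ∀ β : ℝ, β * D = κ * (Real.log ((p : ℝ) * n) * √(Real.log ((p : ℝ) * n))) → 0 < β →
      D ≤ 1 → 12 * ((d + 1) * Real.log ((p : ℝ) * n)) * (β * B) ≤ √n →
      ∀ W ⊆ V, W.Nonempty →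
        ∑ i, ∫ ω, tailSq ((β * (√n)⁻¹) • projSet W (X i ω)) ∂P ≤ 2 * (D + (n : ℝ)⁻¹)) :
    |P.real {ω | normalizedSum X ω ∈ A} - P'.real {ω | normalizedSum Y ω ∈ A}|
      ≤ rateConst a b d K κ * D := by
  have hn0 : 0 < n := by omega
  have hn' : (0 : ℝ) < n := Nat.cast_pos.2 hn0
  have hL := one_le_log_mul hn hp
  have hnc := natCast_le_exp_log_mul hn hp hd.le
  have hcard := hA.card_le.trans (rpow_le_exp_log_mul hn hp d)
  have hsn := sqrt_div_le_of_le_mul_sqrt hn0 hL hB hD hBD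
  set L := Real.log ((p : ℝ) * n) with hLdef
  set c := (d + 1) * L with hcdef
  have hLc : L ≤ c := by nlinarith
  have hs : 1 ≤ √L := Real.one_le_sqrt.2 hL
  have hr : 0 < √(n : ℝ) := Real.sqrt_pos.2 hn'
  have hinv : (n : ℝ)⁻¹ ≤ D := le_trans (by
    rw [inv_eq_one_div]; exact div_le_div_of_nonneg_right hs hn'.le) hsn
  have t1 : 0 ≤ 112 * (d + 1) * √(2 * (d + 1)) / (√b * κ) := by positivity
  have t2 : 0 ≤ 14 * √(2 * (d + 1)) / √b * a := by positivity
  -- If `D` is not small, then `12 (d + 1) D ≥ 1`, and the last term of `rateConst` makes the claim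
  -- trivial. Otherwise `D ≤ 1`, and the smallness is exactly what `hβ1` needs.
  rcases lt_or_ge 1 (12 * (d + 1) * D ^ 2) with hbig | hsmall
  · refine (abs_measureReal_sub_le_one _ _).trans ?_
    have h1 : 1 ≤ 12 * (d + 1) * D := by
      by_contra hlt
      rw [not_le] at hlt
      have : D < 1 := by nlinarith
      nlinarith [mul_pos (by positivity : 0 < 12 * (d + 1)) hD]
    unfold rateConst
    nlinarith [mul_nonneg t1 hD.le, mul_nonneg t2 hD.le, mul_nonneg (by linarith : 0 ≤ K) hD.le]
  have hD1 : D ≤ 1 := by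
    by_contra hlt
    rw [not_le] at hlt
    nlinarith
  -- The smoothing error is of order `√c · c / β`; this `β` makes it of order `D`, with `κ` left
  -- over to make the third-moment coefficient small.
  set β := κ * (L * √L) / D with hβdef
  have hβ : 0 < β := by positivity
  have hβD : β * D = κ * (L * √L) := by rw [hβdef]; field_simp
  have hs2 : √L ^ 2 = L := Real.sq_sqrt (by linarith)
  have hβ1 : 12 * c * (β * B) ≤ √n := by
    have e1 : 12 * c * (β * B) * D = 12 * (d + 1) * κ * (B * (L ^ 2 * √L)) := by
      calc _ = 12 * c * B * (β * D) := by ring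
        _ = _ := by rw [hβD, hcdef]; ring
    have e2 : B * (L ^ 2 * √L) ≤ D ^ 3 * √n := by
      refine le_trans ?_ hBD
      gcongr
      norm_num
    have e3 : 12 * (d + 1) * κ * (B * (L ^ 2 * √L)) ≤ 12 * (d + 1) * 1 * (D ^ 3 * √n) := by
      gcongr
    refine le_of_mul_le_mul_right ?_ hD
    calc _ ≤ 12 * (d + 1) * 1 * (D ^ 3 * √n) := e1.trans_le e3
      _ = 12 * (d + 1) * D ^ 2 * (√n * D) := by ring
      _ ≤ _ := mul_le_of_le_one_left (by positivity) hsmall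
  have hβ2 : 6000 * K * (1 + gaussianThirdMoment) * (β ^ 3 * B) ≤ c * √n := by
    have hg := gaussianThirdMoment_nonneg
    -- Here the seventh power of the logarithm appears: `β^3` contributes `L^{9/2}`, and one factor
    -- `L` is returned by `c` on the right-hand side.
    have e1 : β ^ 3 * B * D ^ 3 = κ ^ 3 * L * (B * (L ^ 3 * √L)) := by
      calc _ = (β * D) ^ 3 * B := by ring
        _ = κ ^ 3 * L ^ 3 * (√L ^ 2 * √L) * B := by rw [hβD]; ring
        _ = _ := by rw [hs2]; ring
    have e2 : β ^ 3 * B ≤ κ ^ 3 * L * √n := by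
      refine le_of_mul_le_mul_right ?_ (pow_pos hD 3)
      rw [e1]
      calc _ ≤ κ ^ 3 * L * (D ^ 3 * √n) := by gcongr
        _ = _ := by ring
    calc _ ≤ 6000 * K * (1 + gaussianThirdMoment) * (κ ^ 3 * L * √n) := by gcongr
      _ = 6000 * K * (1 + gaussianThirdMoment) * κ ^ 3 * (L * √n) := by ring
      _ ≤ L * √n := mul_le_of_le_one_left (by positivity) hκ
      _ ≤ _ := by gcongr
  have hX : ∀ i, AEMeasurable (X i) P := fun i => (hXY.memLp_X i).aestronglyMeasurable.aemeasurable
  have h3 : ∀ i, ∀ v ∈ V, MemLp (fun ω => inner ℝ v (X i ω)) 3 P := fun i v hv =>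
    (hM2.third_moment hn0 (by linarith) hX hv).1 i
  have h2 : ∀ i, ∀ v ∈ V, MemLp (fun ω => inner ℝ v (X i ω)) 2 P := fun i v hv =>
    (h3 i v hv).mono_exponent (by norm_num)
  obtain ⟨g⟩ := hcut c (hL.trans hLc)
  set N := 14 * √(2 * c) / √b with hN
  have hN0 : 0 ≤ N := by positivity
  have main := hA.abs_prob_sub_le ha X Y
    (P := P) (P' := P') (ε := 8 * (N / β) * c + 8 * K * (2 * (D + (n : ℝ)⁻¹) + (n : ℝ)⁻¹)) (N := N)
    (by positivity) hN0 fun W hWV hW t =>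
      hXY.rectCdf_bounds hW g hK (hL.trans hLc) hn0 hnc
        (le_trans (Nat.cast_le.2 (Finset.card_le_card hWV)) hcard)
        (fun i v hv => h3 i v (hWV hv)) hb hB
        (fun v hv => hM1.second_moment hn0 hb h2 (hWV hv))
        (fun v hv => (hM2.third_moment hn0 (by linarith) hX (hWV hv)).2)
        (fun i v hv => hvar i v (hWV hv)) hβ hβ1 hβ2 (hΔ β hβD hβ hD1 hβ1 W hWV hW) t
  refine main.trans ?_
  have hNs : N = 14 * √(2 * (d + 1)) / √b * √L := by
    rw [hN, hcdef, ← mul_assoc, Real.sqrt_mul (by positivity)]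
    ring
  have e1 : 8 * (N / β) * c = 112 * (d + 1) * √(2 * (d + 1)) / (√b * κ) * D := by
    rw [hNs, hcdef, hβdef]
    field_simp
    ring
  have e2 : N * (a / n) ≤ 14 * √(2 * (d + 1)) / √b * a * D := by
    calc N * (a / n) = 14 * √(2 * (d + 1)) / √b * a * (√L / n) := by rw [hNs]; ring
      _ ≤ _ := mul_le_mul_of_nonneg_left hsn t2
  have e3 : 8 * K * (2 * (D + (n : ℝ)⁻¹) + (n : ℝ)⁻¹) ≤ 40 * K * D := by
    calc _ ≤ 8 * K * (2 * (D + D) + D) := by gcongr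
      _ = _ := by ring
  have e4 : 0 ≤ 12 * (d + 1) * D := by positivity
  rw [e1]
  unfold rateConst
  linarith

theorem CondE1.sum_integral_tailSq_le {d B D β : ℝ} (hd : 0 ≤ d) (hn : 4 ≤ n) (hp : 3 ≤ p)
    (hX : ∀ i, AEMeasurable (X i) P) (hB : 0 < B) (hD : 0 ≤ D) {V W : Finset (Vec p)}
    (hE : CondE1 P X B V) (hWV : W ⊆ V) (hcard : (V.card : ℝ) ≤ ((p : ℝ) * n) ^ d) (hβ : 0 < β)
    (hβ1 : 12 * ((d + 1) * Real.log ((p : ℝ) * n)) * (β * B) ≤ √n) :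
    ∑ i, ∫ ω, tailSq ((β * (√n)⁻¹) • projSet W (X i ω)) ∂P ≤ 2 * (D + (n : ℝ)⁻¹) := by
  have hn0 : 0 < n := by omega
  have hn' : (0 : ℝ) < n := Nat.cast_pos.2 hn0
  have hr : 0 < √(n : ℝ) := Real.sqrt_pos.2 hn'
  have hL := one_le_log_mul hn hp
  have hnc := natCast_le_exp_log_mul hn hp hd
  have hcard' := hcard.trans (rpow_le_exp_log_mul hn hp d)
  set c := (d + 1) * Real.log ((p : ℝ) * n) with hc
  have hc1 : 1 ≤ c := by nlinarith
  have h6 : 6 * c * (β * (√n)⁻¹ * B) ≤ 1 := by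
    have e : 6 * c * (β * (√n)⁻¹ * B) = 6 * c * (β * B) / √n := by ring
    rw [e, div_le_one hr]
    have : 0 ≤ c * (β * B) := by positivity
    linarith
  have hterm : ∀ i, ∫ ω, tailSq ((β * (√n)⁻¹) • projSet W (X i ω)) ∂P ≤ Real.exp (-(2 * c)) := by
    intro i
    refine integral_tailSq_le_of_exp (by positivity) hB hc1 h6 ?_ (fun v => ?_) (fun v => ?_)
    · rw [Fintype.card_coe]
      exact le_trans (Nat.cast_le.2 (Finset.card_le_card hWV)) hcard'
    · exact (hE.integral_exp_le hX i (hWV v.2)).1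
    · exact (hE.integral_exp_le hX i (hWV v.2)).2.trans (by norm_num)
  calc _ ≤ ∑ _i : Fin n, Real.exp (-(2 * c)) := Finset.sum_le_sum fun i _ => hterm i
    _ = n * Real.exp (-(2 * c)) := by simp
    _ ≤ (n : ℝ)⁻¹ := natCast_mul_exp_neg_le hn0 hnc
    _ ≤ _ := by
      have := inv_pos.2 hn'
      linarith

/-- With `y = βB / √n`, the definition of `D2` gives `y^2 D^2 ≤ D2^3 n^{-2/q}`, hence `y^2 ≤ D
n^{-2/q}`. Raising to the power `q/2` yields `y^q ≤ D / n`, because `D ≤ 1` and `q > 2`, and the `n`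
summands contribute at most `2D`. -/
theorem CondE2.sum_integral_tailSq_le {κ q B D β : ℝ} (hκ0 : 0 < κ) (hκ1 : κ ≤ 1) (hq : 2 < q)
    (hn : 4 ≤ n) (hp : 3 ≤ p) (hX : ∀ i, AEMeasurable (X i) P) (hB : 0 < B) (hD : 0 < D)
    (hD1 : D ≤ 1) (hDD : D2 n p B q ≤ D) {V W : Finset (Vec p)} (hE : CondE2 P X B q V)
    (hWV : W ⊆ V) (hβ : 0 < β)
    (hβD : β * D = κ * (Real.log ((p : ℝ) * n) * √(Real.log ((p : ℝ) * n)))) :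
    ∑ i, ∫ ω, tailSq ((β * (√n)⁻¹) • projSet W (X i ω)) ∂P ≤ 2 * (D + (n : ℝ)⁻¹) := by
  have hn0 : 0 < n := by omega
  have hn' : (0 : ℝ) < n := Nat.cast_pos.2 hn0
  have hr : 0 < √(n : ℝ) := Real.sqrt_pos.2 hn'
  have hL := one_le_log_mul hn hp
  have hq0 : 0 < q := by linarith
  have h3 := D2_pow_three hn hp B q
  set L := Real.log ((p : ℝ) * n) with hLdef
  set y := β * (√n)⁻¹ * B with hy
  have hy0 : 0 < y := by positivity
  have hsq : y ^ 2 ≤ D * (n : ℝ) ^ (-(2 / q)) := by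
    refine le_of_mul_le_mul_right ?_ (pow_pos hD 2)
    have e1 : y ^ 2 * D ^ 2 = κ ^ 2 * (B ^ 2 * L ^ 3 / n) := by
      calc y ^ 2 * D ^ 2 = (β * D) ^ 2 * ((√n)⁻¹) ^ 2 * B ^ 2 := by rw [hy]; ring
        _ = κ ^ 2 * (L ^ 2 * √L ^ 2) * ((√n)⁻¹) ^ 2 * B ^ 2 := by rw [hβD]; ring
        _ = _ := by
          rw [inv_pow, Real.sq_sqrt (by positivity), Real.sq_sqrt (by positivity)]
          ring
    have e2 : B ^ 2 * L ^ 3 / n = D2 n p B q ^ 3 * (n : ℝ) ^ (-(2 / q)) := by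
      rw [h3, div_mul_eq_mul_div, sub_eq_add_neg, Real.rpow_add hn', Real.rpow_one]
      have := (Real.rpow_pos_of_pos hn' (-(2 / q))).ne'
      field_simp
    have hD3 : D2 n p B q ^ 3 ≤ D ^ 3 := pow_le_pow_left₀ (D2_nonneg hn hp B q) hDD 3
    rw [e1, e2]
    have hx : 0 ≤ (n : ℝ) ^ (-(2 / q)) := by positivity
    have hD20 : 0 ≤ D2 n p B q := D2_nonneg hn hp B q
    calc _ ≤ 1 * (D2 n p B q ^ 3 * (n : ℝ) ^ (-(2 / q))) := by
          gcongr
          exact pow_le_one₀ hκ0.le hκ1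
      _ ≤ 1 * (D ^ 3 * (n : ℝ) ^ (-(2 / q))) := by gcongr
      _ = _ := by ring
  have hyq : y ^ q ≤ D * (n : ℝ)⁻¹ := by
    calc y ^ q = (y ^ 2) ^ (q / 2) := by
          rw [← Real.rpow_natCast, ← Real.rpow_mul hy0.le]
          congr 1
          push_cast
          ring
      _ ≤ (D * (n : ℝ) ^ (-(2 / q))) ^ (q / 2) := by gcongr
      _ = D ^ (q / 2) * (n : ℝ)⁻¹ := by
          rw [Real.mul_rpow hD.le (by positivity), ← Real.rpow_mul hn'.le,
            ← Real.rpow_neg_one (n : ℝ)]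
          congr 2
          field_simp
      _ ≤ D * (n : ℝ)⁻¹ := by
          gcongr
          calc D ^ (q / 2) ≤ D ^ (1 : ℝ) :=
                Real.rpow_le_rpow_of_exponent_ge hD hD1 (by linarith)
            _ = D := Real.rpow_one D
  calc _ ≤ ∑ _i : Fin n, 2 * y ^ q := Finset.sum_le_sum fun i _ =>
        hE.integral_tailSq_le hq.le hB hX i hWV (by positivity)
    _ = n * (2 * y ^ q) := by simp
    _ ≤ n * (2 * (D * (n : ℝ)⁻¹)) := by gcongr
    _ = 2 * D := by field_simp
    _ ≤ _ := by
      have := inv_pos.2 hn'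
      linarith

theorem exists_pos_mul_pow_three_le_one {M : ℝ} (hM : 0 ≤ M) :
    ∃ κ : ℝ, 0 < κ ∧ κ ≤ 1 ∧ M * κ ^ 3 ≤ 1 := by
  refine ⟨(1 + M)⁻¹, by positivity, inv_le_one_of_one_le₀ (by linarith), ?_⟩
  have h1 : (1 + M)⁻¹ ≤ 1 := inv_le_one_of_one_le₀ (by linarith)
  have h0 : 0 ≤ (1 + M)⁻¹ := by positivity
  calc M * (1 + M)⁻¹ ^ 3 ≤ M * (1 + M)⁻¹ := by
        gcongr
        exact pow_le_of_le_one h0 h1 three_ne_zero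
    _ ≤ 1 := by
      rw [← div_eq_mul_inv, div_le_one (by positivity)]
      linarith

theorem rho_le {𝒜 : Set (Set (Vec p))} {r : ℝ} (hr : 0 ≤ r)
    (h : ∀ A ∈ 𝒜, |P.real {ω | normalizedSum X ω ∈ A} - P'.real {ω | normalizedSum Y ω ∈ A}| ≤ r) :
    rho P X P' Y 𝒜 ≤ r :=
  Real.iSup_le (fun A => h A A.2) hr

end Rates

end HighDimCLT

end

/-! ### Both rates from the abstract bound -/

theorem mainTheorem3 (a b d : ℝ) (ha : 0 ≤ a) (hb : 0 < b) (hd : 0 < d) :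
    (∃ C : ℝ, 0 < C ∧
      ∀ (n p : ℕ), 4 ≤ n → 3 ≤ p →
      ∀ (Ω Ω' : Type*) [MeasurableSpace Ω] [MeasurableSpace Ω']
        (P : Measure Ω) [IsProbabilityMeasure P] (P' : Measure Ω') [IsProbabilityMeasure P']
        (X : Fin n → Ω → HighDimCLT.Vec p) (Y : Fin n → Ω' → HighDimCLT.Vec p),
      HighDimCLT.GaussianAnalogue P X P' Y →
      ∀ B : ℝ, 1 ≤ B →
      ∀ 𝒜 : Set (Set (HighDimCLT.Vec p)), 𝒜 ⊆ HighDimCLT.simpleConvex n p a d →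
      ∀ (V : Set (HighDimCLT.Vec p) → Finset (HighDimCLT.Vec p))
        (Am : Set (HighDimCLT.Vec p) → Set (HighDimCLT.Vec p)),
      (∀ A ∈ 𝒜, HighDimCLT.IsSimpleApprox n a d A (V A) (Am A)) →
      (∀ A ∈ 𝒜, HighDimCLT.CondM1 P X b (V A)) →
      (∀ A ∈ 𝒜, HighDimCLT.CondM2 P X B (V A)) →
      (∀ A ∈ 𝒜, HighDimCLT.CondE1 P X B (V A)) →
      HighDimCLT.rho P X P' Y 𝒜 ≤ C * HighDimCLT.D1 n p B) ∧
    (∀ q : ℝ, 0 < q → ∃ C : ℝ, 0 < C ∧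
      ∀ (n p : ℕ), 4 ≤ n → 3 ≤ p →
      ∀ (Ω Ω' : Type*) [MeasurableSpace Ω] [MeasurableSpace Ω']
        (P : Measure Ω) [IsProbabilityMeasure P] (P' : Measure Ω') [IsProbabilityMeasure P']
        (X : Fin n → Ω → HighDimCLT.Vec p) (Y : Fin n → Ω' → HighDimCLT.Vec p),
      HighDimCLT.GaussianAnalogue P X P' Y →
      ∀ B : ℝ, 1 ≤ B →
      ∀ 𝒜 : Set (Set (HighDimCLT.Vec p)), 𝒜 ⊆ HighDimCLT.simpleConvex n p a d →
      ∀ (V : Set (HighDimCLT.Vec p) → Finset (HighDimCLT.Vec p))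
        (Am : Set (HighDimCLT.Vec p) → Set (HighDimCLT.Vec p)),
      (∀ A ∈ 𝒜, HighDimCLT.IsSimpleApprox n a d A (V A) (Am A)) →
      (∀ A ∈ 𝒜, HighDimCLT.CondM1 P X b (V A)) →
      (∀ A ∈ 𝒜, HighDimCLT.CondM2 P X B (V A)) →
      (∀ A ∈ 𝒜, HighDimCLT.CondE2 P X B q (V A)) →
      HighDimCLT.rho P X P' Y 𝒜 ≤ C * (HighDimCLT.D1 n p B + HighDimCLT.D2 n p B q)) := by
  obtain ⟨K, hK, hcut⟩ := HighDimCLT.exists_smoothCutoff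
  have hM : 0 ≤ 6000 * K * (1 + HighDimCLT.gaussianThirdMoment) := by
    have := HighDimCLT.gaussianThirdMoment_nonneg
    positivity
  -- `κ` depends only on `K` and on the Gaussian third moment, which are absolute, so the constant
  -- depends on `a`, `b` and `d` alone.
  obtain ⟨κ, hκ0, hκ1, hκ⟩ := HighDimCLT.exists_pos_mul_pow_three_le_one hM
  have hC : 1 ≤ HighDimCLT.rateConst a b d K κ := HighDimCLT.one_le_rateConst ha hd.le hK hκ0.le
  have hC0 : 0 < HighDimCLT.rateConst a b d K κ := by linarith
  constructor
  · refine ⟨_, hC0, fun n p hn hp Ω Ω' _ _ P _ P' _ X Y hXY B hB 𝒜 _ V Am hA hM1 hM2 hE => ?_⟩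
    have hD := HighDimCLT.D1_pos hn hp hB
    have hX : ∀ i, AEMeasurable (X i) P := fun i =>
      (hXY.memLp_X i).aestronglyMeasurable.aemeasurable
    have hB0 : 0 < B := by linarith
    refine HighDimCLT.rho_le (by positivity) fun A hA𝒜 => ?_
    exact hXY.abs_prob_sub_le ha hb hd hK hcut hκ0 hκ1 hκ hn hp hB (hA A hA𝒜) (hM1 A hA𝒜)
      (hM2 A hA𝒜) (fun i v hv => (hE A hA𝒜).integral_sq_le hB0 hX i hv) hD
      (HighDimCLT.mul_le_D1_pow_mul_sqrt hn hp hB)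
      fun β _ hβ _ hβ1 W hWV _ =>
        (hE A hA𝒜).sum_integral_tailSq_le hd.le hn hp hX hB0 hD.le hWV (hA A hA𝒜).card_le hβ hβ1
  · intro q hq0
    refine ⟨_, hC0, fun n p hn hp Ω Ω' _ _ P _ P' _ X Y hXY B hB 𝒜 _ V Am hA hM1 hM2 hE => ?_⟩
    have hD1 := HighDimCLT.D1_pos hn hp hB
    have hD2 := HighDimCLT.D2_nonneg hn hp B q
    have hX : ∀ i, AEMeasurable (X i) P := fun i =>
      (hXY.memLp_X i).aestronglyMeasurable.aemeasurable
    have hB0 : 0 < B := by linarith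
    refine HighDimCLT.rho_le (by positivity) fun A hA𝒜 => ?_
    -- For `q ≤ 2` the rate is at least `1`; for `q > 2` the abstract bound is applied with `D = D1
    -- + D2`.
    rcases le_or_gt q 2 with hq | hq
    · refine (HighDimCLT.abs_measureReal_sub_le_one _ _).trans ?_
      have := HighDimCLT.one_le_D2 hn hp hB hq0 hq
      exact one_le_mul_of_one_le_of_one_le hC (by linarith)
    · refine hXY.abs_prob_sub_le ha hb hd hK hcut hκ0 hκ1 hκ hn hp hB (hA A hA𝒜) (hM1 A hA𝒜)
        (hM2 A hA𝒜) (fun i v hv => (hE A hA𝒜).integral_sq_le hq.le hB0 hX i hv)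
        (add_pos_of_pos_of_nonneg hD1 hD2) ?_
        fun β hβD hβ hD _ W hWV _ =>
          (hE A hA𝒜).sum_integral_tailSq_le hκ0 hκ1 hq hn hp hX hB0
            (add_pos_of_pos_of_nonneg hD1 hD2) hD (by linarith) hWV hβ hβD
      refine (HighDimCLT.mul_le_D1_pow_mul_sqrt hn hp hB).trans ?_
      gcongr
      linarith
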